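/- Let $F$ be an algebraically closed field of characteristic different from $2$, let $G$ be a finite abelian group with neutral element $e$, and let $R=M_n(F)=\bigoplus_{g\in G}R_g$ ($n\ge 1$) be $G$-graded. Let $\varphi$ be an $F$-linear antiautomorphism of $R$ with $\varphi(R_g)=R_g$ for all $g\in G$ and $\varphi^2|_{R_e}=\mathrm{Id}$. (a) As a $G$-graded algebra, $R$ is isomorphic to a tensor product $C\otimes D$ of the following kind. The algebra $C=M_m(F)$ has the elementary grading given by a tuple $(g_1,\dots,g_m)\in G^m$, so that the matrix unit $E_{ij}$ has degree $g_i^{-1}g_j$. The algebra $D$ equals $M_{n_1}(F)\otimes\cdots\otimes M_{n_r}(F)$ with all $n_l\ge 2$, where $M_{n_l}(F)$ has the $\varepsilon_l$-grading for a primitive $n_l$-th root of unity $\varepsilon_l$: its homogeneous components are spanned by the matrices $X_a^iX_b^j$ ($0\le i,j<n_l$) with $X_a=\mathrm{diag}(\varepsilon_l^{n_l-1},\dots,\varepsilon_l,1)$ and $X_b=E_{12}+E_{23}+\cdots+E_{n_l-1,n_l}+E_{n_l1}$, of degree $a_l^ib_l^j$, where $a_l,b_l\in G$ are such that the subgroup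 $T$ of $G$ generated by all of them is the direct product of the cyclic groups $\langle a_l\rangle,\langle b_l\rangle$ of order $n_l$ ($1\le l\le r$). Moreover $\mathrm{Supp}\,C\cap T=\{e\}$. (b) For every graded isomorphism of $R$ with such a tensor product, all $n_l$ are equal to $2$ (so that $D$ is a tensor product of copies of $M_2(F)$ with the $(-1)$-grading), and, after the isomorphism is composed with the conjugation by $P\otimes I$ for a suitable invertible $P\in C_e$ and $R$ is identified with $C\otimes D$ (realized by Kronecker products), the following holds. There are subalgebras $B_1,\dots,B_k$ of $C_e$, matrices $S_i\in B_iCB_i$, elements $Y_i$ of the center of $B_i$, and invertible matrices $Q_i\in D$ such that: 1. $C_e=B_1\oplus\cdots\oplus B_k$ as algebras, each $B_i\otimes I$ is $\varphi$-stable, and $B_i$ is $*$-simple for the involution $*$ given by $X^*\otimes I=\varphi(X\otimes I)$. 2. For each $i$ there is a number $p$ such that, for some listing of the rows and columns occupied by $B_i$, one of the following holds: $B_i$ is the algebra of all $p\times p$ matrices and $S_i=I_p$; or $B_i$ is the algebra of all $2p\times 2p$ matrices and $S_i=\begin{pmatrix}0&I_p\\-I_p&0\end{pmatrix}$; or $B_i=M_p(F)\oplus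 M_p(F)$ is the algebra of all block diagonal matrices $\mathrm{diag}(A_1,A_2)$ and $S_i=\begin{pmatrix}0&I_p\\I_p&0\end{pmatrix}$. With $S=S_1+\cdots+S_k$, the matrix $S$ is invertible and $\varphi(X\otimes I)=S^{-1}\,{}^tX\,S\otimes I$ for all $X\in C_e$. 3. ${}^tQ_i^{-1}Q_i=\pm I$ for each $i$, where the sign may depend on $i$. 4. The matrix $\Phi=S_1Y_1\otimes Q_1+\cdots+S_kY_k\otimes Q_k$ is invertible and $\varphi(X)=\Phi^{-1}\,{}^tX\,\Phi$ for all $X\in C\otimes D$. -/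

import Mathlib

open scoped Kronecker

namespace GradedMatrix

/-! The grading group is written additively; its neutral element is `0`. -/

/-! ### Elementary gradings, fine `ε`-gradings, tensor products of gradings -/

/-- The component of degree `h` of the elementary grading of a matrix algebra defined by the tuple
`g`: the matrix unit `E_ij` is homogeneous of degree `-g i + g j`. -/
def elementaryComponent (F : Type*) [Field F] {G : Type*} [AddCommGroup G] {ι : Type*}
    (g : ι → G) (h : G) : Submodule F (Matrix ι ι F) where
  carrier := {A | ∀ i j, -g i + g j ≠ h → A i j = 0}
  add_mem' := by
    intro A B hA hB i j hij
    simp [hA i j hij, hB i j hij]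
  zero_mem' := by
    intro i j _
    rfl
  smul_mem' := by
    intro c A hA i j hij
    simp [hA i j hij]

/-- The matrix `X_a = diag(ε^(n-1), ε^(n-2), …, 1)`. -/
def clockMatrix {F : Type*} [Field F] (n : ℕ) (ε : F) : Matrix (Fin n) (Fin n) F :=
  Matrix.diagonal fun i => ε ^ (n - 1 - (i : ℕ))

/-- The cyclic permutation matrix `X_b = E_12 + E_23 + … + E_(n-1,n) + E_n1`. -/
def shiftMatrix (F : Type*) [Field F] (n : ℕ) : Matrix (Fin n) (Fin n) F :=
  Matrix.of fun i j => if (j : ℕ) = ((i : ℕ) + 1) % n then 1 else 0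

/-- The basis element `X_a ^ i * X_b ^ j` of the `ε`-grading, of degree `(i, j)` in
`ℤ/n × ℤ/n`. -/
def epsilonElement {F : Type*} [Field F] (n : ℕ) (ε : F) (t : ZMod n × ZMod n) :
    Matrix (Fin n) (Fin n) F :=
  clockMatrix n ε ^ t.1.val * shiftMatrix F n ^ t.2.val

/-- The tensor (Kronecker) product `A 0 ⊗ A 1 ⊗ ⋯ ⊗ A (r-1)` of a family of square matrices. -/
def tensorMatrix {F : Type*} [Field F] {r : ℕ} {N : Fin r → ℕ}
    (A : ∀ l, Matrix (Fin (N l)) (Fin (N l)) F) :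
    Matrix (∀ l, Fin (N l)) (∀ l, Fin (N l)) F :=
  Matrix.of fun x y => ∏ l, A l (x l) (y l)

/-- The component of degree `h` of `M_{N 0}(F) ⊗ ⋯ ⊗ M_{N (r-1)}(F)`, where the `l`-th factor has
the `ε l`-grading and the element `t` of `∏ (ℤ/N l × ℤ/N l)` is identified with the element
`deg t` of the grading group. -/
def fineComponent {F : Type*} [Field F] {G : Type*} [AddCommGroup G] {r : ℕ} {N : Fin r → ℕ}
    (ε : Fin r → F) (deg : (∀ l, ZMod (N l) × ZMod (N l)) →+ G) (h : G) :
    Submodule F (Matrix (∀ l, Fin (N l)) (∀ l, Fin (N l)) F) :=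
  Submodule.span F
    {X | ∃ t, deg t = h ∧ X = tensorMatrix fun l => epsilonElement (N l) (ε l) (t l)}

/-- The component of degree `h` of the tensor product `C ⊗ D` (realized by Kronecker products) of
two graded matrix algebras: the sum of all `C_a ⊗ D_b` with `a + b = h`. -/
def tensorComponent {F : Type*} [Field F] {G : Type*} [AddCommGroup G] {ι κ : Type*}
    (C : G → Submodule F (Matrix ι ι F)) (D : G → Submodule F (Matrix κ κ F)) (h : G) :
    Submodule F (Matrix (ι × κ) (ι × κ) F) :=
  Submodule.span F {X | ∃ a b, a + b = h ∧ ∃ A ∈ C a, ∃ B ∈ D b, X = A ⊗ₖ B}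

/-- A graded isomorphism of a `G`-graded matrix algebra `R = M_n(F)` with a tensor product `C ⊗ D`,
where `C = M_m(F)` has an elementary grading, `D` is a tensor product of matrix algebras with
`ε`-gradings, and the supports of `C` and `D` meet in the neutral element only. -/
structure TensorDecomposition {F : Type*} [Field F] {G : Type*} [AddCommGroup G] {n : ℕ}
    (𝒜 : G → Submodule F (Matrix (Fin n) (Fin n) F)) where
  /-- the size of `C` -/
  m : ℕ
  /-- the tuple that defines the elementary grading of `C` -/
  tuple : Fin m → G
  /-- the number of tensor factors of `D` -/
  r : ℕ
  /-- the sizes of the tensor factors of `D` -/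
  N : Fin r → ℕ
  one_lt_N : ∀ l, 1 < N l
  /-- the roots of unity that define the gradings of the factors of `D` -/
  ε : Fin r → F
  isPrimitiveRoot : ∀ l, IsPrimitiveRoot (ε l) (N l)
  /-- the degrees of the basis elements of `D` -/
  deg : (∀ l, ZMod (N l) × ZMod (N l)) →+ G
  deg_injective : Function.Injective deg
  support_inter : ∀ h, elementaryComponent F tuple h ≠ ⊥ → h ∈ Set.range deg → h = 0
  /-- the isomorphism `R ≅ C ⊗ D` -/
  equiv : Matrix (Fin n) (Fin n) F ≃ₐ[F]
    Matrix (Fin m × ∀ l, Fin (N l)) (Fin m × ∀ l, Fin (N l)) F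
  map_component : ∀ h, (𝒜 h).map equiv.toLinearMap =
    tensorComponent (elementaryComponent F tuple) (fineComponent ε deg) h

namespace TensorDecomposition

variable {F : Type*} [Field F] {G : Type*} [AddCommGroup G] {n : ℕ}
  {𝒜 : G → Submodule F (Matrix (Fin n) (Fin n) F)}

/-- The matrix algebra `C`. -/
abbrev C (𝒟 : TensorDecomposition 𝒜) : Type _ := Matrix (Fin 𝒟.m) (Fin 𝒟.m) F

/-- The matrix algebra `D`. -/
abbrev D (𝒟 : TensorDecomposition 𝒜) : Type _ :=
  Matrix (∀ l, Fin (𝒟.N l)) (∀ l, Fin (𝒟.N l)) F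

/-- The matrix algebra `C ⊗ D`. -/
abbrev CD (𝒟 : TensorDecomposition 𝒜) : Type _ :=
  Matrix (Fin 𝒟.m × ∀ l, Fin (𝒟.N l)) (Fin 𝒟.m × ∀ l, Fin (𝒟.N l)) F

/-- The identity component `C_e` of `C`. -/
abbrev Ce (𝒟 : TensorDecomposition 𝒜) : Submodule F 𝒟.C := elementaryComponent F 𝒟.tuple 0

/-- The antiautomorphism `φ` of `R`, viewed as a map on `C ⊗ D` through the isomorphism
`X ↦ (P ⊗ I) (equiv X) (P ⊗ I)⁻¹`. -/
def transport (𝒟 : TensorDecomposition 𝒜) (P : 𝒟.Cˣ)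
    (φ : Matrix (Fin n) (Fin n) F ≃ₐ[F] (Matrix (Fin n) (Fin n) F)ᵐᵒᵖ) (X : 𝒟.CD) : 𝒟.CD :=
  ((P : 𝒟.C) ⊗ₖ (1 : 𝒟.D)) *
    𝒟.equiv (φ (𝒟.equiv.symm
      (((P⁻¹ : 𝒟.Cˣ) : 𝒟.C) ⊗ₖ (1 : 𝒟.D) * X * ((P : 𝒟.C) ⊗ₖ (1 : 𝒟.D))))).unop *
    (((P⁻¹ : 𝒟.Cˣ) : 𝒟.C) ⊗ₖ (1 : 𝒟.D))

end TensorDecomposition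

/-! ### `*`-simple subalgebras and their normal forms -/

section Blocks

variable {F : Type*} [Field F] {ι κ : Type*} [DecidableEq κ]

/-- `J ⊗ I` is stable under the map `ψ` of `C ⊗ D`. -/
def IsStable (ψ : Matrix (ι × κ) (ι × κ) F → Matrix (ι × κ) (ι × κ) F)
    (J : Submodule F (Matrix ι ι F)) : Prop :=
  ∀ X ∈ J, ∃ Y ∈ J, ψ (X ⊗ₖ (1 : Matrix κ κ F)) = Y ⊗ₖ (1 : Matrix κ κ F)

/-- The subalgebra `B` of `C` is `*`-simple, where `*` is given by `X* ⊗ I = ψ (X ⊗ I)`: it is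
`*`-stable, has nonzero multiplication, and its only `*`-stable two-sided ideals are `0`
and `B`. -/
structure IsStarSimple [Fintype ι]
    (ψ : Matrix (ι × κ) (ι × κ) F → Matrix (ι × κ) (ι × κ) F)
    (B : NonUnitalSubalgebra F (Matrix ι ι F)) : Prop where
  stable : IsStable ψ B.toSubmodule
  exists_mul_ne_zero : ∃ x ∈ B, ∃ y ∈ B, x * y ≠ 0
  eq_bot_or_eq : ∀ J : Submodule F (Matrix ι ι F), J ≤ B.toSubmodule →
    (∀ b ∈ B, ∀ x ∈ J, b * x ∈ J ∧ x * b ∈ J) → IsStable ψ J → J = ⊥ ∨ J = B.toSubmodule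

/-- The matrix of `M_m(F)` that has the block `M` in the rows and columns listed by `u`, and zeros
elsewhere. -/
def corner [DecidableEq ι] {α : Type*} [Fintype α] (u : α ↪ ι) (M : Matrix α α F) :
    Matrix ι ι F :=
  ∑ a, ∑ b, Matrix.single (u a) (u b) (M a b)

/-- The three normal forms of a pair `(B, S)`:
* `B` is the full algebra of `p × p` matrices in some rows and columns, and `S = I_p`;
* `B` is the full algebra of `2p × 2p` matrices, and `S` has the blocks `0, I_p, -I_p, 0`;
* `B = M_p ⊕ M_p` consists of the block diagonal matrices, and `S` has the
  blocks `0, I_p, I_p, 0`. -/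
def IsNormalBlock [Fintype ι] [DecidableEq ι] (B : NonUnitalSubalgebra F (Matrix ι ι F))
    (S : Matrix ι ι F) : Prop :=
  ∃ p : ℕ,
    (∃ u : Fin p ↪ ι, (B : Set (Matrix ι ι F)) = Set.range (corner u) ∧ S = corner u 1) ∨
    (∃ u : Fin p ⊕ Fin p ↪ ι, (B : Set (Matrix ι ι F)) = Set.range (corner u) ∧
      S = corner u (Matrix.fromBlocks 0 1 (-1) 0)) ∨
    (∃ u : Fin p ⊕ Fin p ↪ ι,
      (B : Set (Matrix ι ι F)) =
        {X | ∃ A₁ A₂ : Matrix (Fin p) (Fin p) F, X = corner u (Matrix.fromBlocks A₁ 0 0 A₂)} ∧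
      S = corner u (Matrix.fromBlocks 0 1 1 0))

end Blocks

end GradedMatrix

/-!
**Existence of the decomposition.** A matrix algebra `R` is prime, so a minimal graded right ideal
contains a homogeneous idempotent `e`, whose corner `e R e` is a graded division algebra with
identity component `F e` (`exists_divisionIdempotent`). A maximal orthogonal system of homogeneous
elements of `R e` and `e R` yields homogeneous matrix units whose centralizer is isomorphic to `e R
e`, hence spanned by invertible elements `X t`, one for each `t` in a subgroup `T` of `G`
(`nonempty_gradedMatrixUnits`). The commutation factors of these elements form an alternating
bicharacter of `T`. It is nondegenerate because `R` is central, so `T` has a symplectic basis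
(`exists_symplectic_basis`). Each hyperbolic pair of this basis gives, after scaling, two elements
that satisfy the relations of the clock and shift matrices; the centralizer is therefore a tensor
product of matrix algebras with `ε`-gradings, and `R ≅ C ⊗ D` (`nonempty_tensorDecomposition`). The
degrees that define the matrix units are chosen in a transversal of `T`, which gives the condition
on the supports.

**Normal form of the antiautomorphism.** By Skolem–Noether an antiautomorphism of `C ⊗ D` is `Z ↦
Φ⁻¹ Zᵀ Φ`. The supports of `C` and `D` meet in the neutral element only, so the identity component
is `C_e ⊗ I`, where `C_e` is the algebra of matrices that are block diagonal for the partition of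
the indices into classes of equal degree. The antiautomorphism induces an involution on `C_e`.
Slices of `Φ`, one for each class, form an invertible matrix `A` with `X* = A⁻¹ Xᵀ A` for `X ∈ C_e`
(`exists_intertwiner`). The involution permutes the classes by an involution `σ`
(`exists_class_involution`), and `A` can be scaled on the classes such that its block on a class
fixed by `σ` is symmetric or skew-symmetric, while its blocks on two interchanged classes are
transposes of each other. The normal forms of bilinear forms then yield a congruence by an element
of `C_e` that takes `A` to `S = S_1 + ⋯ + S_k`, with one summand for each orbit of `σ`
(`exists_normal_form`); the matrices supported on an orbit form the `*`-simple algebra `B_v`.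

After this change of basis `(S⁻¹ ⊗ I) Φ` centralizes `C_e ⊗ I`, so the block of `Φ` in the position
`(i, j)` is `S_ij q(w)`, where `w` is the class of `j` (`exists_block_scalars`). A comparison of
degrees in `Zᵀ Φ = Φ φ(Z)` for `Z = E_ij ⊗ X_t` shows that `X ↦ q(w)⁻¹ Xᵀ q(w)` multiplies every
basis element `X_t` of `D` by a scalar, and that `q(w)` and `q(σ w)` are proportional
(`exists_transpose_mul_block_scalar`). The first statement applied to `X_a X_b = ε X_b X_a` gives
`ε² = 1`, that is, `n_l = 2` (`eq_two_of_transpose_mul`). Then each `X_t` has a scalar square, the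
scalars are signs, and `q(w)` is symmetric or skew-symmetric (`transpose_inv_mul_eq_one_or`). The
second statement gives `Φ = ∑ S_v Y_v ⊗ Q_v` with one matrix `Q_v = q(w)` for each orbit, where the
factors of proportionality are collected in `Y_v` (`exists_sum_kronecker`).
-/

namespace GradedMatrix

/-! ### The homogeneous basis of a tensor product of `ε`-gradings -/

section FineBasis

open Matrix

section WeylPair

variable {F : Type*} [Field F] {A : Type*} [Ring A] [Algebra F A]

theorem pow_val_add_val {n : ℕ} [NeZero n] {a : A} (ha : a ^ n = 1) (s t : ZMod n) :
    a ^ (s + t).val = a ^ s.val * a ^ t.val := by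
  rw [ZMod.val_add, ← pow_add, ← pow_eq_pow_mod _ ha]

theorem pow_mul_pow_of_mul_eq_smul {a b : A} {ε : F} (hε : ε ≠ 0) (h : a * b = ε • (b * a))
    (j k : ℕ) : b ^ j * a ^ k = (ε⁻¹) ^ (j * k) • (a ^ k * b ^ j) := by
  have h1 : b * a = ε⁻¹ • (a * b) := by rw [h, smul_smul, inv_mul_cancel₀ hε, one_smul]
  have h2 : ∀ k, b * a ^ k = ε⁻¹ ^ k • (a ^ k * b) := by
    intro k
    induction k with
    | zero => simp
    | succ k ih =>
      rw [pow_succ, ← mul_assoc, ih, smul_mul_assoc, mul_assoc, h1, mul_smul_comm, smul_smul,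
        ← pow_succ, mul_assoc]
  induction j with
  | zero => simp
  | succ j ih =>
    rw [pow_succ', mul_assoc, ih, mul_smul_comm, ← mul_assoc, h2, smul_mul_assoc, smul_smul,
      mul_assoc, ← pow_add, ← pow_succ']
    congr 2
    ring

/-- If `a ^ n = b ^ n = 1` and `a * b = ε • (b * a)`, the monomials `a ^ i * b ^ j` multiply like
the elements of a twisted group algebra of `ℤ/n × ℤ/n`. -/
theorem weyl_mul {n : ℕ} [NeZero n] {a b : A} {ε : F} (hε : ε ≠ 0) (ha : a ^ n = 1)
    (hb : b ^ n = 1) (h : a * b = ε • (b * a)) (s t : ZMod n × ZMod n) :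
    (a ^ s.1.val * b ^ s.2.val) * (a ^ t.1.val * b ^ t.2.val) =
      (ε⁻¹) ^ (s.2.val * t.1.val) • (a ^ (s + t).1.val * b ^ (s + t).2.val) := by
  rw [Prod.fst_add, Prod.snd_add, pow_val_add_val ha, pow_val_add_val hb,
    show ∀ x y z w : A, (x * y) * (z * w) = x * (y * z) * w by intros; simp only [mul_assoc],
    pow_mul_pow_of_mul_eq_smul hε h]
  simp only [mul_smul_comm, smul_mul_assoc, mul_assoc]

end WeylPair

section ClockShift

variable {F : Type*} [Field F] {n : ℕ} {ε : F}

theorem clockMatrix_pow (i : ℕ) :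
    clockMatrix n ε ^ i = diagonal fun p : Fin n => ε ^ ((n - 1 - (p : ℕ)) * i) := by
  rw [clockMatrix, diagonal_pow]
  congr 1
  funext p
  simp [pow_mul]

theorem shiftMatrix_pow_apply [NeZero n] (j : ℕ) (p q : Fin n) :
    (shiftMatrix F n ^ j) p q = if (q : ℕ) = (p + j) % n then 1 else 0 := by
  induction j generalizing q with
  | zero => simp [Matrix.one_apply, Fin.ext_iff, eq_comm, Nat.mod_eq_of_lt p.2]
  | succ j ih =>
    rw [pow_succ, mul_apply]
    simp only [ih]
    have hr : (p + j) % n < n := Nat.mod_lt _ (NeZero.pos n)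
    rw [Finset.sum_eq_single ⟨(p + j) % n, hr⟩]
    · simp [shiftMatrix, add_assoc]
    · intro r _ hr'
      rw [if_neg, zero_mul]
      exact fun h => hr' (Fin.ext h)
    · simp

theorem clockMatrix_pow_self (hε : ε ^ n = 1) : clockMatrix n ε ^ n = 1 := by
  rw [clockMatrix_pow, ← diagonal_one]
  congr 1
  funext p
  rw [mul_comm, pow_mul, hε, one_pow]

theorem shiftMatrix_pow_self [NeZero n] : shiftMatrix F n ^ n = 1 := by
  ext p q
  rw [shiftMatrix_pow_apply]
  simp [Matrix.one_apply, Fin.ext_iff, eq_comm, Nat.mod_eq_of_lt p.2]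

theorem clockMatrix_mul_shiftMatrix (hε : ε ^ n = 1) :
    clockMatrix n ε * shiftMatrix F n = ε • (shiftMatrix F n * clockMatrix n ε) := by
  ext p q
  simp only [clockMatrix, shiftMatrix, diagonal_mul, Matrix.smul_apply, mul_diagonal, of_apply,
    smul_eq_mul]
  split_ifs with h
  · rw [mul_one, one_mul, ← pow_succ']
    by_cases hp : (p : ℕ) + 1 = n
    · rw [hp, Nat.mod_self] at h
      have : n - 1 - (q : ℕ) + 1 = n := by omega
      rw [this, hε]
      have : n - 1 - (p : ℕ) = 0 := by omega
      rw [this, pow_zero]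
    · rw [Nat.mod_eq_of_lt (by omega)] at h
      congr 1
      omega
  · simp

theorem epsilonElement_apply [NeZero n] (t : ZMod n × ZMod n) (p q : Fin n) :
    epsilonElement n ε t p q =
      ε ^ ((n - 1 - (p : ℕ)) * t.1.val) * if (q : ℕ) = (p + t.2.val) % n then 1 else 0 := by
  rw [epsilonElement, clockMatrix_pow, diagonal_mul, shiftMatrix_pow_apply]

theorem sum_zmod_pow_val [NeZero n] {ζ : F} (hζ : ζ ^ n = 1) (h1 : ζ ≠ 1) :
    ∑ i : ZMod n, ζ ^ i.val = 0 := by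
  have h : ∑ i : ZMod n, ζ ^ i.val = ∑ i ∈ Finset.range n, ζ ^ i := by
    refine Finset.sum_bij (fun i _ => i.val) (fun i _ => Finset.mem_range.2 (ZMod.val_lt i))
      (fun i _ j _ h => ZMod.val_injective n h)
      (fun b hb => ⟨(b : ZMod n), Finset.mem_univ _,
        ZMod.val_cast_of_lt (Finset.mem_range.1 hb)⟩) (fun i _ => rfl)
  rw [h, geom_sum_eq h1, hζ, sub_self, zero_div]

/-- Discrete Fourier inversion: the matrix units are combinations of the monomials in the clock and
shift matrices. -/
theorem single_eq_sum_epsilonElement [NeZero n] (hε : IsPrimitiveRoot ε n) (p q : Fin n) :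
    ∃ c : ZMod n × ZMod n → F,
      ∀ p' q', single p q (1 : F) p' q' = ∑ t, c t * epsilonElement n ε t p' q' := by
  have hn : (n : F) ≠ 0 := (hε.neZero').out
  have hε0 : ε ≠ 0 := hε.ne_zero (NeZero.ne n)
  refine ⟨fun t => if (q : ℕ) = (p + t.2.val) % n then
    (n : F)⁻¹ * ((ε ^ (n - 1 - (p : ℕ)))⁻¹) ^ t.1.val else 0, fun p' q' => ?_⟩
  simp only [epsilonElement_apply]
  rw [Fintype.sum_prod_type]
  have key : ∀ i j : ZMod n,
      (if (q : ℕ) = (p + j.val) % n then (n : F)⁻¹ * ((ε ^ (n - 1 - (p : ℕ)))⁻¹) ^ i.val else 0) *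
        (ε ^ ((n - 1 - (p' : ℕ)) * i.val) * if (q' : ℕ) = (p' + j.val) % n then 1 else 0) =
      ((n : F)⁻¹ * (ε ^ (n - 1 - (p' : ℕ)) * (ε ^ (n - 1 - (p : ℕ)))⁻¹) ^ i.val) *
        ((if (q : ℕ) = (p + j.val) % n then 1 else 0) *
          (if (q' : ℕ) = (p' + j.val) % n then 1 else 0)) := by
    intro i j
    rw [mul_pow, pow_mul]
    split_ifs <;> ring
  simp only [key]
  simp only [← Finset.mul_sum, ← Finset.sum_mul]
  by_cases hp : p = p'
  · subst hp
    rw [mul_inv_cancel₀ (pow_ne_zero _ hε0)]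
    simp only [one_pow, Finset.sum_const, Finset.card_univ, ZMod.card, nsmul_eq_mul, mul_one]
    rw [inv_mul_cancel₀ hn, one_mul]
    have hsol : ∀ j : ZMod n, (q : ℕ) = (p + j.val) % n ↔ j = ((q : ℕ) : ZMod n) - ((p : ℕ)) := by
      intro j
      rw [eq_sub_iff_add_eq, ← (ZMod.val_injective n).eq_iff, ZMod.val_add, ZMod.val_natCast,
        ZMod.val_natCast, Nat.mod_eq_of_lt p.2, Nat.mod_eq_of_lt q.2, add_comm, eq_comm]
    rw [Finset.sum_eq_single (((q : ℕ) : ZMod n) - ((p : ℕ)))]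
    · have h := (hsol _).2 rfl
      rw [if_pos h, one_mul, ← h]
      simp [single_apply, Fin.ext_iff, eq_comm]
    · intro j _ hj
      rw [if_neg (fun h => hj ((hsol j).1 h)), zero_mul]
    · simp
  · rw [single_apply, if_neg (fun h => hp h.1), sum_zmod_pow_val, mul_zero, zero_mul]
    · have h : ∀ k, (ε ^ k) ^ n = 1 := fun k => by
        rw [← pow_mul, mul_comm, pow_mul, hε.pow_eq_one, one_pow]
      rw [mul_pow, inv_pow, h, h, inv_one, one_mul]
    · intro h
      rw [mul_inv_eq_one₀ (pow_ne_zero _ hε0)] at h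
      have h2 := hε.pow_inj (by omega) (by omega) h
      exact hp (Fin.ext (by omega))

end ClockShift

section TensorBasis

variable {F : Type*} [Field F] {r : ℕ} {N : Fin r → ℕ}

theorem tensorMatrix_mul (A B : ∀ l, Matrix (Fin (N l)) (Fin (N l)) F) :
    tensorMatrix A * tensorMatrix B = tensorMatrix fun l => A l * B l := by
  ext x y
  simp only [tensorMatrix, mul_apply, of_apply, ← Finset.prod_mul_distrib]
  rw [Fintype.prod_sum]

theorem tensorMatrix_smul (c : Fin r → F) (A : ∀ l, Matrix (Fin (N l)) (Fin (N l)) F) :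
    (tensorMatrix fun l => c l • A l) = (∏ l, c l) • tensorMatrix A := by
  ext x y
  simp [tensorMatrix, Finset.prod_mul_distrib]

theorem tensorMatrix_one : tensorMatrix (fun l => (1 : Matrix (Fin (N l)) (Fin (N l)) F)) = 1 := by
  ext x y
  simp only [tensorMatrix, of_apply, one_apply]
  by_cases h : x = y
  · subst h; simp
  · rw [if_neg h]
    obtain ⟨l, hl⟩ := Function.ne_iff.1 h
    exact Finset.prod_eq_zero (Finset.mem_univ l) (by simp [hl])

/-- The basis element of degree `t` of the tensor product of the algebras `M_{N l}(F)` with their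
`ε l`-gradings. -/
def fineElement (ε : Fin r → F) (t : ∀ l, ZMod (N l) × ZMod (N l)) :
    Matrix (∀ l, Fin (N l)) (∀ l, Fin (N l)) F :=
  tensorMatrix fun l => epsilonElement (N l) (ε l) (t l)

/-- The structure constants of the basis `fineElement ε`: the product of the basis elements of the
degrees `s` and `t` is `twist ε s t` times the basis element of degree `s + t`. -/
def twist (ε : Fin r → F) (s t : ∀ l, ZMod (N l) × ZMod (N l)) : F :=
  ∏ l, (ε l)⁻¹ ^ ((s l).2.val * (t l).1.val)

variable {ε : Fin r → F}

theorem twist_ne_zero (hε : ∀ l, ε l ≠ 0) (s t : ∀ l, ZMod (N l) × ZMod (N l)) :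
    twist ε s t ≠ 0 :=
  Finset.prod_ne_zero_iff.2 fun l _ => pow_ne_zero _ (inv_ne_zero (hε l))

theorem epsilonElement_mul {n : ℕ} [NeZero n] {ε : F} (hε : IsPrimitiveRoot ε n)
    (s t : ZMod n × ZMod n) :
    epsilonElement n ε s * epsilonElement n ε t =
      (ε⁻¹) ^ (s.2.val * t.1.val) • epsilonElement n ε (s + t) :=
  weyl_mul (hε.ne_zero (NeZero.ne n)) (clockMatrix_pow_self hε.pow_eq_one) shiftMatrix_pow_self
    (clockMatrix_mul_shiftMatrix hε.pow_eq_one) s t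

theorem epsilonElement_zero {n : ℕ} [NeZero n] {ε : F} : epsilonElement n ε 0 = 1 := by
  simp [epsilonElement]

theorem fineElement_zero [∀ l, NeZero (N l)] : fineElement (N := N) ε 0 = 1 := by
  simp [fineElement, epsilonElement_zero, tensorMatrix_one]

theorem fineElement_mul [∀ l, NeZero (N l)] (hε : ∀ l, IsPrimitiveRoot (ε l) (N l))
    (s t : ∀ l, ZMod (N l) × ZMod (N l)) :
    fineElement ε s * fineElement ε t = twist ε s t • fineElement ε (s + t) := by
  simp only [fineElement, tensorMatrix_mul, epsilonElement_mul (hε _), tensorMatrix_smul, twist]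
  rfl

theorem span_fineElement [∀ l, NeZero (N l)] (hε : ∀ l, IsPrimitiveRoot (ε l) (N l)) :
    Submodule.span F (Set.range (fineElement (N := N) ε)) = ⊤ := by
  rw [eq_top_iff]
  intro M _
  rw [matrix_eq_sum_single M]
  refine Submodule.sum_mem _ fun x _ => Submodule.sum_mem _ fun y _ => ?_
  choose c hc using fun l => single_eq_sum_epsilonElement (hε l) (x l) (y l)
  have h : single x y (M x y) =
      ∑ t : ∀ l, ZMod (N l) × ZMod (N l), (M x y * ∏ l, c l (t l)) • fineElement ε t := by
    have h1 : ∀ x' y', single x y (M x y) x' y' =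
        M x y * ∏ l, single (x l) (y l) (1 : F) (x' l) (y' l) := by
      intro x' y'
      simp only [single_apply]
      split_ifs with h
      · obtain ⟨rfl, rfl⟩ := h
        simp
      · have : ∃ l, ¬ (x l = x' l ∧ y l = y' l) := by
          by_contra! h'
          exact h ⟨funext fun l => (h' l).1, funext fun l => (h' l).2⟩
        obtain ⟨l, hl⟩ := this
        rw [Finset.prod_eq_zero (Finset.mem_univ l) (by simp [hl]), mul_zero]
    ext x' y'
    rw [h1]
    simp only [hc, Matrix.sum_apply, Matrix.smul_apply, smul_eq_mul, fineElement, tensorMatrix,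
      of_apply]
    rw [Fintype.prod_sum, Finset.mul_sum]
    refine Finset.sum_congr rfl fun t _ => ?_
    rw [Finset.prod_mul_distrib, mul_assoc]
  rw [h]
  exact Submodule.sum_mem _ fun t _ => Submodule.smul_mem _ _ (Submodule.subset_span ⟨t, rfl⟩)

/-- The elements `fineElement ε t` form a basis of the tensor product of matrix algebras. -/
noncomputable def fineBasis [∀ l, NeZero (N l)] (hε : ∀ l, IsPrimitiveRoot (ε l) (N l)) :
    Module.Basis (∀ l, ZMod (N l) × ZMod (N l)) F
      (Matrix (∀ l, Fin (N l)) (∀ l, Fin (N l)) F) :=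
  basisOfTopLeSpanOfCardEqFinrank (fineElement ε) (span_fineElement hε).ge (by
    rw [Module.finrank_matrix, Module.finrank_self, mul_one]
    simp [Fintype.card_pi, Fintype.card_prod, ZMod.card, Finset.prod_mul_distrib])

theorem fineBasis_apply [∀ l, NeZero (N l)] (hε : ∀ l, IsPrimitiveRoot (ε l) (N l))
    (t : ∀ l, ZMod (N l) × ZMod (N l)) : fineBasis hε t = fineElement ε t := by
  simp [fineBasis]

end TensorBasis

end FineBasis

/-! ### Symplectic bases of finite abelian groups with a bicharacter -/

section Bicharacter

theorem nsmul_val_add {T : Type*} [AddCommGroup T] {n : ℕ} [NeZero n] {a : T} (ha : n • a = 0)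
    (s t : ZMod n) : (s + t).val • a = s.val • a + t.val • a := by
  have h : ∀ k : ℕ, (k % n) • a = k • a := fun k => by
    conv_rhs => rw [← Nat.mod_add_div k n, add_nsmul, mul_nsmul, ha, nsmul_zero,
      add_zero]
  rw [ZMod.val_add, h, add_nsmul]

/-- An alternating bicharacter of the abelian group `T` with values in the field `F`. Additivity in
the second argument follows from `add_left` and `swap`. -/
structure IsBicharacter {F : Type*} [Field F] {T : Type*} [AddCommGroup T] (β : T → T → Fˣ) :
    Prop where
  add_left : ∀ s t u, β (s + t) u = β s u * β t u
  self : ∀ t, β t t = 1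
  swap : ∀ s t, β s t * β t s = 1

variable {F : Type*} [Field F]

namespace IsBicharacter

variable {T : Type*} [AddCommGroup T] {β : T → T → Fˣ} (hβ : IsBicharacter β)
include hβ

theorem eq_inv_swap (s t : T) : β s t = (β t s)⁻¹ := eq_inv_of_mul_eq_one_left (hβ.swap s t)

theorem add_right (s t u : T) : β s (t + u) = β s t * β s u := by
  rw [hβ.eq_inv_swap, hβ.add_left, mul_inv, ← hβ.eq_inv_swap, ← hβ.eq_inv_swap]

theorem zero_left (u : T) : β 0 u = 1 := by
  have h := hβ.add_left 0 0 u
  rwa [add_zero, left_eq_mul] at h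

theorem zero_right (u : T) : β u 0 = 1 := by
  rw [hβ.eq_inv_swap, hβ.zero_left, inv_one]

theorem nsmul_left (k : ℕ) (s u : T) : β (k • s) u = β s u ^ k := by
  induction k with
  | zero => simp [hβ.zero_left]
  | succ k ih => rw [succ_nsmul, hβ.add_left, ih, pow_succ]

theorem nsmul_right (k : ℕ) (s u : T) : β s (k • u) = β s u ^ k := by
  rw [hβ.eq_inv_swap, hβ.nsmul_left, hβ.eq_inv_swap s u, inv_pow]

/-- A nondegenerate alternating bicharacter on a nontrivial finite abelian group has a hyperbolic
pair: `a` is an element of maximal order, and `b` is such that `β a b` generates the image of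
`β a`. -/
theorem exists_hyperbolic_pair [Finite T] [Nontrivial T]
    (hnd : ∀ s, (∀ t, β s t = 1) → s = 0) :
    ∃ n : ℕ, 1 < n ∧ ∃ a b : T, n • a = 0 ∧ (∀ t : T, n • t = 0) ∧
      IsPrimitiveRoot (β a b : F) n := by
  obtain ⟨a, ha⟩ := AddMonoid.exists_addOrderOf_eq_exponent
    (AddMonoid.ExponentExists.of_finite (G := T))
  set n := AddMonoid.exponent T with hn
  have hexp : ∀ t : T, n • t = 0 := AddMonoid.exponent_nsmul_eq_zero
  have hn0 : n ≠ 0 := AddMonoid.exponent_ne_zero_of_finite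
  have hn1 : n ≠ 1 := fun h => by
    obtain ⟨x, hx⟩ := exists_ne (0 : T)
    have := hexp x
    rw [h, one_nsmul] at this
    exact hx this
  let χ : Multiplicative T →* Fˣ :=
    { toFun := fun t => β a t.toAdd
      map_one' := hβ.zero_right a
      map_mul' := fun s t => hβ.add_right a s.toAdd t.toAdd }
  have : Finite χ.range := Finite.of_surjective χ.rangeRestrict χ.rangeRestrict_surjective
  obtain ⟨⟨_, b, rfl⟩, hb⟩ := IsCyclic.exists_generator (α := χ.range)
  refine ⟨n, by omega, a, b.toAdd, hexp a, hexp, ?_⟩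
  rw [IsPrimitiveRoot.coe_units_iff]
  have hpow : β a b.toAdd ^ n = 1 := by rw [← hβ.nsmul_left, hexp, hβ.zero_left]
  refine ⟨hpow, fun k hk => ?_⟩
  rw [← ha]
  refine addOrderOf_dvd_of_nsmul_eq_zero (hnd _ fun t => ?_)
  obtain ⟨z, hz⟩ := Subgroup.mem_zpowers_iff.1 (hb ⟨χ (.ofAdd t), _, rfl⟩)
  have hz' : β a b.toAdd ^ z = β a t := congrArg Subtype.val hz
  rw [hβ.nsmul_left, ← hz', ← zpow_natCast, zpow_comm, zpow_natCast, hk, _root_.one_zpow]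

end IsBicharacter

/-- Every nondegenerate alternating bicharacter on a finite abelian group has a symplectic basis:
hyperbolic planes are split off one after the other, by induction on a bound `c` for the order of
the group. -/
theorem exists_symplectic_basis (c : ℕ) : ∀ {T : Type*} [AddCommGroup T] [Finite T]
    {β : T → T → Fˣ} (_ : IsBicharacter β) (_ : ∀ s, (∀ t, β s t = 1) → s = 0)
    (_ : Nat.card T ≤ c),
    ∃ (r : ℕ) (N : Fin r → ℕ) (a b : Fin r → T), (∀ l, 1 < N l) ∧
      (∀ l, N l • a l = 0) ∧ (∀ l, N l • b l = 0) ∧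
      (∀ l, IsPrimitiveRoot (β (a l) (b l) : F) (N l)) ∧
      (∀ l l', β (a l) (a l') = 1) ∧ (∀ l l', β (b l) (b l') = 1) ∧
      (∀ l l', l ≠ l' → β (a l) (b l') = 1) ∧
      ∀ t, ∃ i j : Fin r → ℕ, (∀ l, i l < N l) ∧ (∀ l, j l < N l) ∧
        t = ∑ l, (i l • a l + j l • b l) := by
  induction c with
  | zero =>
    intro T _ _ β _ _ hc
    have := Nat.card_pos (α := T)
    omega
  | succ c ih =>
    intro T _ _ β hβ hnd hc
    rcases subsingleton_or_nontrivial T with hT | hT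
    · exact ⟨0, Fin.elim0, Fin.elim0, Fin.elim0, fun l => l.elim0, fun l => l.elim0,
        fun l => l.elim0, fun l => l.elim0, fun l => l.elim0, fun l => l.elim0, fun l => l.elim0,
        fun t => ⟨Fin.elim0, Fin.elim0, fun l => l.elim0, fun l => l.elim0,
          Subsingleton.elim _ _⟩⟩
    obtain ⟨n, hn, a, b, ha, hexp, hε⟩ := hβ.exists_hyperbolic_pair hnd
    have : NeZero n := ⟨by omega⟩
    -- the orthogonal complement of the hyperbolic plane spanned by `a` and `b`
    let K : AddSubgroup T :=
      { carrier := {t | β t a = 1 ∧ β t b = 1}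
        add_mem' := fun {s t} hs ht => by
          simp only [Set.mem_ofPred_eq] at hs ht ⊢
          simp [hβ.add_left, hs, ht]
        zero_mem' := ⟨hβ.zero_left a, hβ.zero_left b⟩
        neg_mem' := fun {s} hs => by
          simp only [Set.mem_ofPred_eq] at hs ⊢
          have h1 := hβ.add_left s (-s) a
          have h2 := hβ.add_left s (-s) b
          rw [add_neg_cancel, hβ.zero_left, hs.1, one_mul] at h1
          rw [add_neg_cancel, hβ.zero_left, hs.2, one_mul] at h2
          exact ⟨h1.symm, h2.symm⟩ }
    have hdec : ∀ t : T, ∃ i < n, ∃ j < n, ∃ k ∈ K, t = i • a + j • b + k := by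
      intro t
      have hroot : ∀ u : Fˣ, u ^ n = 1 → ∃ i < n, β a b ^ i = u := by
        intro u hu
        obtain ⟨i, hi, h⟩ := hε.eq_pow_of_pow_eq_one (ξ := (u : F))
          (by rw [← Units.val_pow_eq_pow_val, hu, Units.val_one])
        exact ⟨i, hi, Units.ext (by rw [Units.val_pow_eq_pow_val, h])⟩
      obtain ⟨i, hi, h1⟩ := hroot (β t b) (by rw [← hβ.nsmul_right, hexp, hβ.zero_right])
      obtain ⟨j, hj, h2⟩ := hroot (β a t) (by rw [← hβ.nsmul_right, hexp, hβ.zero_right])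
      obtain ⟨k, hk⟩ : ∃ k, t = i • a + j • b + k := ⟨t - (i • a + j • b), by abel⟩
      refine ⟨i, hi, j, hj, k, ⟨?_, ?_⟩, hk⟩
      · rw [hk, hβ.add_right, hβ.add_right, hβ.nsmul_right, hβ.nsmul_right, hβ.self, one_pow,
          one_mul, left_eq_mul] at h2
        rw [hβ.eq_inv_swap, h2, inv_one]
      · rwa [hk, hβ.add_left, hβ.add_left, hβ.nsmul_left, hβ.nsmul_left, hβ.self, one_pow,
          mul_one, left_eq_mul] at h1
    have haK : a ∉ K := fun h => by
      have h2 : β a b = 1 := h.2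
      rw [h2, Units.val_one] at hε
      exact hn.ne' (hε.unique IsPrimitiveRoot.one)
    have hcard : Nat.card K ≤ c := by
      have : Nat.card K < Nat.card T := by
        have hs : (K : Set T) ⊂ Set.univ :=
          (Set.ssubset_univ_iff).2 fun h => haK (by
            have := Set.mem_univ a
            rwa [← h] at this)
        have := Set.ncard_lt_ncard hs
        rwa [Set.ncard_univ] at this
      omega
    have hβK : IsBicharacter fun s t : K => β s t :=
      ⟨fun s t u => hβ.add_left s t u, fun t => hβ.self t, fun s t => hβ.swap s t⟩
    have hndK : ∀ s : K, (∀ t : K, β s t = 1) → s = 0 := by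
      intro s hs
      refine Subtype.ext (hnd s fun t => ?_)
      obtain ⟨i, -, j, -, k, hk, rfl⟩ := hdec t
      rw [hβ.add_right, hβ.add_right, hβ.nsmul_right, hβ.nsmul_right, s.2.1, s.2.2, hs ⟨k, hk⟩]
      simp
    obtain ⟨r, N, a', b', hN, ha', hb', hprim, haa, hbb, hab, hspan⟩ := ih hβK hndK hcard
    have hl : ∀ k : K, β k a = 1 ∧ β k b = 1 := fun k => k.2
    have hr : ∀ k : K, β a k = 1 ∧ β b k = 1 := fun k => by
      rw [hβ.eq_inv_swap a, hβ.eq_inv_swap b, (hl k).1, (hl k).2, inv_one]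
      exact ⟨rfl, rfl⟩
    refine ⟨r + 1, Fin.cons n N, Fin.cons a fun l => (a' l : T), Fin.cons b fun l => (b' l : T),
      ?_, ?_, ?_, ?_, ?_, ?_, ?_, ?_⟩
    · exact Fin.cases hn hN
    · exact Fin.cases ha fun l => by simpa using congrArg Subtype.val (ha' l)
    · exact Fin.cases (hexp b) fun l => by simpa using congrArg Subtype.val (hb' l)
    · exact Fin.cases hε hprim
    · exact Fin.cases (Fin.cases (hβ.self a) fun l => (hr _).1)
        fun l => Fin.cases (hl _).1 (haa l)
    · exact Fin.cases (Fin.cases (hβ.self b) fun l => (hr _).2)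
        fun l => Fin.cases (hl _).2 (hbb l)
    · refine Fin.cases (Fin.cases (fun h => absurd rfl h) fun l _ => (hr _).1)
        fun l => Fin.cases (fun _ => (hl _).2) fun l' h => hab l l' fun h' => h (by rw [h'])
    · intro t
      obtain ⟨i, hi, j, hj, k, hk, rfl⟩ := hdec t
      obtain ⟨i', j', hi', hj', h⟩ := hspan ⟨k, hk⟩
      refine ⟨Fin.cons i i', Fin.cons j j', Fin.cases hi hi', Fin.cases hj hj', ?_⟩
      rw [Fin.sum_univ_succ]
      simpa using congrArg Subtype.val h

end Bicharacter

/-! ### Homogeneous matrix units in a graded prime algebra -/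

section GradedStructure

variable {F : Type*} [Field F] {G : Type*} [AddCommGroup G] [DecidableEq G] {R : Type*} [Ring R]
  [Algebra F R] (𝒜 : G → Submodule F R) [GradedAlgebra 𝒜]

theorem exists_homogeneous_mul_ne_zero {a b r : R} (h : a * r * b ≠ 0) :
    ∃ g, ∃ s ∈ 𝒜 g, a * s * b ≠ 0 := by
  classical
  by_contra! H
  apply h
  rw [← DirectSum.sum_support_decompose 𝒜 r, Finset.mul_sum, Finset.sum_mul]
  exact Finset.sum_eq_zero fun g _ => H g _ (SetLike.coe_mem _)

theorem exists_homogeneous_factor {a c w : R} {g g' : G} (ha : a ∈ 𝒜 g) (hc : c ∈ 𝒜 (g + g'))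
    (h : a * w = c) : ∃ w' ∈ 𝒜 g', a * w' = c := by
  refine ⟨DirectSum.decompose 𝒜 w g', SetLike.coe_mem _, ?_⟩
  rw [← DirectSum.coe_decompose_mul_add_of_left_mem 𝒜 ha, h, DirectSum.decompose_of_mem_same 𝒜 hc]

/-- A homogeneous idempotent `e` such that `e R e` is a graded division algebra: each nonzero
homogeneous element of the corner has a homogeneous inverse in the corner. -/
structure IsDivisionIdempotent (e : R) : Prop where
  mem : e ∈ 𝒜 0
  ne_zero : e ≠ 0
  idem : e * e = e
  inv : ∀ g, ∀ d ∈ 𝒜 g, e * d = d → d * e = d → d ≠ 0 →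
    ∃ f ∈ 𝒜 (-g), e * f = f ∧ f * e = f ∧ d * f = e ∧ f * d = e

/-- A graded algebra of finite dimension contains a homogeneous element `x` that generates a minimal
graded right ideal, namely one for which the dimension of `x R` is minimal. -/
theorem exists_minimal_homogeneous [FiniteDimensional F R] [Nontrivial R] :
    ∃ x : R, ∃ g, x ∈ 𝒜 g ∧ x ≠ 0 ∧
      ∀ h, ∀ r ∈ 𝒜 h, x * r ≠ 0 → ∃ s, x = x * r * s := by
  classical
  have hex : ∃ k : ℕ, ∃ x : R, ∃ g, x ∈ 𝒜 g ∧ x ≠ 0 ∧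
      Module.finrank F (LinearMap.range (LinearMap.mulLeft F x)) = k :=
    ⟨_, 1, 0, SetLike.GradedOne.one_mem, one_ne_zero, rfl⟩
  obtain ⟨x, g, hx, hx0, hk⟩ := Nat.find_spec hex
  refine ⟨x, g, hx, hx0, fun h r hr hne => ?_⟩
  have hle : LinearMap.range (LinearMap.mulLeft F (x * r)) ≤
      LinearMap.range (LinearMap.mulLeft F x) := by
    rintro _ ⟨s, rfl⟩
    exact ⟨r * s, by simp⟩
  have hge := Nat.find_min' hex
    ⟨x * r, g + h, SetLike.GradedMul.mul_mem hx hr, hne, rfl⟩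
  have heq := Submodule.eq_of_le_of_finrank_le hle (by rw [hk]; exact hge)
  have : x ∈ LinearMap.range (LinearMap.mulLeft F (x * r)) := by
    rw [heq]
    exact ⟨1, by simp⟩
  obtain ⟨s, hs⟩ := this
  exact ⟨s, hs.symm⟩

/-- A minimal graded right ideal `x R` of a graded prime algebra contains a homogeneous idempotent
`x w`. Its corner is a graded division algebra, by the graded form of Schur's lemma. -/
theorem exists_divisionIdempotent [FiniteDimensional F R] [Nontrivial R]
    (hprime : ∀ a b : R, a ≠ 0 → b ≠ 0 → ∃ r, a * r * b ≠ 0) :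
    ∃ e, IsDivisionIdempotent 𝒜 e := by
  obtain ⟨x, g, hx, hx0, hmin⟩ := exists_minimal_homogeneous 𝒜
  obtain ⟨r₀, hr₀⟩ := hprime x x hx0 hx0
  obtain ⟨g', r, hr, hne⟩ := exists_homogeneous_mul_ne_zero 𝒜 hr₀
  obtain ⟨s, hs⟩ := hmin (g' + g) (r * x) (SetLike.GradedMul.mul_mem hr hx)
    (by rwa [← mul_assoc])
  -- `x * r` generates `x R`, and `w` with `x * r * x * w = x * r` gives the idempotent `x * w`
  have hz : x * r ∈ 𝒜 (g + g') := SetLike.GradedMul.mul_mem hx hr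
  obtain ⟨w, hw, hzw⟩ := exists_homogeneous_factor 𝒜 (a := x * r * x) (c := x * r) (w := s * r)
    (g := g + g' + g) (g' := -g) (SetLike.GradedMul.mul_mem hz hx)
    (by rwa [add_neg_cancel_right]) (by
      conv_rhs => rw [hs]
      simp only [mul_assoc])
  have he : x * w ∈ 𝒜 0 := by
    have := SetLike.GradedMul.mul_mem hx hw
    rwa [add_neg_cancel] at this
  have he0 : x * w ≠ 0 := fun h => by
    rw [mul_assoc, h, mul_zero] at hzw
    rw [← hzw, zero_mul] at hne
    exact hne rfl
  have hidem : (x * w) * (x * w) = x * w := by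
    by_contra hcon
    -- otherwise `x R` is generated by `(x * w) ^ 2 - x * w`, which `x * r` annihilates
    have hmem : w * (x * w) - w ∈ 𝒜 (-g) := by
      refine sub_mem ?_ hw
      have := SetLike.GradedMul.mul_mem hw he
      rwa [add_zero] at this
    have hfac : x * (w * (x * w) - w) = x * w * (x * w) - x * w := by
      rw [mul_sub]
      simp only [mul_assoc]
    obtain ⟨s', hs'⟩ := hmin _ _ hmem (by rw [hfac]; exact sub_ne_zero.2 hcon)
    have h1 : x * r * (x * w) = x * r := by rw [← mul_assoc, hzw]
    have h2 : x * r * (x * w * (x * w) - x * w) = 0 := by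
      rw [mul_sub, ← mul_assoc (x * r), h1, h1, sub_self]
    apply hne
    calc x * r * x = x * r * (x * (w * (x * w) - w) * s') := by rw [← hs']
      _ = 0 := by rw [hfac, ← mul_assoc (x * r), h2, zero_mul]
  have hright : ∀ g₁, ∀ d ∈ 𝒜 g₁, x * w * d = d → d ≠ 0 → ∃ f ∈ 𝒜 (-g₁), d * f = x * w := by
    intro g₁ d hd hed hd0
    obtain ⟨s', hs'⟩ := hmin _ _ (SetLike.GradedMul.mul_mem hw hd)
      (by rwa [← mul_assoc, hed])
    rw [← mul_assoc, hed] at hs'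
    refine exists_homogeneous_factor 𝒜 (w := s' * w) hd (by rwa [add_neg_cancel]) ?_
    rw [← mul_assoc, ← hs']
  set e := x * w with hedef
  have hcorner : ∀ g₁, ∀ d ∈ 𝒜 g₁, e * d = d → d * e = d → d ≠ 0 →
      ∃ f ∈ 𝒜 (-g₁), e * f = f ∧ f * e = f ∧ d * f = e := by
    intro g₁ d hd hed hde hd0
    obtain ⟨f, hf, hdf⟩ := hright g₁ d hd hed hd0
    refine ⟨e * f * e, ?_, ?_, ?_, ?_⟩
    · have := SetLike.GradedMul.mul_mem (SetLike.GradedMul.mul_mem he hf) he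
      rwa [zero_add, add_zero] at this
    · rw [← mul_assoc e (e * f) e, ← mul_assoc e e f, hidem]
    · rw [mul_assoc, hidem]
    · rw [← mul_assoc d (e * f) e, ← mul_assoc d e f, hde, hdf, hidem]
  refine ⟨e, he, he0, hidem, fun g₁ d hd hed hde hd0 => ?_⟩
  obtain ⟨f, hf, hef, hfe, hdf⟩ := hcorner g₁ d hd hed hde hd0
  have hf0 : f ≠ 0 := fun h => he0 (by rw [← hdf, h, mul_zero])
  obtain ⟨f', -, hef', -, hff'⟩ := hcorner _ f hf hef hfe hf0
  have : d = f' := by rw [← hde, ← hff', ← mul_assoc, hdf, hef']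
  exact ⟨f, hf, hef, hfe, hdf, by rw [this, hff']⟩

namespace IsDivisionIdempotent

variable {𝒜} {e : R} (he : IsDivisionIdempotent 𝒜 e)
include he

omit [DecidableEq G] [GradedAlgebra 𝒜] in
/-- The identity component of the corner `e R e` is a finite-dimensional division algebra over an
algebraically closed field, so it consists of the multiples of `e`. -/
theorem exists_eq_smul [IsAlgClosed F] [FiniteDimensional F R] {d : R} (hd : d ∈ 𝒜 0)
    (hed : e * d = d) (hde : d * e = d) : ∃ c : F, d = c • e := by
  -- an eigenvalue of `d` on the right ideal `e R`
  have hmaps : ∀ v ∈ LinearMap.range (LinearMap.mulLeft F e),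
      LinearMap.mulLeft F d v ∈ LinearMap.range (LinearMap.mulLeft F e) := by
    intro v _
    exact ⟨d * v, by simp [← mul_assoc, hed]⟩
  have : Nontrivial (LinearMap.range (LinearMap.mulLeft F e)) := by
    refine ⟨⟨⟨e, 1, by simp⟩, 0, fun h => he.ne_zero (congrArg Subtype.val h)⟩⟩
  obtain ⟨c, hc⟩ := Module.End.exists_eigenvalue ((LinearMap.mulLeft F d).restrict hmaps)
  obtain ⟨⟨v, u, hu⟩, hv⟩ := hc.exists_hasEigenvector
  have hdv : d * v = c • v := congrArg Subtype.val hv.apply_eq_smul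
  have hv0 : v ≠ 0 := fun h => hv.2 (Subtype.ext h)
  have hev : e * v = v := by
    rw [← hu, LinearMap.mulLeft_apply, ← mul_assoc, he.idem]
  refine ⟨c, ?_⟩
  by_contra hne
  obtain ⟨f, -, -, -, -, hf⟩ := he.inv 0 (d - c • e) (sub_mem hd (Submodule.smul_mem _ _ he.mem))
    (by rw [mul_sub, hed, mul_smul_comm, he.idem]) (by rw [sub_mul, hde, smul_mul_assoc, he.idem])
    (sub_ne_zero.2 hne)
  apply hv0
  rw [← hev, ← hf, mul_assoc, sub_mul, hdv, smul_mul_assoc, hev, sub_self, mul_zero]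

/-- The support of the graded division algebra `e R e`. -/
def support : AddSubgroup G where
  carrier := {g | ∃ d ∈ 𝒜 g, e * d = d ∧ d * e = d ∧ d ≠ 0}
  zero_mem' := ⟨e, he.mem, he.idem, he.idem, he.ne_zero⟩
  add_mem' := by
    rintro g g' ⟨d, hd, hed, hde, hd0⟩ ⟨d', hd', hed', hde', hd0'⟩
    refine ⟨d * d', SetLike.GradedMul.mul_mem hd hd', by rw [← mul_assoc, hed],
      by rw [mul_assoc, hde'], fun h => hd0' ?_⟩
    obtain ⟨f, -, -, -, -, hfd⟩ := he.inv g d hd hed hde hd0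
    rw [← hed', ← hfd, mul_assoc, h, mul_zero]
  neg_mem' := by
    rintro g ⟨d, hd, hed, hde, hd0⟩
    obtain ⟨f, hf, hef, hfe, hdf, -⟩ := he.inv g d hd hed hde hd0
    exact ⟨f, hf, hef, hfe, fun h => he.ne_zero (by rw [← hdf, h, mul_zero])⟩

omit he in
/-- A homogeneous frame of length `m` for the idempotent `e`: the products `x i * e * y j` behave
like the matrix units of an `m × m` matrix algebra over `e R e`. -/
structure IsFrame (𝒜 : G → Submodule F R) (e : R) {m : ℕ} (h : Fin m → G) (x y : Fin m → R) :
    Prop where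
  x_mem : ∀ i, x i ∈ 𝒜 (h i)
  y_mem : ∀ i, y i ∈ 𝒜 (-h i)
  x_mul : ∀ i, x i * e = x i
  mul_y : ∀ i, e * y i = y i
  y_mul_x : ∀ i j, y i * x j = if i = j then e else 0

omit [DecidableEq G] [GradedAlgebra 𝒜] in
/-- The elements `x i` of a frame are linearly independent. -/
theorem IsFrame.le_finrank [FiniteDimensional F R] {m : ℕ} {h : Fin m → G} {x y : Fin m → R}
    (hf : IsFrame 𝒜 e h x y) : m ≤ Module.finrank F R := by
  have hli : LinearIndependent F x := by
    rw [Fintype.linearIndependent_iff]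
    intro c hc i
    have h1 : y i * ∑ j, c j • x j = c i • e := by
      rw [Finset.mul_sum, Finset.sum_eq_single i]
      · rw [mul_smul_comm, hf.y_mul_x, if_pos rfl]
      · intro j _ hj
        rw [mul_smul_comm, hf.y_mul_x, if_neg hj.symm, smul_zero]
      · simp
    rw [hc, mul_zero] at h1
    exact (smul_eq_zero.1 h1.symm).resolve_right he.ne_zero
  simpa using hli.fintype_card_le_finrank

/-- Every incomplete frame can be extended by one pair: primeness provides nonzero homogeneous
elements of `p R e` and `e R p` for the complementary idempotent `p`. -/
theorem IsFrame.extend (hprime : ∀ a b : R, a ≠ 0 → b ≠ 0 → ∃ r, a * r * b ≠ 0) {m : ℕ}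
    {h : Fin m → G} {x y : Fin m → R} (hf : IsFrame 𝒜 e h x y) (hne : ∑ i, x i * y i ≠ 1) :
    ∃ (h' : Fin (m + 1) → G) (x' y' : Fin (m + 1) → R), IsFrame 𝒜 e h' x' y' := by
  set p := 1 - ∑ i, x i * y i with hp
  have hp0 : p ≠ 0 := sub_ne_zero.2 hne.symm
  have hpmem : p ∈ 𝒜 0 := by
    refine sub_mem SetLike.GradedOne.one_mem (sum_mem fun i _ => ?_)
    have := SetLike.GradedMul.mul_mem (hf.x_mem i) (hf.y_mem i)
    rwa [add_neg_cancel] at this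
  have hpx : ∀ j, p * x j = 0 := fun j => by
    rw [hp, sub_mul, one_mul, Finset.sum_mul, Finset.sum_eq_single j, mul_assoc, hf.y_mul_x,
      if_pos rfl, hf.x_mul, sub_self]
    · intro i _ hi
      rw [mul_assoc, hf.y_mul_x, if_neg hi, mul_zero]
    · simp
  have hyp : ∀ j, y j * p = 0 := fun j => by
    rw [hp, mul_sub, mul_one, Finset.mul_sum, Finset.sum_eq_single j, ← mul_assoc, hf.y_mul_x,
      if_pos rfl, hf.mul_y, sub_self]
    · intro i _ hi
      rw [← mul_assoc, hf.y_mul_x, if_neg hi.symm, zero_mul]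
    · simp
  have hpp : p * p = p := by
    nth_rewrite 1 [hp]
    rw [sub_mul, one_mul, Finset.sum_mul, Finset.sum_eq_zero, sub_zero]
    intro i _
    rw [mul_assoc, hyp, mul_zero]
  obtain ⟨r₀, hr₀⟩ := hprime p e hp0 he.ne_zero
  obtain ⟨g, r, hr, hx0⟩ := exists_homogeneous_mul_ne_zero 𝒜 hr₀
  have hxmem : p * r * e ∈ 𝒜 g := by
    have := SetLike.GradedMul.mul_mem (SetLike.GradedMul.mul_mem hpmem hr) he.mem
    rwa [zero_add, add_zero] at this
  obtain ⟨s₀, hs₀⟩ := hprime e (p * r * e) he.ne_zero hx0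
  obtain ⟨g', s, hs, hd0⟩ := exists_homogeneous_mul_ne_zero 𝒜 hs₀
  have hdmem := SetLike.GradedMul.mul_mem (SetLike.GradedMul.mul_mem he.mem hs) hxmem
  obtain ⟨f, hfmem, hef, -, -, hfd⟩ := he.inv _ _ hdmem
    (by simp only [← mul_assoc, he.idem]) (by simp only [mul_assoc, he.idem]) hd0
  -- `d = e * s * p * r * e` is invertible in the corner; its inverse `f` normalizes the new pair
  refine ⟨Fin.cons g h, Fin.cons (p * r * e) x, Fin.cons (f * (e * s) * p) y, ?_, ?_, ?_, ?_, ?_⟩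
  · exact Fin.cases hxmem hf.x_mem
  · refine Fin.cases ?_ hf.y_mem
    have := SetLike.GradedMul.mul_mem (SetLike.GradedMul.mul_mem hfmem
      (SetLike.GradedMul.mul_mem he.mem hs)) hpmem
    have heq : -(0 + g' + g) + (0 + g') + 0 = -g := by abel
    rw [heq] at this
    exact this
  · refine Fin.cases ?_ hf.x_mul
    simp [mul_assoc, he.idem]
  · refine Fin.cases ?_ hf.mul_y
    simp [← mul_assoc, hef]
  · refine Fin.cases (Fin.cases ?_ fun j => ?_) fun i => Fin.cases ?_ fun j => ?_
    · simp only [Fin.cons_zero, if_true]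
      refine Eq.trans ?_ hfd
      simp only [mul_assoc]
      rw [← mul_assoc p p, hpp]
    · simp only [Fin.cons_zero, Fin.cons_succ]
      rw [mul_assoc, hpx, mul_zero, if_neg (Fin.succ_ne_zero j).symm]
    · simp only [Fin.cons_zero, Fin.cons_succ]
      rw [← mul_assoc, ← mul_assoc, hyp, zero_mul, zero_mul, if_neg (Fin.succ_ne_zero i)]
    · simp only [Fin.cons_succ, hf.y_mul_x, Fin.succ_inj]

theorem exists_complete_frame [FiniteDimensional F R]
    (hprime : ∀ a b : R, a ≠ 0 → b ≠ 0 → ∃ r, a * r * b ≠ 0) :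
    ∃ (m : ℕ) (h : Fin m → G) (x y : Fin m → R), IsFrame 𝒜 e h x y ∧ ∑ i, x i * y i = 1 := by
  by_contra! hcon
  have hall : ∀ m : ℕ, ∃ (h : Fin m → G) (x y : Fin m → R), IsFrame 𝒜 e h x y := by
    intro m
    induction m with
    | zero =>
      exact ⟨Fin.elim0, Fin.elim0, Fin.elim0, fun i => i.elim0, fun i => i.elim0,
        fun i => i.elim0, fun i => i.elim0, fun i => i.elim0⟩
    | succ m ih =>
      obtain ⟨h, x, y, hf⟩ := ih
      exact hf.extend he hprime (hcon m h x y hf)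
  obtain ⟨h, x, y, hf⟩ := hall (Module.finrank F R + 1)
  exact absurd (hf.le_finrank he) (by omega)

/-- The degrees of a complete frame can be chosen in a fixed transversal of the support of
`e R e`: multiplication of `x i` by an invertible homogeneous element of `e R e` moves its degree
within its coset. -/
theorem exists_complete_frame_transversal [FiniteDimensional F R]
    (hprime : ∀ a b : R, a ≠ 0 → b ≠ 0 → ∃ r, a * r * b ≠ 0) :
    ∃ (m : ℕ) (h : Fin m → G) (x y : Fin m → R), IsFrame 𝒜 e h x y ∧ ∑ i, x i * y i = 1 ∧
      ∀ i j, h i - h j ∈ he.support → h i = h j := by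
  obtain ⟨m, h, x, y, hf, h1⟩ := he.exists_complete_frame hprime
  set ρ : G → G := fun g => (QuotientAddGroup.mk g : G ⧸ he.support).out with hρ
  have hρ1 : ∀ g, -g + ρ g ∈ he.support := fun g =>
    QuotientAddGroup.eq.1 (Quotient.out_eq' (QuotientAddGroup.mk g : G ⧸ he.support)).symm
  choose d hd hed hde hd0 using fun i => hρ1 (h i)
  choose f hfm hef hfe hdf hfd using fun i => he.inv _ _ (hd i) (hed i) (hde i) (hd0 i)
  refine ⟨m, fun i => ρ (h i), fun i => x i * d i, fun i => f i * y i, ⟨?_, ?_, ?_, ?_, ?_⟩,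
    ?_, ?_⟩
  · intro i
    have := SetLike.GradedMul.mul_mem (hf.x_mem i) (hd i)
    rwa [add_neg_cancel_left] at this
  · intro i
    have := SetLike.GradedMul.mul_mem (hfm i) (hf.y_mem i)
    have heq : -(-h i + ρ (h i)) + -h i = -ρ (h i) := by abel
    rwa [heq] at this
  · intro i
    rw [mul_assoc, hde]
  · intro i
    rw [← mul_assoc, hef]
  · intro i j
    rw [show f i * y i * (x j * d j) = f i * (y i * x j) * d j by simp only [mul_assoc],
      hf.y_mul_x]
    split_ifs with hij
    · subst hij
      rw [hfe, hfd]
    · rw [mul_zero, zero_mul]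
  · rw [← h1]
    refine Finset.sum_congr rfl fun i _ => ?_
    rw [show x i * d i * (f i * y i) = x i * (d i * f i) * y i by simp only [mul_assoc], hdf,
      hf.x_mul]
  · intro i j hij
    have h2 : -(h j) + h i ∈ he.support := by
      have := add_mem (sub_mem hij (hρ1 (h i))) (hρ1 (h j))
      have heq : ρ (h i) - ρ (h j) - (-h i + ρ (h i)) + (-h j + ρ (h j)) = -(h j) + h i := by abel
      rwa [heq] at this
    simp only [hρ]
    rw [QuotientAddGroup.eq.2 h2]

end IsDivisionIdempotent

/-- Homogeneous matrix units `E i j` of a graded algebra whose centralizer is spanned by invertible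
elements `X t`, one in each degree `t` of a subgroup `T`; the degrees `h i` lie in a transversal
of `T`. -/
structure GradedMatrixUnits where
  /-- the number of rows -/
  m : ℕ
  /-- the degrees of the rows -/
  h : Fin m → G
  /-- the matrix units -/
  E : Fin m → Fin m → R
  /-- the support of the centralizer -/
  T : AddSubgroup G
  /-- the homogeneous basis of the centralizer -/
  X : T → Rˣ
  pos : 0 < m
  E_mem : ∀ i j, E i j ∈ 𝒜 (h i - h j)
  E_mul : ∀ i j k l, E i j * E k l = if j = k then E i l else 0
  sum_E : ∑ i, E i i = 1
  X_mem : ∀ t : T, (X t : R) ∈ 𝒜 t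
  X_comm : ∀ t i j, Commute (X t : R) (E i j)
  exists_eq_smul : ∀ g, ∀ r ∈ 𝒜 g, (∀ i j, Commute r (E i j)) → r ≠ 0 →
    ∃ t : T, (t : G) = g ∧ ∃ c : F, r = c • (X t : R)
  h_eq : ∀ i j, h i - h j ∈ T → h i = h j

/-- Matrix units are the products `x i * y j` for a complete frame, and the corner `e R e` is
isomorphic to their centralizer by `d ↦ ∑ i, x i * d * y i`. -/
theorem nonempty_gradedMatrixUnits [IsAlgClosed F] [FiniteDimensional F R] [Nontrivial R]
    (hprime : ∀ a b : R, a ≠ 0 → b ≠ 0 → ∃ r, a * r * b ≠ 0) :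
    Nonempty (GradedMatrixUnits 𝒜) := by
  obtain ⟨e, he⟩ := exists_divisionIdempotent 𝒜 hprime
  obtain ⟨m, h, x, y, hf, h1, hT⟩ := he.exists_complete_frame_transversal hprime
  have hm : 0 < m := by
    rcases Nat.eq_zero_or_pos m with rfl | hm
    · simp at h1
    · exact hm
  have hE : ∀ i j k l, x i * y j * (x k * y l) = if j = k then x i * y l else 0 := by
    intro i j k l
    rw [show x i * y j * (x k * y l) = x i * (y j * x k) * y l by simp only [mul_assoc],
      hf.y_mul_x]
    split_ifs
    · rw [hf.x_mul]
    · rw [mul_zero, zero_mul]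
  -- the embedding of the corner `e R e` into the centralizer of the matrix units
  set ι : R → R := fun d => ∑ i, x i * d * y i with hι
  have hιx : ∀ d k, e * d = d → d * e = d → ι d * x k = x k * d := by
    intro d k hed hde
    rw [hι, Finset.sum_mul, Finset.sum_eq_single k, mul_assoc, hf.y_mul_x, if_pos rfl, mul_assoc,
      hde]
    · intro i _ hi
      rw [mul_assoc, hf.y_mul_x, if_neg hi, mul_zero]
    · simp
  have hιy : ∀ d k, e * d = d → d * e = d → y k * ι d = d * y k := by
    intro d k hed hde
    rw [hι, Finset.mul_sum, Finset.sum_eq_single k, ← mul_assoc, ← mul_assoc, hf.y_mul_x,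
      if_pos rfl, hed]
    · intro i _ hi
      rw [← mul_assoc, ← mul_assoc, hf.y_mul_x, if_neg hi.symm, zero_mul, zero_mul]
    · simp
  have hιmul : ∀ d d', e * d = d → d * e = d → ι d * ι d' = ι (d * d') := by
    intro d d' hed hde
    simp only [hι]
    rw [Finset.mul_sum]
    refine Finset.sum_congr rfl fun i _ => ?_
    rw [← mul_assoc, ← mul_assoc]
    have := hιx d i hed hde
    simp only [hι] at this
    rw [this]
    simp only [mul_assoc]
  have hιe : ι e = 1 := by
    rw [hι, ← h1]
    exact Finset.sum_congr rfl fun i _ => by rw [hf.x_mul]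
  choose d hd hed hde hd0 using fun t : he.support => t.2
  choose f hfm hef hfe hdf hfd using fun t => he.inv _ _ (hd t) (hed t) (hde t) (hd0 t)
  refine ⟨⟨m, h, fun i j => x i * y j, he.support,
    fun t => ⟨ι (d t), ι (f t), by rw [hιmul _ _ (hed t) (hde t), hdf, hιe],
      by rw [hιmul _ _ (hef t) (hfe t), hfd, hιe]⟩, hm, ?_, hE, h1, ?_, ?_, ?_, hT⟩⟩
  · intro i j
    rw [sub_eq_add_neg]
    exact SetLike.GradedMul.mul_mem (hf.x_mem i) (hf.y_mem j)
  · intro t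
    change ∑ i, x i * d t * y i ∈ 𝒜 t
    refine sum_mem fun i _ => ?_
    have := SetLike.GradedMul.mul_mem (SetLike.GradedMul.mul_mem (hf.x_mem i) (hd t)) (hf.y_mem i)
    rwa [add_neg_cancel_comm] at this
  · intro t i j
    change ι (d t) * (x i * y j) = x i * y j * ι (d t)
    rw [← mul_assoc, hιx _ _ (hed t) (hde t), mul_assoc, mul_assoc, hιy _ _ (hed t) (hde t)]
  · intro g r hr hcomm hr0
    -- since `r` commutes with the matrix units, `y k * r * x i` is diagonal with constant entries
    have hoff : ∀ i j k l, y k * r * x i * (y j * x l) = (y k * x i) * (y j * r * x l) := by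
      intro i j k l
      have := congrArg (fun z => y k * z * x l) (hcomm i j).eq
      simp only [mul_assoc] at this ⊢
      exact this
    set i₀ : Fin m := ⟨0, hm⟩
    have hcorner1 : ∀ i j, e * (y i * r * x j) = y i * r * x j := fun i j => by
      rw [← mul_assoc, ← mul_assoc, hf.mul_y]
    have hcorner2 : ∀ i j, y i * r * x j * e = y i * r * x j := fun i j => by
      rw [mul_assoc, hf.x_mul]
    have hval : ∀ k i, y k * r * x i = if k = i then y i₀ * r * x i₀ else 0 := by
      intro k i
      have := hoff i i₀ k i₀
      rw [hf.y_mul_x, if_pos rfl, hcorner2, hf.y_mul_x] at this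
      rw [this]
      split_ifs
      · rw [hcorner1]
      · rw [zero_mul]
    have hr1 : r = ι (y i₀ * r * x i₀) := by
      calc r = (∑ k, x k * y k) * r * ∑ i, x i * y i := by rw [h1, one_mul, mul_one]
        _ = ∑ k, ∑ i, x k * (y k * r * x i) * y i := by
          rw [Finset.sum_mul, Finset.sum_mul]
          refine Finset.sum_congr rfl fun k _ => ?_
          rw [Finset.mul_sum]
          refine Finset.sum_congr rfl fun i _ => ?_
          simp only [mul_assoc]
        _ = ι (y i₀ * r * x i₀) := by
          refine Finset.sum_congr rfl fun k _ => ?_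
          rw [Finset.sum_eq_single k]
          · rw [hval, if_pos rfl]
          · intro i _ hi
            rw [hval, if_neg hi.symm, mul_zero, zero_mul]
          · simp
    set d₀ := y i₀ * r * x i₀ with hd₀
    have hd₀mem : d₀ ∈ 𝒜 g := by
      have := SetLike.GradedMul.mul_mem (SetLike.GradedMul.mul_mem (hf.y_mem i₀) hr) (hf.x_mem i₀)
      rwa [neg_add_cancel_comm] at this
    have hd₀0 : d₀ ≠ 0 := fun h => hr0 (by rw [hr1, h, hι]; simp)
    refine ⟨⟨g, d₀, hd₀mem, hcorner1 _ _, hcorner2 _ _, hd₀0⟩, rfl, ?_⟩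
    set t : he.support := ⟨g, d₀, hd₀mem, hcorner1 _ _, hcorner2 _ _, hd₀0⟩
    obtain ⟨c, hc⟩ := he.exists_eq_smul (d := d₀ * f t) (by
        have := SetLike.GradedMul.mul_mem hd₀mem (hfm t)
        rwa [add_neg_cancel] at this) (by rw [← mul_assoc, hcorner1]) (by rw [mul_assoc, hfe])
    refine ⟨c, ?_⟩
    have hd₀c : d₀ = c • d t := by
      calc d₀ = d₀ * (f t * d t) := by rw [hfd, hcorner2]
        _ = c • d t := by rw [← mul_assoc, hc, smul_mul_assoc, hed]
    conv_lhs => rw [hr1, hd₀c]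
    simp only [hι, mul_smul_comm, smul_mul_assoc, Finset.smul_sum]

end GradedStructure

/-! ### The centralizer of the matrix units -/

section NoncommProd

theorem noncommProd_mem_graded {F G R α : Type*} [Field F] [AddCommGroup G] [DecidableEq G]
    [Ring R] [Algebra F R] (𝒜 : G → Submodule F R) [GradedAlgebra 𝒜] (s : Finset α) (f : α → R)
    (comm : (s : Set α).Pairwise (Function.onFun Commute f)) (d : α → G)
    (h : ∀ i, f i ∈ 𝒜 (d i)) : s.noncommProd f comm ∈ 𝒜 (∑ i ∈ s, d i) := by
  classical
  induction s using Finset.induction_on with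
  | empty => simpa using SetLike.GradedOne.one_mem
  | insert a s ha ih =>
    rw [Finset.noncommProd_insert_of_notMem _ _ _ _ ha, Finset.sum_insert ha]
    exact SetLike.GradedMul.mul_mem (h a) (ih _)

theorem noncommProd_smul {F R α : Type*} [Field F] [Ring R] [Algebra F R] (s : Finset α)
    (c : α → F) (f : α → R) (comm : (s : Set α).Pairwise (Function.onFun Commute f))
    (comm' : (s : Set α).Pairwise (Function.onFun Commute fun i => c i • f i)) :
    s.noncommProd (fun i => c i • f i) comm' = (∏ i ∈ s, c i) • s.noncommProd f comm := by
  classical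
  induction s using Finset.induction_on with
  | empty => simp [Finset.noncommProd_empty]
  | insert a s ha ih =>
    rw [Finset.noncommProd_insert_of_notMem _ _ _ _ ha,
      Finset.noncommProd_insert_of_notMem _ _ _ _ ha, Finset.prod_insert ha, ih,
      smul_mul_smul_comm]

end NoncommProd

namespace GradedMatrixUnits

variable {F : Type*} [Field F] {G : Type*} [AddCommGroup G] [DecidableEq G] {R : Type*} [Ring R]
  [Algebra F R] {𝒜 : G → Submodule F R} [GradedAlgebra 𝒜] (U : GradedMatrixUnits 𝒜)

section Entries

/-- The `(i, j)` entry of `r` with respect to the matrix units, an element of their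
centralizer. -/
def entry (r : R) (i j : Fin U.m) : R := ∑ k, U.E k i * r * U.E j k

omit [DecidableEq G] [GradedAlgebra 𝒜] in
theorem entry_mul_E (r : R) (i j a b : Fin U.m) :
    U.entry r i j * U.E a b = U.E a i * r * U.E j b := by
  rw [entry, Finset.sum_mul, Finset.sum_eq_single a]
  · rw [mul_assoc, U.E_mul, if_pos rfl]
  · intro k _ hk
    rw [mul_assoc, U.E_mul, if_neg hk, mul_zero]
  · simp

omit [DecidableEq G] [GradedAlgebra 𝒜] in
theorem entry_commute (r : R) (i j a b : Fin U.m) : Commute (U.entry r i j) (U.E a b) := by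
  rw [Commute, SemiconjBy, entry_mul_E, entry, Finset.mul_sum, Finset.sum_eq_single b]
  · rw [← mul_assoc, ← mul_assoc, U.E_mul, if_pos rfl]
  · intro k _ hk
    rw [← mul_assoc, ← mul_assoc, U.E_mul, if_neg hk.symm, zero_mul, zero_mul]
  · simp

omit [DecidableEq G] [GradedAlgebra 𝒜] in
theorem eq_sum_entry (r : R) : r = ∑ i, ∑ j, U.entry r i j * U.E i j := by
  simp only [entry_mul_E]
  simp only [← Finset.mul_sum, ← Finset.sum_mul, U.sum_E, one_mul, mul_one]

theorem entry_mem {g : G} {r : R} (hr : r ∈ 𝒜 g) (i j : Fin U.m) :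
    U.entry r i j ∈ 𝒜 (g - U.h i + U.h j) := by
  refine sum_mem fun k _ => ?_
  have := SetLike.GradedMul.mul_mem (SetLike.GradedMul.mul_mem (U.E_mem k i) hr) (U.E_mem j k)
  rwa [show U.h k - U.h i + g + (U.h j - U.h k) = g - U.h i + U.h j by abel] at this

variable [Nontrivial R]

theorem exists_X_mul (s t : U.T) :
    ∃ c : F, c ≠ 0 ∧ (U.X s : R) * U.X t = c • (U.X (s + t) : R) := by
  have hne : (U.X s : R) * U.X t ≠ 0 := by
    rw [← Units.val_mul]
    exact Units.ne_zero _
  obtain ⟨u, hu, c, hc⟩ := U.exists_eq_smul _ _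
    (SetLike.GradedMul.mul_mem (U.X_mem s) (U.X_mem t))
    (fun i j => (U.X_comm s i j).mul_left (U.X_comm t i j)) hne
  have : u = s + t := Subtype.ext hu
  subst this
  exact ⟨c, fun h => hne (by rw [hc, h, zero_smul]), hc⟩

theorem exists_eq_smul_one {r : R} (hr : r ∈ 𝒜 0) (hcomm : ∀ i j, Commute r (U.E i j)) :
    ∃ c : F, r = c • (1 : R) := by
  by_cases h0 : r = 0
  · exact ⟨0, by rw [h0, zero_smul]⟩
  obtain ⟨t, ht, c, hc⟩ := U.exists_eq_smul 0 r hr hcomm h0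
  obtain ⟨t', ht', c', hc'⟩ := U.exists_eq_smul 0 1 SetLike.GradedOne.one_mem
    (fun i j => Commute.one_left _) one_ne_zero
  have : t = t' := Subtype.ext (ht.trans ht'.symm)
  subst this
  have hc0 : c' ≠ 0 := fun h => one_ne_zero (α := R) (by rw [hc', h, zero_smul])
  exact ⟨c * c'⁻¹, by rw [hc', smul_smul, mul_assoc, inv_mul_cancel₀ hc0, mul_one, hc]⟩

theorem exists_commutator (s t : U.T) :
    ∃ c : Fˣ, (U.X s : R) * U.X t = (c : F) • ((U.X t : R) * U.X s) := by
  obtain ⟨c, hc0, hc⟩ := U.exists_X_mul s t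
  obtain ⟨c', hc0', hc'⟩ := U.exists_X_mul t s
  refine ⟨Units.mk0 (c * c'⁻¹) (mul_ne_zero hc0 (inv_ne_zero hc0')), ?_⟩
  rw [Units.val_mk0, hc', hc, smul_smul, mul_assoc, inv_mul_cancel₀ hc0', mul_one, add_comm]

/-- The commutation factor of the centralizer of the matrix units:
`X s * X t = commFactor s t • (X t * X s)`. -/
noncomputable def commFactor (s t : U.T) : Fˣ := (U.exists_commutator s t).choose

theorem X_mul_X (s t : U.T) :
    (U.X s : R) * U.X t = (U.commFactor s t : F) • ((U.X t : R) * U.X s) :=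
  (U.exists_commutator s t).choose_spec

theorem commFactor_eq {s t : U.T} {c : Fˣ}
    (h : (U.X s : R) * U.X t = (c : F) • ((U.X t : R) * U.X s)) : U.commFactor s t = c := by
  rw [X_mul_X, ← Units.val_mul] at h
  exact Units.ext (smul_left_injective F (Units.ne_zero (U.X t * U.X s)) h)

theorem isBicharacter_commFactor : IsBicharacter U.commFactor where
  self t := U.commFactor_eq (by simp)
  swap s t := by
    have h : U.commFactor s t = (U.commFactor t s)⁻¹ := U.commFactor_eq (by
      rw [U.X_mul_X t s, smul_smul, Units.inv_mul, one_smul])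
    rw [h, inv_mul_cancel]
  add_left s t u := U.commFactor_eq (by
    obtain ⟨c, hc0, hc⟩ := U.exists_X_mul s t
    have h : (U.X (s + t) : R) = c⁻¹ • ((U.X s : R) * U.X t) := by
      rw [hc, smul_smul, inv_mul_cancel₀ hc0, one_smul]
    rw [h, smul_mul_assoc, mul_assoc, U.X_mul_X t u, mul_smul_comm, ← mul_assoc, U.X_mul_X s u,
      smul_mul_assoc, mul_smul_comm, mul_assoc, smul_smul, smul_smul, smul_smul, Units.val_mul]
    congr 1
    ring)

/-- In a central algebra the commutation factor is nondegenerate: an element `X s` that commutes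
with the centralizer of the matrix units commutes with everything, so it is a scalar. -/
theorem commFactor_nondegenerate [Algebra.IsCentral F R] (s : U.T)
    (hs : ∀ t, U.commFactor s t = 1) : s = 0 := by
  have hcomm : ∀ t, Commute (U.X s : R) (U.X t : R) := fun t => by
    have := U.X_mul_X s t
    rwa [hs, Units.val_one, one_smul] at this
  have hhom : ∀ g, ∀ r ∈ 𝒜 g, Commute (U.X s : R) r := by
    intro g r hr
    rw [U.eq_sum_entry r]
    refine Commute.sum_right _ _ _ fun i _ => Commute.sum_right _ _ _ fun j _ => ?_
    refine Commute.mul_right ?_ (U.X_comm s i j)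
    by_cases h0 : U.entry r i j = 0
    · rw [h0]
      exact Commute.zero_right _
    obtain ⟨t, -, c, hc⟩ := U.exists_eq_smul _ _ (U.entry_mem hr i j) (U.entry_commute r i j) h0
    rw [hc]
    exact (hcomm t).smul_right c
  have hcen : (U.X s : R) ∈ Subalgebra.center F R := by
    rw [Subalgebra.mem_center_iff]
    intro r
    classical
    rw [← DirectSum.sum_support_decompose 𝒜 r]
    exact (Commute.sum_right _ _ _ fun g _ => hhom g _ (SetLike.coe_mem _)).eq.symm
  rw [Algebra.IsCentral.center_eq_bot, Algebra.mem_bot] at hcen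
  obtain ⟨c, hc⟩ := hcen
  have hmem : (U.X s : R) ∈ 𝒜 0 := by
    rw [← hc, Algebra.algebraMap_eq_smul_one]
    exact Submodule.smul_mem _ _ SetLike.GradedOne.one_mem
  exact Subtype.ext (DirectSum.degree_eq_of_mem_mem 𝒜 (U.X_mem s) hmem (Units.ne_zero _))

end Entries

section Coordinates

variable [Nontrivial R] [IsAlgClosed F]

/-- A scalar multiple of `X t` whose `k`-th power is `1`, provided that `k • t = 0`. -/
theorem exists_smul_pow_eq_one (t : U.T) {k : ℕ} (hk : 0 < k) (ht : k • t = 0) :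
    ∃ c : F, c ≠ 0 ∧ (c • (U.X t : R)) ^ k = 1 := by
  have hmem : (U.X t : R) ^ k ∈ 𝒜 0 := by
    have := SetLike.pow_mem_graded k (U.X_mem t)
    rwa [← AddSubgroup.coe_nsmul, ht] at this
  obtain ⟨c, hc⟩ := U.exists_eq_smul_one hmem (fun i j => (U.X_comm t i j).pow_left k)
  have hc0 : c ≠ 0 := fun h => by
    rw [h, zero_smul, ← Units.val_pow_eq_pow_val] at hc
    exact Units.ne_zero _ hc
  obtain ⟨d, hd⟩ := IsAlgClosed.exists_pow_nat_eq c⁻¹ hk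
  refine ⟨d, fun h => ?_, ?_⟩
  · rw [h, zero_pow hk.ne'] at hd
    exact inv_ne_zero hc0 hd.symm
  · rw [smul_pow, hd, hc, smul_smul, inv_mul_cancel₀ hc0, one_smul]

/-- The centralizer of the matrix units is the image of a tensor product of matrix algebras with
`ε`-gradings: a symplectic basis of its support, with suitably scaled elements `X t`, satisfies the
relations of the clock and shift matrices. -/
theorem exists_fine_generators [Algebra.IsCentral F R] [Finite G] :
    ∃ (r : ℕ) (N : Fin r → ℕ) (ε : Fin r → F) (_ : ∀ l, NeZero (N l))
      (deg : (∀ l, ZMod (N l) × ZMod (N l)) →+ G)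
      (W : (∀ l, ZMod (N l) × ZMod (N l)) → R),
      (∀ l, 1 < N l) ∧ (∀ l, IsPrimitiveRoot (ε l) (N l)) ∧ Function.Injective deg ∧
      (∀ g, g ∈ Set.range deg ↔ g ∈ U.T) ∧
      (∀ s t, W s * W t = twist ε s t • W (s + t)) ∧ W 0 = 1 ∧
      (∀ t, W t ∈ 𝒜 (deg t)) ∧ ∀ t i j, Commute (W t) (U.E i j) := by
  obtain ⟨r, N, a, b, hN, ha, hb, hprim, haa, hbb, hab, hspan⟩ :=
    exists_symplectic_basis _ U.isBicharacter_commFactor U.commFactor_nondegenerate le_rfl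
  have hNZ : ∀ l, NeZero (N l) := fun l => ⟨by have := hN l; omega⟩
  have hNpos : ∀ l, 0 < N l := fun l => NeZero.pos _
  choose c hc0 hc using fun l => U.exists_smul_pow_eq_one (a l) (hNpos l) (ha l)
  choose d hd0 hd using fun l => U.exists_smul_pow_eq_one (b l) (hNpos l) (hb l)
  set A : Fin r → R := fun l => c l • (U.X (a l) : R) with hA
  set B : Fin r → R := fun l => d l • (U.X (b l) : R) with hB
  set ε : Fin r → F := fun l => (U.commFactor (a l) (b l) : F) with hε
  have hcomm1 : ∀ s t, U.commFactor s t = 1 → Commute (U.X s : R) (U.X t : R) := fun s t h => by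
    have := U.X_mul_X s t
    rwa [h, Units.val_one, one_smul] at this
  have hAA : ∀ l l', Commute (A l) (A l') := fun l l' =>
    ((hcomm1 _ _ (haa l l')).smul_left _).smul_right _
  have hBB : ∀ l l', Commute (B l) (B l') := fun l l' =>
    ((hcomm1 _ _ (hbb l l')).smul_left _).smul_right _
  have hAB : ∀ l l', l ≠ l' → Commute (A l) (B l') := fun l l' h =>
    ((hcomm1 _ _ (hab l l' h)).smul_left _).smul_right _
  have hrel : ∀ l, A l * B l = ε l • (B l * A l) := fun l => by
    simp only [hA, hB, hε, smul_mul_smul_comm]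
    rw [U.X_mul_X, smul_comm, mul_comm]
  have hε0 : ∀ l, ε l ≠ 0 := fun l => Units.ne_zero _
  -- the monomials in the `l`-th pair, which correspond to the basis of the `l`-th tensor factor
  set V : ∀ l, ZMod (N l) × ZMod (N l) → R := fun l t => A l ^ t.1.val * B l ^ t.2.val with hV
  have hVV : ∀ l l' s t, l ≠ l' → Commute (V l s) (V l' t) := fun l l' s t h =>
    (((hAA l l').pow_pow _ _).mul_right ((hAB l l' h).pow_pow _ _)).mul_left
      (((hAB l' l h.symm).symm.pow_pow _ _).mul_right ((hBB l l').pow_pow _ _))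
  have hVmul : ∀ l s t, V l s * V l t = (ε l)⁻¹ ^ (s.2.val * t.1.val) • V l (s + t) := fun l s t =>
    weyl_mul (hε0 l) (hc l) (hd l) (hrel l) s t
  have hpair : ∀ t : ∀ l, ZMod (N l) × ZMod (N l),
      ((Finset.univ : Finset (Fin r)) : Set (Fin r)).Pairwise
        (Function.onFun Commute fun l => V l (t l)) :=
    fun t l _ l' _ h => hVV l l' _ _ h
  set δ : (∀ l, ZMod (N l) × ZMod (N l)) → U.T :=
    fun t => ∑ l, ((t l).1.val • a l + (t l).2.val • b l) with hδ
  have hδadd : ∀ s t, δ (s + t) = δ s + δ t := fun s t => by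
    simp only [hδ, ← Finset.sum_add_distrib]
    refine Finset.sum_congr rfl fun l _ => ?_
    rw [Pi.add_apply, Prod.fst_add, Prod.snd_add, nsmul_val_add (ha l), nsmul_val_add (hb l)]
    abel
  have hβ := U.isBicharacter_commFactor
  have hβsum : ∀ s (f : Fin r → U.T), U.commFactor s (∑ l, f l) = ∏ l, U.commFactor s (f l) := by
    intro s f
    let χ : Multiplicative U.T →* Fˣ :=
      { toFun := fun t => U.commFactor s t.toAdd
        map_one' := hβ.zero_right s
        map_mul' := fun x y => hβ.add_right s x.toAdd y.toAdd }
    exact map_prod χ (fun l => Multiplicative.ofAdd (f l)) Finset.univ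
  -- the commutation factors with the basis elements recover the coordinates
  have hβa : ∀ t l, U.commFactor (a l) (δ t) = U.commFactor (a l) (b l) ^ (t l).2.val := by
    intro t l
    rw [hδ, hβsum, Finset.prod_eq_single l]
    · rw [hβ.add_right, hβ.nsmul_right, hβ.nsmul_right, haa, one_pow, one_mul]
    · intro l' _ h
      rw [hβ.add_right, hβ.nsmul_right, hβ.nsmul_right, haa, hab l l' h.symm, one_pow, one_pow,
        one_mul]
    · simp
  have hβb : ∀ t l, U.commFactor (b l) (δ t) = U.commFactor (b l) (a l) ^ (t l).1.val := by
    intro t l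
    rw [hδ, hβsum, Finset.prod_eq_single l]
    · rw [hβ.add_right, hβ.nsmul_right, hβ.nsmul_right, hbb, one_pow, mul_one]
    · intro l' _ h
      rw [hβ.add_right, hβ.nsmul_right, hβ.nsmul_right, hbb, hβ.eq_inv_swap (b l) (a l'),
        hab l' l h, inv_one, one_pow, one_pow, one_mul]
    · simp
  have hδinj : Function.Injective δ := by
    intro s t hst
    funext l
    have h1 := hβa s l
    have h2 := hβb s l
    rw [hst, hβa] at h1
    rw [hst, hβb, hβ.eq_inv_swap (b l), inv_pow, inv_pow, inv_inj] at h2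
    have hp := IsPrimitiveRoot.coe_units_iff.1 (hprim l)
    exact Prod.ext (ZMod.val_injective _ (hp.pow_inj (ZMod.val_lt _) (ZMod.val_lt _) h2.symm))
      (ZMod.val_injective _ (hp.pow_inj (ZMod.val_lt _) (ZMod.val_lt _) h1.symm))
  refine ⟨r, N, ε, hNZ, AddMonoidHom.mk' (fun t => (δ t : G)) (fun s t => by rw [hδadd]; rfl),
    fun t => Finset.univ.noncommProd (fun l => V l (t l)) (hpair t), hN, hprim, ?_, ?_, ?_, ?_,
    ?_, ?_⟩
  · exact fun s t h => hδinj (Subtype.ext h)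
  · intro g
    refine ⟨?_, fun hg => ?_⟩
    · rintro ⟨t, rfl⟩
      exact (δ t).2
    · obtain ⟨i, j, hi, hj, h⟩ := hspan ⟨g, hg⟩
      refine ⟨fun l => ((i l : ZMod (N l)), (j l : ZMod (N l))), ?_⟩
      change ((δ _ : U.T) : G) = g
      simp only [hδ, ZMod.val_cast_of_lt (hi _), ZMod.val_cast_of_lt (hj _)]
      rw [← h]
  · intro s t
    rw [← Finset.noncommProd_mul_distrib]
    · have heq : ((fun l => V l (s l)) * fun l => V l (t l)) =
          fun l => (ε l)⁻¹ ^ ((s l).2.val * (t l).1.val) • V l ((s + t) l) :=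
        funext fun l => hVmul l (s l) (t l)
      have hcg : ∀ (f g : Fin r → R) (hf) (hg), f = g →
          (Finset.univ : Finset (Fin r)).noncommProd f hf = Finset.univ.noncommProd g hg := by
        rintro f _ hf hg rfl
        rfl
      have hcomm' : ((Finset.univ : Finset (Fin r)) : Set (Fin r)).Pairwise
          (Function.onFun Commute
            fun l => (ε l)⁻¹ ^ ((s l).2.val * (t l).1.val) • V l ((s + t) l)) :=
        fun l _ l' _ h => ((hVV l l' _ _ h).smul_left _).smul_right _
      rw [hcg _ _ _ hcomm' heq, noncommProd_smul _ _ _ (hpair (s + t))]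
      rfl
    · exact fun l _ l' _ h => hVV l l' _ _ h
  · refine (Finset.noncommProd_eq_pow_card _ _ _ (1 : R) fun l _ => ?_).trans (one_pow _)
    simp [hV]
  · intro t
    have h := noncommProd_mem_graded 𝒜 Finset.univ (fun l => V l (t l)) (hpair t)
      (fun l => (t l).1.val • (a l : G) + (t l).2.val • (b l : G)) (fun l =>
        SetLike.GradedMul.mul_mem
          (SetLike.pow_mem_graded _ (Submodule.smul_mem _ _ (U.X_mem _)))
          (SetLike.pow_mem_graded _ (Submodule.smul_mem _ _ (U.X_mem _))))
    simpa [hδ] using h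
  · intro t i j
    refine (Finset.noncommProd_commute _ _ _ _ fun l _ => ?_).symm
    exact ((((U.X_comm _ i j).smul_left _).pow_left _).mul_left
      (((U.X_comm _ i j).smul_left _).pow_left _)).symm

end Coordinates
end GradedMatrixUnits

/-! ### The decomposition `C ⊗ D` and its homogeneous components in terms of blocks -/

section MatrixBlocks

variable {F : Type*} [Field F] {ι κ : Type*}

/-- The `κ × κ` block of a matrix over `ι × κ` in the position `(i, j)`. -/
def blk (M : Matrix (ι × κ) (ι × κ) F) (i j : ι) : Matrix κ κ F :=
  Matrix.of fun x y => M (i, x) (j, y)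

omit [Field F] in
theorem ext_blk {M M' : Matrix (ι × κ) (ι × κ) F} (h : ∀ i j, blk M i j = blk M' i j) :
    M = M' := by
  ext ⟨i, x⟩ ⟨j, y⟩
  exact congrFun (congrFun (h i j) x) y

theorem blk_mul [Fintype ι] [Fintype κ] (M M' : Matrix (ι × κ) (ι × κ) F) (i k : ι) :
    blk (M * M') i k = ∑ j, blk M i j * blk M' j k := by
  ext x y
  simp [blk, Matrix.mul_apply, Matrix.sum_apply, Fintype.sum_prod_type]

theorem blk_kronecker (A : Matrix ι ι F) (B : Matrix κ κ F) (i j : ι) :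
    blk (A ⊗ₖ B) i j = A i j • B := rfl

theorem blk_add (M M' : Matrix (ι × κ) (ι × κ) F) (i j : ι) :
    blk (M + M') i j = blk M i j + blk M' i j := rfl

theorem blk_smul (c : F) (M : Matrix (ι × κ) (ι × κ) F) (i j : ι) :
    blk (c • M) i j = c • blk M i j := rfl

theorem blk_one [DecidableEq ι] [DecidableEq κ] (i j : ι) :
    blk (1 : Matrix (ι × κ) (ι × κ) F) i j = if i = j then 1 else 0 := by
  ext x y
  by_cases h : i = j <;> simp [blk, Matrix.one_apply, h]

theorem blk_sum {α : Type*} (s : Finset α) (M : α → Matrix (ι × κ) (ι × κ) F) (i j : ι) :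
    blk (∑ a ∈ s, M a) i j = ∑ a ∈ s, blk (M a) i j := by
  ext x y
  simp [blk, Matrix.sum_apply]

theorem eq_sum_single_kronecker_blk [Fintype ι] [DecidableEq ι] (M : Matrix (ι × κ) (ι × κ) F) :
    M = ∑ i, ∑ j, Matrix.single i j (1 : F) ⊗ₖ blk M i j := by
  refine ext_blk fun a b => ?_
  simp only [blk_sum, blk_kronecker, Matrix.single_apply, ite_smul, one_smul, zero_smul]
  rw [Finset.sum_eq_single a, Finset.sum_eq_single b]
  · simp
  · intro j _ hj
    simp [hj]
  · simp
  · intro i _ hi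
    simp [hi]
  · simp

end MatrixBlocks

section Components

variable {F : Type*} [Field F] {G : Type*} [AddCommGroup G]

theorem single_mem_elementaryComponent {ι : Type*} [DecidableEq ι] (g : ι → G) (i j : ι) (c : F) :
    Matrix.single i j c ∈ elementaryComponent F g (-g i + g j) := by
  intro a b hab
  rw [Matrix.single_apply, if_neg]
  rintro ⟨rfl, rfl⟩
  exact hab rfl

theorem exists_of_elementaryComponent_ne_bot {ι : Type*} {g : ι → G} {h : G}
    (hne : elementaryComponent F g h ≠ ⊥) : ∃ i j, -g i + g j = h := by
  by_contra! hcon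
  refine hne (eq_bot_iff.2 fun A hA => ?_)
  ext i j
  exact hA i j (hcon i j)

variable {r : ℕ} {N : Fin r → ℕ} {ε : Fin r → F}
  {deg : (∀ l, ZMod (N l) × ZMod (N l)) →+ G}

theorem fineElement_mem (t : ∀ l, ZMod (N l) × ZMod (N l)) :
    fineElement ε t ∈ fineComponent ε deg (deg t) :=
  Submodule.subset_span ⟨t, rfl, rfl⟩

theorem exists_eq_smul_of_mem_fineComponent (hdeg : Function.Injective deg)
    {t : ∀ l, ZMod (N l) × ZMod (N l)} {M : Matrix (∀ l, Fin (N l)) (∀ l, Fin (N l)) F}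
    (hM : M ∈ fineComponent ε deg (deg t)) : ∃ c : F, M = c • fineElement ε t := by
  have hset : {X | ∃ s, deg s = deg t ∧ X = tensorMatrix fun l => epsilonElement (N l) (ε l) (s l)}
      = {fineElement ε t} := by
    ext X
    constructor
    · rintro ⟨s, hs, rfl⟩
      rw [hdeg hs]
      rfl
    · rintro rfl
      exact ⟨t, rfl, rfl⟩
  rw [fineComponent, hset, Submodule.mem_span_singleton] at hM
  obtain ⟨c, hc⟩ := hM
  exact ⟨c, hc.symm⟩

theorem eq_zero_of_mem_fineComponent {h : G} (hh : h ∉ Set.range deg)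
    {M : Matrix (∀ l, Fin (N l)) (∀ l, Fin (N l)) F} (hM : M ∈ fineComponent ε deg h) :
    M = 0 := by
  have hset : {X | ∃ s, deg s = h ∧ X = tensorMatrix fun l => epsilonElement (N l) (ε l) (s l)}
      = ∅ := by
    ext X
    simp only [Set.mem_ofPred_eq, Set.mem_empty_iff_false, iff_false]
    rintro ⟨s, hs, -⟩
    exact hh ⟨s, hs⟩
  rw [fineComponent, hset, Submodule.span_empty] at hM
  exact hM

/-- The homogeneous components of `C ⊗ D` in terms of blocks: the block in the position `(i, j)` of
an element of degree `h` is homogeneous of degree `h + g i - g j`. -/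
theorem mem_tensorComponent_iff {ι : Type*} [Fintype ι] [DecidableEq ι] {g : ι → G} {h : G}
    {M : Matrix (ι × ∀ l, Fin (N l)) (ι × ∀ l, Fin (N l)) F} :
    M ∈ tensorComponent (elementaryComponent F g) (fineComponent ε deg) h ↔
      ∀ i j, blk M i j ∈ fineComponent ε deg (h + g i - g j) := by
  constructor
  · intro hM i j
    induction hM using Submodule.span_induction with
    | mem X hX =>
      obtain ⟨a, b, hab, A, hA, B, hB, rfl⟩ := hX
      rw [blk_kronecker]
      by_cases h0 : A i j = 0
      · rw [h0, zero_smul]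
        exact zero_mem _
      · have ha : -g i + g j = a := by
          by_contra hne
          exact h0 (hA i j hne)
        have hb : h + g i - g j = b := by
          rw [← hab, ← ha]
          abel
        rw [hb]
        exact Submodule.smul_mem _ _ hB
    | zero => exact zero_mem _
    | add X Y _ _ hX hY => exact add_mem hX hY
    | smul c X _ hX => exact Submodule.smul_mem _ c hX
  · intro hM
    rw [eq_sum_single_kronecker_blk M]
    refine sum_mem fun i _ => sum_mem fun j _ => Submodule.subset_span ?_
    exact ⟨_, _, by abel, _, single_mem_elementaryComponent g i j 1, _, hM i j, rfl⟩

end Components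

section Existence

variable {F : Type*} [Field F] {G : Type*} [AddCommGroup G] [DecidableEq G]

/-- Coordinates with respect to homogeneous matrix units and the matrix algebra structure of their
centralizer identify a central graded algebra with a tensor product `C ⊗ D`. -/
theorem GradedMatrixUnits.nonempty_tensorDecomposition [IsAlgClosed F] [Finite G] {n : ℕ}
    [NeZero n] {𝒜 : G → Submodule F (Matrix (Fin n) (Fin n) F)} [GradedAlgebra 𝒜]
    (U : GradedMatrixUnits 𝒜) : Nonempty (TensorDecomposition 𝒜) := by
  obtain ⟨r, N, ε, hNZ, deg, W, hN, hε, hdeg, hrange, hmul, hone, hmem, hcomm⟩ :=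
    U.exists_fine_generators
  -- the isomorphism `θ` of `D` with the centralizer of the matrix units
  set θ : Matrix (∀ l, Fin (N l)) (∀ l, Fin (N l)) F →ₗ[F] Matrix (Fin n) (Fin n) F :=
    (fineBasis hε).constr F W with hθ
  have hθW : ∀ t, θ (fineElement ε t) = W t := fun t => by
    rw [← fineBasis_apply hε, hθ, Module.Basis.constr_basis]
  have hθone : θ 1 = 1 := by rw [← fineElement_zero (ε := ε), hθW, hone]
  have hθmul : ∀ A B, θ (A * B) = θ A * θ B := by
    have h : (LinearMap.mul F _).compr₂ θ = (LinearMap.mul F _).compl₁₂ θ θ := by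
      refine (fineBasis hε).ext fun s => (fineBasis hε).ext fun t => ?_
      simp only [LinearMap.compr₂_apply, LinearMap.compl₁₂_apply, LinearMap.mul_apply',
        fineBasis_apply, fineElement_mul hε, map_smul, hθW, hmul]
    exact fun A B => LinearMap.congr_fun₂ h A B
  have hθcomm : ∀ A i j, Commute (θ A) (U.E i j) := by
    intro A i j
    rw [← (fineBasis hε).sum_repr A, map_sum]
    refine Commute.sum_left _ _ _ fun t _ => ?_
    rw [map_smul, fineBasis_apply, hθW]
    exact (hcomm t i j).smul_left _
  have hθmem : ∀ g, ∀ A ∈ fineComponent ε deg g, θ A ∈ 𝒜 g := by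
    intro g A hA
    by_cases hg : g ∈ Set.range deg
    · obtain ⟨t, rfl⟩ := hg
      obtain ⟨c, rfl⟩ := exists_eq_smul_of_mem_fineComponent hdeg hA
      rw [map_smul, hθW]
      exact Submodule.smul_mem _ _ (hmem t)
    · rw [eq_zero_of_mem_fineComponent hg hA, map_zero]
      exact zero_mem _
  -- every homogeneous element of the centralizer of the matrix units is in the image of `θ`
  have hθsurj : ∀ g, ∀ x ∈ 𝒜 g, (∀ i j, Commute x (U.E i j)) →
      ∃ A ∈ fineComponent ε deg g, θ A = x := by
    intro g x hx hxE
    by_cases h0 : x = 0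
    · exact ⟨0, zero_mem _, by rw [map_zero, h0]⟩
    obtain ⟨t, ht, c, hc⟩ := U.exists_eq_smul g x hx hxE h0
    obtain ⟨s, rfl⟩ := (hrange g).2 (ht ▸ t.2)
    have hW0 : W s ≠ 0 := fun h => by
      have h1 := hmul s (-s)
      rw [h, zero_mul, add_neg_cancel, hone] at h1
      exact smul_ne_zero (twist_ne_zero (fun l => (hε l).ne_zero (NeZero.ne _)) s (-s))
        one_ne_zero h1.symm
    obtain ⟨t', ht', c', hc'⟩ := U.exists_eq_smul _ _ (hmem s) (hcomm s) hW0
    have : t = t' := Subtype.ext (ht.trans ht'.symm)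
    subst this
    have hc0 : c' ≠ 0 := fun h => hW0 (by rw [hc', h, zero_smul])
    refine ⟨(c * c'⁻¹) • fineElement ε s, Submodule.smul_mem _ _ (fineElement_mem s), ?_⟩
    rw [map_smul, hθW, hc', smul_smul, mul_assoc, inv_mul_cancel₀ hc0, mul_one, hc]
  -- `∑ E_ij ⊗ M_ij` is mapped to `∑ θ(M_ij) E i j`
  let Θl : Matrix (Fin U.m × ∀ l, Fin (N l)) (Fin U.m × ∀ l, Fin (N l)) F →ₗ[F]
      Matrix (Fin n) (Fin n) F :=
    { toFun := fun M => ∑ i, ∑ j, θ (blk M i j) * U.E i j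
      map_add' := fun M M' => by
        simp only [blk_add, map_add, add_mul, Finset.sum_add_distrib]
      map_smul' := fun c M => by
        simp only [blk_smul, map_smul, smul_mul_assoc, Finset.smul_sum, RingHom.id_apply] }
  have hΘone : Θl 1 = 1 := by
    change ∑ i, ∑ j, θ (blk 1 i j) * U.E i j = 1
    rw [← U.sum_E]
    refine Finset.sum_congr rfl fun i _ => ?_
    rw [Finset.sum_eq_single i]
    · rw [blk_one, if_pos rfl, hθone, one_mul]
    · intro j _ hj
      rw [blk_one, if_neg hj.symm, map_zero, zero_mul]
    · simp
  have hΘmul : ∀ M M', Θl (M * M') = Θl M * Θl M' := by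
    intro M M'
    change ∑ i, ∑ j, θ (blk (M * M') i j) * U.E i j =
      (∑ i, ∑ j, θ (blk M i j) * U.E i j) * ∑ i, ∑ j, θ (blk M' i j) * U.E i j
    have hrow : ∀ i j, θ (blk M i j) * U.E i j * ∑ i', ∑ k, θ (blk M' i' k) * U.E i' k =
        ∑ k, θ (blk M i j * blk M' j k) * U.E i k := by
      intro i j
      rw [Finset.mul_sum, Finset.sum_eq_single j]
      · rw [Finset.mul_sum]
        refine Finset.sum_congr rfl fun k _ => ?_
        rw [mul_assoc (θ (blk M i j)), ← mul_assoc (U.E i j), ← (hθcomm _ i j).eq,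
          mul_assoc (θ (blk M' j k)), U.E_mul, if_pos rfl, hθmul, mul_assoc]
      · intro j' _ hj'
        rw [Finset.mul_sum]
        refine Finset.sum_eq_zero fun k _ => ?_
        rw [mul_assoc (θ (blk M i j)), ← mul_assoc (U.E i j), ← (hθcomm _ i j).eq,
          mul_assoc (θ (blk M' j' k)), U.E_mul, if_neg hj'.symm, mul_zero, mul_zero]
      · simp
    rw [Finset.sum_mul]
    refine Finset.sum_congr rfl fun i _ => ?_
    rw [Finset.sum_mul]
    simp only [hrow, blk_mul, map_sum, Finset.sum_mul]
    exact Finset.sum_comm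
  let Θ := AlgHom.ofLinearMap Θl hΘone hΘmul
  have hΘ : ∀ M, Θ M = ∑ i, ∑ j, θ (blk M i j) * U.E i j := fun M => rfl
  have : Nonempty (Fin U.m) := ⟨⟨0, U.pos⟩⟩
  -- a matrix algebra is simple
  have hinj : Function.Injective Θ := Θ.toRingHom.injective
  have hΘmem : ∀ g, ∀ M ∈ tensorComponent (elementaryComponent F fun i => -U.h i)
      (fineComponent ε deg) g, Θ M ∈ 𝒜 g := by
    intro g M hM
    rw [mem_tensorComponent_iff] at hM
    rw [hΘ]
    refine sum_mem fun i _ => sum_mem fun j _ => ?_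
    have := SetLike.GradedMul.mul_mem (hθmem _ _ (hM i j)) (U.E_mem i j)
    rwa [show g + -U.h i - -U.h j + (U.h i - U.h j) = g by abel] at this
  have hΘsurj : ∀ g, ∀ x ∈ 𝒜 g, ∃ M ∈ tensorComponent (elementaryComponent F fun i => -U.h i)
      (fineComponent ε deg) g, Θ M = x := by
    intro g x hx
    choose A hA hAx using fun i j => hθsurj _ _ (U.entry_mem hx i j) (U.entry_commute x i j)
    refine ⟨Matrix.of fun p q => A p.1 q.1 p.2 q.2, mem_tensorComponent_iff.2 fun i j => ?_, ?_⟩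
    · have := hA i j
      rwa [show g - U.h i + U.h j = g + -U.h i - -U.h j by abel] at this
    · rw [hΘ, U.eq_sum_entry x]
      exact Finset.sum_congr rfl fun i _ => Finset.sum_congr rfl fun j _ => by
        rw [← hAx i j]
        rfl
  have hsurj : Function.Surjective Θ := by
    intro x
    classical
    choose M _ hM using fun g => hΘsurj g _ (SetLike.coe_mem (DirectSum.decompose 𝒜 x g))
    refine ⟨∑ g ∈ (DirectSum.decompose 𝒜 x).support, M g, ?_⟩
    rw [map_sum]
    conv_rhs => rw [← DirectSum.sum_support_decompose 𝒜 x]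
    exact Finset.sum_congr rfl fun g _ => hM g
  let e := AlgEquiv.ofBijective Θ ⟨hinj, hsurj⟩
  refine ⟨⟨U.m, fun i => -U.h i, r, N, hN, ε, hε, deg, hdeg, ?_, e.symm, ?_⟩⟩
  · intro h hne hh
    obtain ⟨i, j, rfl⟩ := exists_of_elementaryComponent_ne_bot hne
    rw [hrange] at hh
    have := U.h_eq i j (by rwa [neg_neg, ← sub_eq_add_neg] at hh)
    rw [neg_neg, this, add_neg_cancel]
  · intro g
    ext M
    constructor
    · rintro ⟨x, hx, rfl⟩
      obtain ⟨M, hM, rfl⟩ := hΘsurj g x hx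
      have : e.symm (Θ M) = M := e.symm_apply_apply M
      change e.symm (Θ M) ∈ _
      rwa [this]
    · intro hM
      exact ⟨Θ M, hΘmem g M hM, e.symm_apply_apply M⟩

/-- A matrix algebra is prime. -/
theorem matrix_prime {n : ℕ} (a b : Matrix (Fin n) (Fin n) F) (ha : a ≠ 0) (hb : b ≠ 0) :
    ∃ r, a * r * b ≠ 0 := by
  obtain ⟨i, j, hij⟩ : ∃ i j, a i j ≠ 0 := by
    by_contra! h
    exact ha (Matrix.ext h)
  obtain ⟨k, l, hkl⟩ : ∃ k l, b k l ≠ 0 := by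
    by_contra! h
    exact hb (Matrix.ext h)
  refine ⟨Matrix.single j k 1, fun h => mul_ne_zero hij hkl ?_⟩
  have := congrFun (congrFun h i) l
  simpa [Matrix.mul_apply, Matrix.single_apply, Finset.sum_ite_eq, Finset.sum_ite_eq',
    ite_and] using this

/-- Every grading of a matrix algebra over an algebraically closed field by a finite abelian group
is the tensor product of an elementary grading and of `ε`-gradings. -/
theorem nonempty_tensorDecomposition [IsAlgClosed F] [Finite G] {n : ℕ} (hn : 0 < n)
    (𝒜 : G → Submodule F (Matrix (Fin n) (Fin n) F)) [GradedAlgebra 𝒜] :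
    Nonempty (TensorDecomposition 𝒜) := by
  have : NeZero n := ⟨hn.ne'⟩
  obtain ⟨U⟩ := nonempty_gradedMatrixUnits 𝒜 matrix_prime
  exact U.nonempty_tensorDecomposition

end Existence

/-! ### Normal forms of symmetric and skew-symmetric matrices -/

section BilinearNormalForms

variable {F : Type*} [Field F]

theorem transpose_mul_mul_apply {α β : Type*} [Fintype α] [DecidableEq α] (M : Matrix α α F)
    (Q : Matrix α β F) (a b : β) :
    (Q.transpose * M * Q) a b = Matrix.toBilin' M (fun x => Q x a) (fun x => Q x b) := by
  rw [Matrix.toBilin'_apply', Matrix.dotProduct_mulVec]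
  simp only [Matrix.mul_apply, Matrix.transpose_apply, dotProduct, Matrix.vecMul]

theorem toBilin'_transpose {α : Type*} [Fintype α] [DecidableEq α] (M : Matrix α α F)
    (x y : α → F) : Matrix.toBilin' M.transpose x y = Matrix.toBilin' M y x := by
  rw [Matrix.toBilin'_apply', Matrix.toBilin'_apply', Matrix.mulVec_transpose, dotProduct_comm,
    Matrix.dotProduct_mulVec]

theorem nondegenerate_toBilin'_of_isUnit {α : Type*} [Fintype α] [DecidableEq α] {M : Matrix α α F}
    (hM : IsUnit M) : (Matrix.toBilin' M).Nondegenerate :=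
  (Matrix.nondegenerate_of_det_ne_zero ((Matrix.isUnit_iff_isUnit_det M).1 hM).ne_zero).toBilin'

/-- Over an algebraically closed field of characteristic different from `2` every invertible
symmetric matrix is congruent to the identity matrix. -/
theorem exists_transpose_mul_mul_eq_one [IsAlgClosed F] (h2 : (2 : F) ≠ 0) {α : Type*} [Fintype α]
    [DecidableEq α] {M : Matrix α α F} (hM : IsUnit M) (hsymm : M.transpose = M) :
    ∃ Q : Matrix α α F, Q.transpose * M * Q = 1 := by
  have : Invertible (2 : F) := invertibleOfNonzero h2
  set B := Matrix.toBilin' M with hB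
  have hBsymm : LinearMap.IsSymm B := ⟨fun x y => by
    rw [hB, RingHom.id_apply, ← toBilin'_transpose, hsymm]⟩
  obtain ⟨v, hv⟩ := LinearMap.BilinForm.exists_orthogonal_basis hBsymm
  have hne := hv.not_isOrtho_basis_self_of_separatingLeft (nondegenerate_toBilin'_of_isUnit hM).1
  -- square roots normalize an orthogonal basis
  choose c hc using fun i => IsAlgClosed.exists_pow_nat_eq (B (v i) (v i))⁻¹ (two_pos)
  let e : α ≃ Fin (Module.finrank F (α → F)) := Fintype.equivOfCardEq (by simp)
  refine ⟨Matrix.of fun x a => (c (e a) • v (e a)) x, ?_⟩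
  ext a b
  rw [transpose_mul_mul_apply]
  change B (c (e a) • v (e a)) (c (e b) • v (e b)) = _
  rw [map_smul, map_smul, LinearMap.smul_apply, smul_eq_mul, smul_eq_mul, ← mul_assoc]
  by_cases hab : a = b
  · subst hab
    rw [Matrix.one_apply_eq, ← sq, hc, inv_mul_cancel₀ (hne _)]
  · rw [Matrix.one_apply_ne hab]
    have : B (v (e a)) (v (e b)) = 0 := hv (fun h => hab (e.injective h))
    rw [this, mul_zero]

section Symplectic

variable {V : Type*} [AddCommGroup V] [Module F V]

/-- A hyperbolic family of length `p` for the bilinear form `B`. -/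
structure IsHyperbolic (B : LinearMap.BilinForm F V) {p : ℕ} (v w : Fin p → V) : Prop where
  vv : ∀ i j, B (v i) (v j) = 0
  ww : ∀ i j, B (w i) (w j) = 0
  vw : ∀ i j, B (v i) (w j) = if i = j then 1 else 0
  wv : ∀ i j, B (w i) (v j) = if i = j then -1 else 0

variable {B : LinearMap.BilinForm F V} {p : ℕ} {v w : Fin p → V}

/-- The projection onto the span of a hyperbolic family along its orthogonal complement. -/
def hyperbolicProj (B : LinearMap.BilinForm F V) (v w : Fin p → V) (x : V) : V :=
  ∑ i, (B x (w i) • v i - B x (v i) • w i)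

namespace IsHyperbolic

variable (hvw : IsHyperbolic B v w)
include hvw

theorem linearIndependent : LinearIndependent F (Sum.elim v w) := by
  rw [Fintype.linearIndependent_iff]
  intro c hc
  have hsum : ∑ i, c (Sum.inl i) • v i + ∑ i, c (Sum.inr i) • w i = 0 := by
    simpa [Fintype.sum_sum_type] using hc
  rintro (j | j)
  · have := congrArg (fun x => B x (w j)) hsum
    simpa [hvw.vw, hvw.ww] using this
  · have := congrArg (fun x => B x (v j)) hsum
    simpa [hvw.wv, hvw.vv] using this

theorem hyperbolicProj_apply_v (x : V) (j : Fin p) :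
    B (hyperbolicProj B v w x) (v j) = B x (v j) := by
  simp [hyperbolicProj, hvw.vv, hvw.wv]

theorem hyperbolicProj_apply_w (x : V) (j : Fin p) :
    B (hyperbolicProj B v w x) (w j) = B x (w j) := by
  simp [hyperbolicProj, hvw.ww, hvw.vw]

/-- A hyperbolic family that does not span can be extended by one hyperbolic pair. -/
theorem extend (halt : ∀ x, B x x = 0) (hnd : B.Nondegenerate) {x : V}
    (hx : hyperbolicProj B v w x ≠ x) :
    ∃ v' w' : Fin (p + 1) → V, IsHyperbolic B v' w' := by
  have hskew : ∀ x y, B x y = - B y x := fun x y => by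
    have h := halt (x + y)
    simp only [map_add, LinearMap.add_apply, halt, zero_add, add_zero] at h
    exact eq_neg_of_add_eq_zero_right h
  set x₁ := x - hyperbolicProj B v w x with hx₁
  have hx₁v : ∀ j, B x₁ (v j) = 0 := fun j => by
    rw [hx₁, map_sub, LinearMap.sub_apply, hvw.hyperbolicProj_apply_v, sub_self]
  have hx₁w : ∀ j, B x₁ (w j) = 0 := fun j => by
    rw [hx₁, map_sub, LinearMap.sub_apply, hvw.hyperbolicProj_apply_w, sub_self]
  obtain ⟨y, hy⟩ : ∃ y, B x₁ y ≠ 0 := by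
    by_contra! hcon
    exact hx (sub_eq_zero.1 (hnd.1 x₁ hcon)).symm
  clear_value x₁
  set y₁ := (B x₁ y)⁻¹ • (y - hyperbolicProj B v w y) with hy₁
  have hy₁v : ∀ j, B y₁ (v j) = 0 := fun j => by
    rw [hy₁, map_smul, LinearMap.smul_apply, map_sub, LinearMap.sub_apply,
      hvw.hyperbolicProj_apply_v, sub_self, smul_zero]
  have hy₁w : ∀ j, B y₁ (w j) = 0 := fun j => by
    rw [hy₁, map_smul, LinearMap.smul_apply, map_sub, LinearMap.sub_apply,
      hvw.hyperbolicProj_apply_w, sub_self, smul_zero]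
  have hxproj : B x₁ (hyperbolicProj B v w y) = 0 := by
    simp [hyperbolicProj, hx₁v, hx₁w]
  have hxy : B x₁ y₁ = 1 := by
    rw [hy₁, map_smul, map_sub, hxproj, sub_zero, smul_eq_mul, inv_mul_cancel₀ hy]
  refine ⟨Fin.cons x₁ v, Fin.cons y₁ w, ?_, ?_, ?_, ?_⟩
  · refine Fin.cases (Fin.cases (halt _) hx₁v) fun i => Fin.cases ?_ (hvw.vv i)
    simp [hskew (v i), hx₁v]
  · refine Fin.cases (Fin.cases (halt _) hy₁w) fun i => Fin.cases ?_ (hvw.ww i)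
    simp [hskew (w i), hy₁w]
  · refine Fin.cases (Fin.cases ?_ fun j => ?_) fun i => Fin.cases ?_ fun j => ?_
    · simpa using hxy
    · simp [hx₁w, (Fin.succ_ne_zero j).symm]
    · simp [hskew (v i), hy₁v]
    · simp [hvw.vw]
  · refine Fin.cases (Fin.cases ?_ fun j => ?_) fun i => Fin.cases ?_ fun j => ?_
    · simp [hskew y₁, hxy]
    · simp [hy₁v, (Fin.succ_ne_zero j).symm]
    · simp [hskew (w i), hx₁w]
    · simp [hvw.wv]

end IsHyperbolic

/-- A nondegenerate alternating form has a symplectic basis. -/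
theorem exists_hyperbolic_basis [FiniteDimensional F V] (halt : ∀ x, B x x = 0)
    (hnd : B.Nondegenerate) :
    ∃ (p : ℕ) (v w : Fin p → V), IsHyperbolic B v w ∧ Module.finrank F V = p + p := by
  obtain ⟨p, v, w, h, hproj⟩ : ∃ (p : ℕ) (v w : Fin p → V), IsHyperbolic B v w ∧
      ∀ x, hyperbolicProj B v w x = x := by
    by_contra! hcon
    have hall : ∀ p : ℕ, ∃ v w : Fin p → V, IsHyperbolic B v w := by
      intro p
      induction p with
      | zero => exact ⟨Fin.elim0, Fin.elim0, fun i => i.elim0, fun i => i.elim0,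
          fun i => i.elim0, fun i => i.elim0⟩
      | succ p ih =>
        obtain ⟨v, w, h⟩ := ih
        obtain ⟨x, hx⟩ := hcon p v w h
        exact h.extend halt hnd hx
    obtain ⟨v, w, h⟩ := hall (Module.finrank F V + 1)
    have := h.linearIndependent.fintype_card_le_finrank
    simp only [Fintype.card_sum, Fintype.card_fin] at this
    omega
  refine ⟨p, v, w, h, ?_⟩
  have hspan : ⊤ ≤ Submodule.span F (Set.range (Sum.elim v w)) := by
    intro x _
    rw [← hproj x]
    refine sum_mem fun i _ => sub_mem (Submodule.smul_mem _ _ (Submodule.subset_span ?_))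
      (Submodule.smul_mem _ _ (Submodule.subset_span ?_))
    · exact ⟨Sum.inl i, rfl⟩
    · exact ⟨Sum.inr i, rfl⟩
  rw [Module.finrank_eq_card_basis (Module.Basis.mk h.linearIndependent hspan)]
  simp

end Symplectic

/-- In characteristic different from `2` every invertible skew-symmetric matrix is congruent to the
standard symplectic matrix. -/
theorem exists_transpose_mul_mul_eq_symplectic (h2 : (2 : F) ≠ 0) {α : Type*} [Fintype α]
    [DecidableEq α] {M : Matrix α α F} (hM : IsUnit M) (hskew : M.transpose = -M) :
    ∃ (p : ℕ) (e : Fin p ⊕ Fin p ≃ α) (Q : Matrix (Fin p ⊕ Fin p) (Fin p ⊕ Fin p) F),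
      Q.transpose * M.submatrix e e * Q = Matrix.fromBlocks 0 1 (-1) 0 := by
  have halt : ∀ x, Matrix.toBilin' M x x = 0 := fun x => by
    have h := toBilin'_transpose M x x
    rw [hskew, map_neg, LinearMap.neg_apply, LinearMap.neg_apply, neg_eq_iff_add_eq_zero,
      ← two_mul] at h
    exact (mul_eq_zero.1 h).resolve_left h2
  obtain ⟨p, v, w, h, hcard⟩ := exists_hyperbolic_basis halt (nondegenerate_toBilin'_of_isUnit hM)
  let e : Fin p ⊕ Fin p ≃ α := Fintype.equivOfCardEq (by
    rw [Module.finrank_fintype_fun_eq_card] at hcard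
    simp [hcard])
  let Q₀ : Matrix α (Fin p ⊕ Fin p) F := Matrix.of fun x a => Sum.elim v w a x
  have hQ₀ : Q₀.transpose * M * Q₀ = Matrix.fromBlocks 0 1 (-1) 0 := by
    ext a b
    rw [transpose_mul_mul_apply]
    change Matrix.toBilin' M (Sum.elim v w a) (Sum.elim v w b) = _
    rcases a with a | a <;> rcases b with b | b
    · simp [h.vv]
    · simp [h.vw, Matrix.one_apply]
    · simp only [Sum.elim_inl, Sum.elim_inr, h.wv, Matrix.fromBlocks_apply₂₁, Matrix.neg_apply,
        Matrix.one_apply]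
      split_ifs <;> simp
    · simp [h.ww]
  refine ⟨p, e, Q₀.submatrix e id, ?_⟩
  rw [Matrix.transpose_submatrix, Matrix.submatrix_mul_equiv, Matrix.submatrix_mul_equiv, hQ₀,
    Matrix.submatrix_id_id]

end BilinearNormalForms

/-! ### Matrices that permute the classes of indices -/

section ClassShift

variable {F : Type*} [Field F] {ι W : Type*} {cl : ι → W}

/-- The rows and columns of `A` are divided into classes by `cl`, and the nonzero entries of `A` in
the rows of the class `w` lie in the columns of the class `σ w`. For `σ = id` these are the block
diagonal matrices. -/
def ClassShift (cl : ι → W) (σ : W → W) (A : Matrix ι ι F) : Prop :=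
  ∀ i j, A i j ≠ 0 → cl j = σ (cl i)

theorem ClassShift.mul [Fintype ι] {σ τ : W → W} {A B : Matrix ι ι F} (hA : ClassShift cl σ A)
    (hB : ClassShift cl τ B) : ClassShift cl (τ ∘ σ) (A * B) := by
  intro i j hij
  rw [Matrix.mul_apply] at hij
  obtain ⟨k, -, hk⟩ := Finset.exists_ne_zero_of_sum_ne_zero hij
  rw [hB k j (right_ne_zero_of_mul hk), hA i k (left_ne_zero_of_mul hk)]
  rfl

theorem ClassShift.transpose {σ : W → W} (hσ : Function.Involutive σ) {A : Matrix ι ι F}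
    (hA : ClassShift cl σ A) : ClassShift cl σ A.transpose := by
  intro i j hij
  rw [hA j i hij, hσ]

theorem ClassShift.transpose_id {A : Matrix ι ι F} (hA : ClassShift cl id A) :
    ClassShift cl id A.transpose :=
  hA.transpose fun _ => rfl

theorem classShift_single [DecidableEq ι] {i j : ι} (h : cl i = cl j) (c : F) :
    ClassShift cl id (Matrix.single i j c) := by
  intro a b hab
  rw [Matrix.single_apply] at hab
  split_ifs at hab with h'
  · rw [← h'.1, ← h'.2]
    exact h.symm
  · exact absurd rfl hab

variable [DecidableEq ι] [DecidableEq W]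

/-- The diagonal idempotent that projects onto the coordinates of the class `w`. -/
def classIdem (F : Type*) [Field F] (cl : ι → W) (w : W) : Matrix ι ι F :=
  Matrix.diagonal fun i => if cl i = w then 1 else 0

theorem classShift_classIdem (w : W) : ClassShift cl id (classIdem F cl w) := by
  intro i j hij
  by_cases h : i = j
  · rw [h]
    rfl
  · exact absurd (Matrix.diagonal_apply_ne _ h) hij

theorem classIdem_transpose (w : W) :
    (classIdem F cl w).transpose = classIdem F cl w :=
  Matrix.diagonal_transpose _

theorem classIdem_inj (hcl : Function.Surjective cl) {w w' : W}
    (h : classIdem F cl w = classIdem F cl w') : w = w' := by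
  obtain ⟨i, rfl⟩ := hcl w
  have := congrFun (congrFun h i) i
  simp only [classIdem, Matrix.diagonal_apply_eq, if_true] at this
  by_contra hne
  rw [if_neg hne] at this
  exact one_ne_zero this

variable [Fintype ι]

theorem ClassShift.classIdem_mul {σ : W → W} (hσ : Function.Involutive σ) {A : Matrix ι ι F}
    (hA : ClassShift cl σ A) (w : W) :
    classIdem F cl w * A = A * classIdem F cl (σ w) := by
  ext i j
  rw [classIdem, classIdem, Matrix.diagonal_mul, Matrix.mul_diagonal]
  by_cases h : A i j = 0
  · rw [h, mul_zero, zero_mul]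
  · rw [hA i j h]
    by_cases hw : cl i = w
    · rw [if_pos hw, if_pos (by rw [hw]), one_mul, mul_one]
    · rw [if_neg hw, if_neg (fun h' => hw (hσ.injective h')), zero_mul, mul_zero]

theorem ClassShift.of_classIdem_mul {σ : W → W} {A : Matrix ι ι F}
    (h : ∀ w, classIdem F cl w * A = A * classIdem F cl (σ w)) : ClassShift cl σ A := by
  intro i j hij
  have := congrFun (congrFun (h (cl i)) i) j
  rw [classIdem, classIdem, Matrix.diagonal_mul, Matrix.mul_diagonal, if_pos rfl, one_mul] at this
  by_contra hne
  rw [if_neg hne, mul_zero] at this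
  exact hij this

/-- `A` carries the central idempotent of the class `w` to that of `σ w`, so its inverse does the
reverse. -/
theorem ClassShift.inverse {σ : W → W} (hσ : Function.Involutive σ) {A B : Matrix ι ι F}
    (hA : ClassShift cl σ A) (hAB : A * B = 1) : ClassShift cl σ B := by
  have hBA : B * A = 1 := mul_eq_one_comm.1 hAB
  refine ClassShift.of_classIdem_mul fun w => ?_
  have h := hA.classIdem_mul hσ (σ w)
  rw [hσ] at h
  calc classIdem F cl w * B = B * A * classIdem F cl w * B := by rw [hBA, one_mul]
    _ = B * classIdem F cl (σ w) * (A * B) := by rw [mul_assoc B A, ← h]; simp only [mul_assoc]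
    _ = B * classIdem F cl (σ w) := by rw [hAB, mul_one]

omit [DecidableEq W] in
/-- The centralizer of the block diagonal matrices consists of the matrices that are scalar on
each class. The scalars may lie in a noncommutative ring `A`. -/
theorem eq_diagonal_of_commute_single {A : Type*} [Ring A] (hcl : Function.Surjective cl)
    {z : Matrix ι ι A}
    (hz : ∀ i j, cl i = cl j → Matrix.single i j (1 : A) * z = z * Matrix.single i j (1 : A)) :
    ∃ q : W → A, z = Matrix.diagonal fun i => q (cl i) := by
  refine ⟨fun w => z (Function.surjInv hcl w) (Function.surjInv hcl w), ?_⟩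
  have hentry : ∀ i j a b, cl i = cl j →
      (if a = i then z j b else 0) = if b = j then z a i else 0 := by
    intro i j a b h
    have h1 := congrFun (congrFun (hz i j h) a) b
    have h2 : (Matrix.single i j (1 : A) * z) a b = if a = i then z j b else 0 := by
      split_ifs with h'
      · rw [h', Matrix.single_mul_apply_same, one_mul]
      · exact Matrix.single_mul_apply_of_ne _ _ _ _ _ h' _
    have h3 : (z * Matrix.single i j (1 : A)) a b = if b = j then z a i else 0 := by
      split_ifs with h'
      · rw [h', Matrix.mul_single_apply_same, mul_one]
      · exact Matrix.mul_single_apply_of_ne _ _ _ _ _ h' _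
    rw [← h2, ← h3, h1]
  ext i j
  by_cases h : i = j
  · subst h
    rw [Matrix.diagonal_apply_eq]
    have := hentry i (Function.surjInv hcl (cl i)) i (Function.surjInv hcl (cl i))
      (Function.surjInv_eq hcl _).symm
    rw [if_pos rfl, if_pos rfl] at this
    exact this.symm
  · rw [Matrix.diagonal_apply_ne _ h]
    have := hentry i i i j rfl
    rwa [if_pos rfl, if_neg (Ne.symm h)] at this

end ClassShift

section Orbits

/-- Representatives for the orbits of an involution of a finite set. -/
theorem exists_orbit_representatives {W : Type*} [Finite W] {σ : W → W}
    (hσ : Function.Involutive σ) :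
    ∃ (k : ℕ) (o : W → Fin k) (s : Fin k → W), (∀ v, o (s v) = v) ∧
      ∀ w w', o w = o w' ↔ w' = w ∨ w' = σ w := by
  let r : Setoid W :=
    { r := fun w w' => w' = w ∨ w' = σ w
      iseqv :=
        { refl := fun _ => Or.inl rfl
          symm := by
            rintro x y (rfl | rfl)
            · exact Or.inl rfl
            · exact Or.inr (hσ x).symm
          trans := by
            rintro x y z (rfl | rfl) (rfl | rfl)
            · exact Or.inl rfl
            · exact Or.inr rfl
            · exact Or.inr rfl
            · exact Or.inl (hσ x) } }
  obtain ⟨k, ⟨e⟩⟩ := Finite.exists_equiv_fin (Quotient r)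
  refine ⟨k, fun w => e (Quotient.mk r w), fun v => (e.symm v).out, fun v => ?_, fun w w' => ?_⟩
  · change e (Quotient.mk r (e.symm v).out) = v
    rw [Quotient.out_eq, e.apply_symm_apply]
  · exact e.injective.eq_iff.trans Quotient.eq

end Orbits

section Intertwiner

variable {F : Type*} [Field F] {ι κ W : Type*} [Fintype ι] [DecidableEq ι] [Fintype κ]
  [DecidableEq κ] {cl : ι → W}

/-- An antiautomorphism `*` of the algebra of block diagonal matrices that is induced by an inner
one of a larger matrix algebra `X ↦ Φ⁻¹ Xᵀ Φ` is of the form `X ↦ A⁻¹ Xᵀ A`. The rows of `A` are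
rows of `Φ`. -/
theorem exists_intertwiner [Nonempty κ] (hcl : Function.Surjective cl)
    {Φ : Matrix (ι × κ) (ι × κ) F} (hΦ : IsUnit Φ) {star : Matrix ι ι F → Matrix ι ι F}
    (hstar : ∀ X, ClassShift cl id X → (X.transpose ⊗ₖ (1 : Matrix κ κ F)) * Φ =
      Φ * (star X ⊗ₖ (1 : Matrix κ κ F))) :
    ∃ A : Matrix ι ι F, IsUnit A ∧
      ∀ X, ClassShift cl id X → X.transpose * A = A * star X := by
  obtain ⟨x₀⟩ := ‹Nonempty κ›
  -- in each class, one slice `Φ (·, x₀) (·, y)` of `Φ` that does not vanish is selected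
  have hrow : ∀ w, ∃ y, ∃ j, Φ (Function.surjInv hcl w, x₀) (j, y) ≠ 0 := by
    intro w
    by_contra! hcon
    have hdet := ((Matrix.isUnit_iff_isUnit_det Φ).1 hΦ).ne_zero
    exact hdet (Matrix.det_eq_zero_of_row_eq_zero (Function.surjInv hcl w, x₀)
      fun p => hcon p.2 p.1)
  choose y j hyj using hrow
  set A : Matrix ι ι F := Matrix.of fun a b => Φ (a, x₀) (b, y (cl a)) with hA
  have hslice : ∀ X, ClassShift cl id X → ∀ a b y,
      ∑ c, X c a * Φ (c, x₀) (b, y) = ∑ c, Φ (a, x₀) (c, y) * star X c b := by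
    intro X hX a b y
    have := congrFun (congrFun (hstar X hX) (a, x₀)) (b, y)
    simpa [Matrix.mul_apply, Fintype.sum_prod_type, Matrix.kroneckerMap_apply,
      Matrix.one_apply] using this
  have hAint : ∀ X, ClassShift cl id X → X.transpose * A = A * star X := by
    intro X hX
    ext a b
    simp only [Matrix.mul_apply, Matrix.transpose_apply, hA, Matrix.of_apply]
    rw [← hslice X hX]
    refine Finset.sum_congr rfl fun c _ => ?_
    by_cases h : X c a = 0
    · rw [h, zero_mul, zero_mul]
    · have : cl a = cl c := hX c a h
      rw [this]
  have hAne : ∀ i, ∃ b, A i b ≠ 0 := by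
    intro i
    by_contra! hcon
    set i₀ := Function.surjInv hcl (cl i) with hi₀
    have hcli : cl i₀ = cl i := Function.surjInv_eq hcl _
    have h1 : Matrix.single i₀ i (1 : F) * A = 0 := by
      ext a b
      by_cases h : a = i₀
      · rw [h, Matrix.single_mul_apply_same, hcon, mul_zero]
        rfl
      · exact Matrix.single_mul_apply_of_ne _ _ _ _ _ h _
    have h2 : Matrix.single i₀ i₀ (1 : F) * A = 0 := by
      have h3 := hAint _ (classShift_single (F := F) hcli 1)
      rw [Matrix.transpose_single] at h3
      have h4 : Matrix.single i₀ i₀ (1 : F) = Matrix.single i₀ i 1 * Matrix.single i i₀ 1 := by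
        rw [Matrix.single_mul_single_same, mul_one]
      rw [h4, mul_assoc, h3, ← mul_assoc, h1, zero_mul]
    have h5 := congrFun (congrFun h2 i₀) (j (cl i))
    rw [Matrix.single_mul_apply_same, one_mul] at h5
    refine hyj (cl i) ?_
    have : A i₀ (j (cl i)) = Φ (i₀, x₀) (j (cl i), y (cl i)) := by
      rw [hA, Matrix.of_apply, hcli]
    rw [← this]
    exact h5
  refine ⟨A, ?_, hAint⟩
  rw [Matrix.isUnit_iff_isUnit_det, isUnit_iff_ne_zero]
  intro hdet
  obtain ⟨v, hv, hvA⟩ := Matrix.exists_vecMul_eq_zero_iff.2 hdet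
  apply hv
  funext i
  have h1 := hAint _ (classShift_single (F := F) (rfl : cl i = cl i) 1)
  rw [Matrix.transpose_single] at h1
  have h2 : Matrix.vecMul v (Matrix.single i i (1 : F) * A) = 0 := by
    rw [h1, ← Matrix.vecMul_vecMul, hvA, Matrix.zero_vecMul]
  obtain ⟨b, hb⟩ := hAne i
  have h3 := congrFun h2 b
  have h4 : Matrix.vecMul v (Matrix.single i i (1 : F) * A) b = v i * A i b := by
    rw [Matrix.vecMul, dotProduct, Finset.sum_eq_single i]
    · rw [Matrix.single_mul_apply_same, one_mul]
    · intro c _ hc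
      rw [Matrix.single_mul_apply_of_ne _ _ _ _ _ hc, mul_zero]
    · simp
  rw [h4] at h3
  exact (mul_eq_zero.1 h3).resolve_right hb

end Intertwiner

/-! ### Involutions of the algebra of block diagonal matrices -/

section Involution

variable {F : Type*} [Field F] {ι W : Type*} [Fintype ι] [DecidableEq ι] [DecidableEq W]
  {cl : ι → W} {A : Matrix ι ι F} {star : Matrix ι ι F → Matrix ι ι F}

omit [DecidableEq W] in
/-- A map with an intertwiner reverses products of block diagonal matrices. -/
theorem star_mul_of_intertwiner (hA : IsUnit A)
    (hint : ∀ X, ClassShift cl id X → X.transpose * A = A * star X)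
    {X Y : Matrix ι ι F} (hX : ClassShift cl id X) (hY : ClassShift cl id Y) :
    star (X * Y) = star Y * star X := by
  have h := hint (X * Y) (hX.mul hY)
  rw [Matrix.transpose_mul, mul_assoc, hint X hX, ← mul_assoc, hint Y hY, mul_assoc] at h
  exact (hA.mul_left_cancel h).symm

/-- An involution of the algebra of block diagonal matrices permutes the central idempotents of
the blocks. The resulting permutation `σ` of the classes describes the zero pattern of an
intertwiner `A`. -/
theorem exists_class_involution (hcl : Function.Surjective cl) (hA : IsUnit A)
    (hint : ∀ X, ClassShift cl id X → X.transpose * A = A * star X)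
    (hstar : ∀ X, ClassShift cl id X → ClassShift cl id (star X))
    (hinv : ∀ X, ClassShift cl id X → star (star X) = X) :
    ∃ σ : W → W, Function.Involutive σ ∧ ClassShift cl σ A := by
  have hidem : ∀ w, ClassShift cl id (classIdem F cl w) := fun w => classShift_classIdem w
  have hself : ∀ w, classIdem F cl w * classIdem F cl w = classIdem F cl w := fun w => by
    rw [classIdem, Matrix.diagonal_mul_diagonal]
    congr 1
    funext i
    split_ifs <;> simp
  have hcentral : ∀ w X, ClassShift cl id X →
      classIdem F cl w * X = X * classIdem F cl w := fun w X hX =>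
    hX.classIdem_mul (fun _ => rfl) w
  have hdiag : ∀ w, ∃ f : W → F, star (classIdem F cl w) = Matrix.diagonal fun i => f (cl i) := by
    intro w
    refine eq_diagonal_of_commute_single hcl fun i j hij => ?_
    have hs := classShift_single (F := F) hij 1
    rw [← hinv _ hs, ← star_mul_of_intertwiner hA hint (hidem w) (hstar _ hs),
      hcentral w _ (hstar _ hs), star_mul_of_intertwiner hA hint (hstar _ hs) (hidem w)]
  choose f hf using hdiag
  have hf01 : ∀ w u, f w u = 0 ∨ f w u = 1 := by
    intro w u
    obtain ⟨i, rfl⟩ := hcl u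
    have h := star_mul_of_intertwiner hA hint (hidem w) (hidem w)
    rw [hself, hf, Matrix.diagonal_mul_diagonal] at h
    have h1 : f w (cl i) = f w (cl i) * f w (cl i) := congrFun (Matrix.diagonal_injective h) i
    rcases eq_or_ne (f w (cl i)) 0 with h0 | h0
    · exact Or.inl h0
    · exact Or.inr (mul_left_cancel₀ h0 (by rw [← h1, mul_one]))
  have hf1 : ∀ w, ∃ u, f w u = 1 := by
    intro w
    by_contra! hcon
    have h0 : star (classIdem F cl w) = 0 := by
      rw [hf, ← Matrix.diagonal_zero]
      congr 1
      funext i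
      exact (hf01 w (cl i)).resolve_right (hcon _)
    have h1 := hint _ (hidem w)
    rw [h0, mul_zero, classIdem_transpose] at h1
    have h2 : classIdem F cl w = 0 := hA.mul_right_cancel (by rw [h1, zero_mul])
    obtain ⟨i, rfl⟩ := hcl w
    have h3 := congrFun (congrFun h2 i) i
    rw [classIdem, Matrix.diagonal_apply_eq, if_pos rfl] at h3
    exact one_ne_zero h3
  choose σ hσ using hf1
  have hswap : ∀ w, star (classIdem F cl (σ w)) = classIdem F cl w := by
    intro w
    have h1 : classIdem F cl (σ w) * star (classIdem F cl w) = classIdem F cl (σ w) := by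
      rw [hf, classIdem, Matrix.diagonal_mul_diagonal]
      congr 1
      funext i
      split_ifs with h
      · rw [h, hσ, mul_one]
      · rw [zero_mul]
    have h2 := star_mul_of_intertwiner hA hint (hidem (σ w)) (hstar _ (hidem w))
    rw [h1, hinv _ (hidem w), hf, classIdem, Matrix.diagonal_mul_diagonal] at h2
    have h3 : ∀ u, u ≠ w → f (σ w) u = 0 := by
      intro u hu
      obtain ⟨i, rfl⟩ := hcl u
      have h4 : f (σ w) (cl i) = (if cl i = w then 1 else 0) * f (σ w) (cl i) :=
        congrFun (Matrix.diagonal_injective h2) i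
      rwa [if_neg hu, zero_mul] at h4
    have h5 : f (σ w) w = 1 := by
      have h6 := hσ (σ w)
      by_cases h : σ (σ w) = w
      · rwa [h] at h6
      · rw [h3 _ h] at h6
        exact absurd h6 zero_ne_one
    rw [hf, classIdem]
    congr 1
    funext i
    split_ifs with h
    · rw [h, h5]
    · exact h3 _ h
  have hσσ : ∀ w, star (classIdem F cl w) = classIdem F cl (σ w) := fun w => by
    rw [← hswap, hinv _ (hidem _)]
  refine ⟨σ, fun w => classIdem_inj (F := F) hcl ?_, ClassShift.of_classIdem_mul fun w => ?_⟩
  · rw [← hσσ, hswap]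
  · rw [← hσσ, ← hint _ (hidem w), classIdem_transpose]

omit [DecidableEq W] in
/-- An intertwiner of an involution is symmetric up to scalars on the classes: `A⁻¹ Aᵀ` commutes
with all block diagonal matrices. -/
theorem exists_symmetry_scalars (hcl : Function.Surjective cl) (hA : IsUnit A)
    (hint : ∀ X, ClassShift cl id X → X.transpose * A = A * star X)
    (hstar : ∀ X, ClassShift cl id X → ClassShift cl id (star X))
    (hinv : ∀ X, ClassShift cl id X → star (star X) = X) :
    ∃ c : W → F, ∀ i j, A j i = A i j * c (cl j) := by
  obtain ⟨A', hAA', hA'A⟩ := isUnit_iff_exists.1 hA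
  have hcomm : ∀ X, ClassShift cl id X → X * (A' * A.transpose) = A' * A.transpose * X := by
    intro X hX
    have h1 := hint _ (hstar X hX)
    rw [hinv X hX] at h1
    have h2 := congrArg Matrix.transpose (hint X hX)
    rw [Matrix.transpose_mul, Matrix.transpose_mul, Matrix.transpose_transpose] at h2
    rw [mul_assoc, h2, ← mul_assoc, ← mul_assoc]
    congr 1
    calc X * A' = A' * (A * X) * A' := by rw [← mul_assoc, hA'A, one_mul]
      _ = A' * (star X).transpose := by rw [← h1, mul_assoc, mul_assoc, hAA', mul_one]
  obtain ⟨c, hc⟩ := eq_diagonal_of_commute_single hcl fun i j hij =>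
    hcomm _ (classShift_single hij 1)
  refine ⟨c, fun i j => ?_⟩
  have h : A.transpose = A * Matrix.diagonal fun i => c (cl i) := by
    rw [← hc, ← mul_assoc, hAA', one_mul]
  have h1 := congrFun (congrFun h i) j
  rwa [Matrix.mul_diagonal] at h1

/-- The intertwiner of an involution can be scaled such that each of its blocks that belongs to a
pair of classes `w ≠ σ w` is the transpose of its partner. -/
theorem exists_normalized_intertwiner (hcl : Function.Surjective cl) (hA : IsUnit A)
    (hint : ∀ X, ClassShift cl id X → X.transpose * A = A * star X)
    {σ : W → W} (hσ : Function.Involutive σ) (hAσ : ClassShift cl σ A)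
    {c : W → F} (hc : ∀ i j, A j i = A i j * c (cl j))
    {k : ℕ} {o : W → Fin k} {s : Fin k → W} (hs : ∀ v, o (s v) = v)
    (ho : ∀ w w', o w = o w' ↔ w' = w ∨ w' = σ w)
    (hstar : ∀ X, ClassShift cl id X → ClassShift cl id (star X)) :
    ∃ (A' : Matrix ι ι F) (c' : W → F), IsUnit A' ∧
      (∀ X, ClassShift cl id X → X.transpose * A' = A' * star X) ∧ ClassShift cl σ A' ∧
      (∀ i j, A' j i = A' i j * c' (cl j)) ∧ (∀ w, c' w = 1 ∨ c' w = -1) ∧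
      ∀ w, σ w ≠ w → c' w = 1 := by
  have hcc : ∀ w, c w * c (σ w) = 1 := by
    intro w
    obtain ⟨i, rfl⟩ := hcl w
    have hne : ∃ j, A i j ≠ 0 := by
      by_contra! hcon
      exact ((Matrix.isUnit_iff_isUnit_det A).1 hA).ne_zero
        (Matrix.det_eq_zero_of_row_eq_zero i hcon)
    obtain ⟨j, hj⟩ := hne
    have : A i j * (c (cl i) * c (σ (cl i))) = A i j := by
      have h2 := hc j i
      rw [hc i j, hAσ i j hj] at h2
      rw [mul_comm (c (cl i)), ← mul_assoc]
      exact h2.symm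
    exact mul_left_cancel₀ hj (by rw [this, mul_one])
  have hρ : ∀ w, s (o w) = w ∨ s (o w) = σ w := fun w => (ho w _).1 (hs (o w)).symm
  have hoσ : ∀ w, o (σ w) = o w := fun w => ((ho w _).2 (Or.inr rfl)).symm
  -- only the columns of one of two interchanged classes are scaled
  set d : W → F := fun w => if s (o w) = w then 1 else c w with hd
  have hc0 : ∀ w, c w ≠ 0 := fun w => left_ne_zero_of_mul_eq_one (hcc w)
  have hd0 : ∀ w, d w ≠ 0 := fun w => by
    simp only [hd]
    split_ifs
    · exact one_ne_zero
    · exact hc0 w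
  have hdσ : ∀ w, σ w ≠ w → c w * d (σ w) = d w := by
    intro w hw
    simp only [hd, hoσ]
    rcases hρ w with h | h
    · rw [if_neg (fun h' => hw (h'.symm.trans h)), if_pos h, hcc]
    · rw [if_pos h, if_neg (fun h' => hw (h.symm.trans h')), mul_one]
  refine ⟨A * Matrix.diagonal fun i => d (cl i), fun w => c w * d (σ w) * (d w)⁻¹, ?_, ?_, ?_, ?_,
    ?_, ?_⟩
  · refine hA.mul ((Matrix.isUnit_iff_isUnit_det _).2 ?_)
    rw [Matrix.det_diagonal, isUnit_iff_ne_zero]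
    exact Finset.prod_ne_zero_iff.2 fun i _ => hd0 _
  · intro X hX
    rw [← mul_assoc, hint X hX, mul_assoc, mul_assoc]
    congr 1
    ext i j
    rw [Matrix.diagonal_mul, Matrix.mul_diagonal]
    by_cases h : star X i j = 0
    · rw [h, mul_zero, zero_mul]
    · have : cl j = cl i := hstar X hX i j h
      rw [this, mul_comm]
  · intro i j hij
    rw [Matrix.mul_diagonal] at hij
    exact hAσ i j (left_ne_zero_of_mul hij)
  · intro i j
    rw [Matrix.mul_diagonal, Matrix.mul_diagonal, hc i j]
    by_cases h : A i j = 0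
    · rw [h]
      simp
    · have : cl i = σ (cl j) := by rw [hAσ i j h, hσ]
      rw [this]
      field_simp [hd0 (cl j)]
  · intro w
    by_cases hw : σ w = w
    · have h1 : c w * c w = 1 := by
        have := hcc w
        rwa [hw] at this
      beta_reduce
      rw [hw, mul_assoc, mul_inv_cancel₀ (hd0 w), mul_one]
      exact mul_self_eq_one_iff.1 h1
    · left
      beta_reduce
      rw [hdσ w hw, mul_inv_cancel₀ (hd0 w)]
  · intro w hw
    beta_reduce
    rw [hdσ w hw, mul_inv_cancel₀ (hd0 w)]

end Involution

/-! ### The algebra of an orbit of classes -/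

section Corner

variable {F : Type*} [Field F] {ι α : Type*} [DecidableEq ι] [Fintype α]

theorem corner_apply_apply (u : α ↪ ι) (M : Matrix α α F) (a b : α) :
    corner u M (u a) (u b) = M a b := by
  classical
  simp [corner, Matrix.sum_apply, Matrix.single_apply, ite_and]

theorem corner_apply_of_forall_ne (u : α ↪ ι) (M : Matrix α α F) {i j : ι}
    (h : ∀ a b, ¬ (u a = i ∧ u b = j)) : corner u M i j = 0 := by
  simp only [corner, Matrix.sum_apply, Matrix.single_apply]
  exact Finset.sum_eq_zero fun a _ => Finset.sum_eq_zero fun b _ => if_neg (h a b)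

theorem eq_corner (u : α ↪ ι) {X : Matrix ι ι F}
    (hX : ∀ i j, (¬ ∃ a b, u a = i ∧ u b = j) → X i j = 0) :
    X = corner u (X.submatrix u u) := by
  ext i j
  by_cases h : ∃ a b, u a = i ∧ u b = j
  · obtain ⟨a, b, rfl, rfl⟩ := h
    rw [corner_apply_apply, Matrix.submatrix_apply]
  · rw [hX i j h, corner_apply_of_forall_ne]
    push Not at h
    exact fun a b hab => h a b hab.1 hab.2

theorem corner_transpose (u : α ↪ ι) (M : Matrix α α F) :
    (corner u M).transpose = corner u M.transpose := by
  simp only [corner, Matrix.transpose_sum, Matrix.transpose_single, Matrix.transpose_apply]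
  exact Finset.sum_comm

/-- The inclusion of the coordinates listed by `u`, as a rectangular matrix. -/
def embMatrix (F : Type*) [Field F] (u : α ↪ ι) : Matrix ι α F :=
  Matrix.of fun i a => if u a = i then 1 else 0

theorem corner_eq_mul [DecidableEq α] (u : α ↪ ι) (M : Matrix α α F) :
    corner u M = embMatrix F u * M * (embMatrix F u).transpose := by
  ext i j
  simp only [corner, Matrix.sum_apply, Matrix.single_apply, Matrix.mul_apply, embMatrix,
    Matrix.transpose_apply, Matrix.of_apply, ite_and]
  rw [Finset.sum_comm]
  refine Finset.sum_congr rfl fun b _ => ?_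
  rw [Finset.sum_mul]
  refine Finset.sum_congr rfl fun a _ => ?_
  split_ifs <;> simp

variable [Fintype ι]

omit [Fintype α] in
theorem embMatrix_transpose_mul_mul (u : α ↪ ι) (A : Matrix ι ι F) :
    (embMatrix F u).transpose * A * embMatrix F u = A.submatrix u u := by
  ext a b
  simp [Matrix.mul_apply, embMatrix, Finset.sum_ite_eq]

omit [Fintype α] in
theorem embMatrix_transpose_mul [DecidableEq α] (u : α ↪ ι) :
    (embMatrix F u).transpose * embMatrix F u = 1 := by
  have h := embMatrix_transpose_mul_mul u (1 : Matrix ι ι F)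
  rw [Matrix.mul_one] at h
  rw [h, Matrix.submatrix_one_embedding]

theorem corner_mul_corner (u : α ↪ ι) (M M' : Matrix α α F) :
    corner u M * corner u M' = corner u (M * M') := by
  classical
  rw [corner_eq_mul, corner_eq_mul, corner_eq_mul]
  rw [show embMatrix F u * M * (embMatrix F u).transpose *
      (embMatrix F u * M' * (embMatrix F u).transpose) = embMatrix F u * M *
      ((embMatrix F u).transpose * embMatrix F u) * M' * (embMatrix F u).transpose by
    simp only [Matrix.mul_assoc], embMatrix_transpose_mul, Matrix.mul_one,
    Matrix.mul_assoc (embMatrix F u)]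

theorem corner_mul_mul_corner (u : α ↪ ι) (M M' : Matrix α α F) (A : Matrix ι ι F) :
    corner u M * A * corner u M' = corner u (M * A.submatrix u u * M') := by
  classical
  rw [corner_eq_mul, corner_eq_mul, corner_eq_mul, ← embMatrix_transpose_mul_mul u A]
  simp only [Matrix.mul_assoc]

end Corner

section OrbitAlgebra

variable {F : Type*} [Field F] {ι W : Type*} [Fintype ι] [DecidableEq ι] {k : ℕ}

/-- The algebra of the block diagonal matrices that are supported on the classes of the orbit
`v`. The map `o` assigns to each class its orbit. -/
def orbitAlgebra (F : Type*) [Field F] {ι W : Type*} [Fintype ι] {k : ℕ} (cl : ι → W)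
    (o : W → Fin k) (v : Fin k) : NonUnitalSubalgebra F (Matrix ι ι F) where
  carrier := {X | ∀ i j, X i j ≠ 0 → cl i = cl j ∧ o (cl i) = v}
  add_mem' := by
    intro X Y hX hY i j hij
    by_cases h : X i j = 0
    · refine hY i j fun h' => hij ?_
      rw [Matrix.add_apply, h, h', add_zero]
    · exact hX i j h
  zero_mem' := fun i j hij => absurd rfl hij
  mul_mem' := by
    intro X Y hX hY i j hij
    rw [Matrix.mul_apply] at hij
    obtain ⟨c, -, hc⟩ := Finset.exists_ne_zero_of_sum_ne_zero hij
    have h1 := hX i c (left_ne_zero_of_mul hc)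
    exact ⟨h1.1.trans (hY c j (right_ne_zero_of_mul hc)).1, h1.2⟩
  smul_mem' := by
    intro c X hX i j hij
    exact hX i j (right_ne_zero_of_mul hij)

variable {cl : ι → W} {o : W → Fin k} {v : Fin k}

/-- The unit element of the orbit algebra. -/
def orbitIdem (F : Type*) [Field F] (cl : ι → W) (o : W → Fin k) (v : Fin k) : Matrix ι ι F :=
  Matrix.diagonal fun i => if o (cl i) = v then 1 else 0

variable {α : Type*} [Fintype α] {u : α ↪ ι}

theorem mem_orbitAlgebra_iff_corner (hu : ∀ i, o (cl i) = v ↔ ∃ a, u a = i) {X : Matrix ι ι F} :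
    X ∈ orbitAlgebra F cl o v ↔
      ∃ M : Matrix α α F, (∀ a b, cl (u a) ≠ cl (u b) → M a b = 0) ∧ X = corner u M := by
  constructor
  · intro hX
    refine ⟨X.submatrix u u, fun a b hab => ?_, eq_corner u fun i j hij => ?_⟩
    · by_contra h
      exact hab (hX _ _ h).1
    · by_contra h
      obtain ⟨h1, h2⟩ := hX i j h
      obtain ⟨a, ha⟩ := (hu i).1 h2
      obtain ⟨b, hb⟩ := (hu j).1 (h1 ▸ h2)
      exact hij ⟨a, b, ha, hb⟩
  · rintro ⟨M, hM, rfl⟩ i j hij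
    have : ∃ a b, u a = i ∧ u b = j := by
      by_contra hcon
      push Not at hcon
      exact hij (corner_apply_of_forall_ne u M fun a b hab => hcon a b hab.1 hab.2)
    obtain ⟨a, b, rfl, rfl⟩ := this
    rw [corner_apply_apply] at hij
    refine ⟨?_, (hu _).2 ⟨a, rfl⟩⟩
    by_contra h
    exact hij (hM a b h)

omit [Fintype ι] in
theorem corner_one_eq_orbitIdem [DecidableEq α] (hu : ∀ i, o (cl i) = v ↔ ∃ a, u a = i) :
    corner u (1 : Matrix α α F) = orbitIdem F cl o v := by
  refine (eq_corner u ?_ : orbitIdem F cl o v = _).symm ▸ ?_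
  · intro i j hij
    rw [orbitIdem, Matrix.diagonal_apply]
    split_ifs with h1 h2
    · obtain ⟨a, ha⟩ := (hu i).1 h2
      exact absurd ⟨a, a, ha, h1 ▸ ha⟩ hij
    · rfl
    · rfl
  · congr 1
    ext a b
    rw [Matrix.submatrix_apply, orbitIdem, Matrix.diagonal_apply, Matrix.one_apply,
      if_pos ((hu _).2 ⟨a, rfl⟩)]
    simp [u.injective.eq_iff]

/-- A congruence of the form restricted to an orbit, seen as a congruence of the whole form. -/
theorem exists_orbit_congruence [DecidableEq α] (hu : ∀ i, o (cl i) = v ↔ ∃ a, u a = i)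
    (A : Matrix ι ι F) {Q Q' : Matrix α α F} (hQQ' : Q * Q' = 1)
    (hQ : ∀ a b, cl (u a) ≠ cl (u b) → Q a b = 0)
    (hQ' : ∀ a b, cl (u a) ≠ cl (u b) → Q' a b = 0) :
    ∃ P ∈ orbitAlgebra F cl o v, ∃ P' ∈ orbitAlgebra F cl o v, P * P' = orbitIdem F cl o v ∧
      P.transpose * A * P = corner u (Q.transpose * A.submatrix u u * Q) := by
  refine ⟨corner u Q, (mem_orbitAlgebra_iff_corner hu).2 ⟨Q, hQ, rfl⟩, corner u Q',
    (mem_orbitAlgebra_iff_corner hu).2 ⟨Q', hQ', rfl⟩, ?_, ?_⟩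
  · rw [corner_mul_corner, hQQ', corner_one_eq_orbitIdem hu]
  · rw [corner_transpose, corner_mul_mul_corner]

end OrbitAlgebra

section NormalForm

variable {F : Type*} [Field F] {ι W : Type*} [Fintype ι] [DecidableEq ι] {cl : ι → W} {k : ℕ}
  {σ : W → W} {A : Matrix ι ι F}

/-- The block of an invertible class shift that belongs to the classes `w` and `σ w` is
invertible. -/
theorem ClassShift.submatrix_mul_submatrix {B : Matrix ι ι F} (hA : ClassShift cl σ A)
    (hAB : A * B = 1) {α β : Type*} [DecidableEq α] [Fintype β] {u : α ↪ ι}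
    {u' : β ↪ ι} {w : W} (hu : ∀ a, cl (u a) = w) (hu' : ∀ i, cl i = σ w ↔ ∃ b, u' b = i) :
    A.submatrix u u' * B.submatrix u' u = 1 := by
  ext a a'
  rw [← Matrix.submatrix_one_embedding u, ← hAB, Matrix.mul_apply, Matrix.submatrix_apply,
    Matrix.mul_apply]
  refine Fintype.sum_of_injective u' u'.injective _ _ (fun j hj => ?_) fun b => rfl
  by_cases h : A (u a) j = 0
  · rw [h, zero_mul]
  · have h1 := hA _ _ h
    rw [hu] at h1
    exact absurd ((hu' j).1 h1) hj

variable [IsAlgClosed F] [DecidableEq W]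

/-- On each orbit of the class involution the normalized intertwiner is congruent to one of the
three normal forms: a fixed class carries a symmetric or a skew-symmetric form, and a pair of
interchanged classes carries a form that is determined by one invertible block. -/
theorem exists_orbit_normalBlock (h2 : (2 : F) ≠ 0) (hσ : Function.Involutive σ) {o : W → Fin k}
    {s : Fin k → W} (hs : ∀ v, o (s v) = v) (ho : ∀ w w', o w = o w' ↔ w' = w ∨ w' = σ w)
    (hA : IsUnit A) (hAσ : ClassShift cl σ A) {c : W → F}
    (hc : ∀ i j, A j i = A i j * c (cl j)) (hc1 : ∀ w, c w = 1 ∨ c w = -1)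
    (hc2 : ∀ w, σ w ≠ w → c w = 1) (v : Fin k) :
    ∃ P ∈ orbitAlgebra F cl o v, ∃ P' ∈ orbitAlgebra F cl o v, P * P' = orbitIdem F cl o v ∧
      IsNormalBlock (orbitAlgebra F cl o v) (P.transpose * A * P) := by
  obtain ⟨B, hAB, hBA⟩ := isUnit_iff_exists.1 hA
  have hBσ := hAσ.inverse hσ hAB
  set w := s v with hw
  have horb : ∀ i, o (cl i) = v ↔ cl i = w ∨ cl i = σ w := fun i => by
    rw [← ho, hw, hs, eq_comm]
  by_cases hfix : σ w = w
  · have horb' : ∀ i, o (cl i) = v ↔ cl i = w := fun i => by rw [horb, hfix, or_self]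
    rcases hc1 w with hcw | hcw
    · -- the form is symmetric on the class `w`
      let f : Fin (Fintype.card {i // cl i = w}) ≃ {i // cl i = w} :=
        (Fintype.equivFin _).symm
      let u := f.toEmbedding.trans (Function.Embedding.subtype _)
      have hucl : ∀ a, cl (u a) = w := fun a => (f a).2
      have hu : ∀ i, cl i = w ↔ ∃ a, u a = i := fun i =>
        ⟨fun h => ⟨f.symm ⟨i, h⟩, by simp [u]⟩, by rintro ⟨a, rfl⟩; exact hucl a⟩
      have hu' : ∀ i, o (cl i) = v ↔ ∃ a, u a = i := fun i => (horb' i).trans (hu i)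
      have hunit : A.submatrix u u * B.submatrix u u = 1 :=
        hAσ.submatrix_mul_submatrix hAB hucl (by rwa [hfix])
      obtain ⟨Q, hQ⟩ := exists_transpose_mul_mul_eq_one h2 (M := A.submatrix u u)
        (IsUnit.of_mul_eq_one _ hunit) (by
          ext a b
          rw [Matrix.transpose_apply, Matrix.submatrix_apply, Matrix.submatrix_apply,
            hc (u a) (u b), hucl, hcw, mul_one])
      obtain ⟨P, hP, P', hP', hPP', hPA⟩ := exists_orbit_congruence hu' A
        (mul_eq_one_comm.1 hQ) (fun a b h => absurd ((hucl a).trans (hucl b).symm) h)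
        (fun a b h => absurd ((hucl a).trans (hucl b).symm) h)
      refine ⟨P, hP, P', hP', hPP', _, Or.inl ⟨u, ?_, ?_⟩⟩
      · ext X
        rw [SetLike.mem_coe, mem_orbitAlgebra_iff_corner hu']
        exact ⟨fun ⟨M, _, hM⟩ => ⟨M, hM.symm⟩, fun ⟨M, hM⟩ =>
          ⟨M, fun a b h => absurd ((hucl a).trans (hucl b).symm) h, hM.symm⟩⟩
      · rw [hPA, hQ]
    · -- the form is skew-symmetric on the class `w`
      let u₀ := Function.Embedding.subtype fun i => cl i = w
      have hu₀cl : ∀ a, cl (u₀ a) = w := fun a => a.2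
      have hu₀ : ∀ i, cl i = w ↔ ∃ a, u₀ a = i := fun i =>
        ⟨fun h => ⟨⟨i, h⟩, rfl⟩, by rintro ⟨a, rfl⟩; exact hu₀cl a⟩
      have hunit : A.submatrix u₀ u₀ * B.submatrix u₀ u₀ = 1 :=
        hAσ.submatrix_mul_submatrix hAB hu₀cl (by rwa [hfix])
      obtain ⟨p, e, Q, hQ⟩ := exists_transpose_mul_mul_eq_symplectic h2 (M := A.submatrix u₀ u₀)
        (IsUnit.of_mul_eq_one _ hunit) (by
          ext a b
          rw [Matrix.transpose_apply, Matrix.neg_apply, Matrix.submatrix_apply,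
            Matrix.submatrix_apply, hc (u₀ a) (u₀ b), hu₀cl, hcw, mul_neg_one])
      let u := e.toEmbedding.trans u₀
      have hucl : ∀ a, cl (u a) = w := fun a => (e a).2
      have hu' : ∀ i, o (cl i) = v ↔ ∃ a, u a = i := fun i =>
        (horb' i).trans ⟨fun h => ⟨e.symm ⟨i, h⟩, by simp [u, u₀]⟩,
          by rintro ⟨a, rfl⟩; exact hucl a⟩
      set J : Matrix (Fin p ⊕ Fin p) (Fin p ⊕ Fin p) F := Matrix.fromBlocks 0 1 (-1) 0 with hJ
      have hJJ : (-J) * J = 1 := by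
        rw [hJ, neg_mul, Matrix.fromBlocks_multiply]
        simp [Matrix.fromBlocks_neg, Matrix.fromBlocks_one]
      have hQ' : Q * (-J * (Q.transpose * (A.submatrix u₀ u₀).submatrix e e)) = 1 :=
        mul_eq_one_comm.1 (by rw [Matrix.mul_assoc, hQ, hJJ])
      obtain ⟨P, hP, P', hP', hPP', hPA⟩ := exists_orbit_congruence hu' A
        hQ' (fun a b h => absurd ((hucl a).trans (hucl b).symm) h)
        (fun a b h => absurd ((hucl a).trans (hucl b).symm) h)
      refine ⟨P, hP, P', hP', hPP', p, Or.inr (Or.inl ⟨u, ?_, ?_⟩)⟩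
      · ext X
        rw [SetLike.mem_coe, mem_orbitAlgebra_iff_corner hu']
        exact ⟨fun ⟨M, _, hM⟩ => ⟨M, hM.symm⟩, fun ⟨M, hM⟩ =>
          ⟨M, fun a b h => absurd ((hucl a).trans (hucl b).symm) h, hM.symm⟩⟩
      · rw [hPA]
        exact congrArg (corner u) hQ
  · -- the classes `w` and `σ w` are interchanged
    have hcw : c w = 1 := hc2 w hfix
    let u₀ := Function.Embedding.subtype fun i => cl i = w
    let u₀' := Function.Embedding.subtype fun i => cl i = σ w
    have hu₀ : ∀ i, cl i = w ↔ ∃ a, u₀ a = i := fun i =>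
      ⟨fun h => ⟨⟨i, h⟩, rfl⟩, by rintro ⟨a, rfl⟩; exact a.2⟩
    have hu₀' : ∀ i, cl i = σ w ↔ ∃ a, u₀' a = i := fun i =>
      ⟨fun h => ⟨⟨i, h⟩, rfl⟩, by rintro ⟨a, rfl⟩; exact a.2⟩
    have hcard : Fintype.card {i // cl i = w} = Fintype.card {i // cl i = σ w} :=
      Matrix.square_of_invertible _ _
        (hAσ.submatrix_mul_submatrix hAB (fun a : {i // cl i = w} => a.2) hu₀' :
          A.submatrix u₀ u₀' * B.submatrix u₀' u₀ = 1)
        (hBσ.submatrix_mul_submatrix hBA (fun a : {i // cl i = σ w} => a.2) (by rwa [hσ]))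
    let p := Fintype.card {i // cl i = w}
    let f : Fin p ≃ {i // cl i = w} := (Fintype.equivFin _).symm
    let f' : Fin p ≃ {i // cl i = σ w} := (Fintype.equivFinOfCardEq hcard.symm).symm
    let u₁ := f.toEmbedding.trans u₀
    let u₂ := f'.toEmbedding.trans u₀'
    have h₁ : ∀ a, cl (u₁ a) = w := fun a => (f a).2
    have h₂ : ∀ a, cl (u₂ a) = σ w := fun a => (f' a).2
    have h₂' : ∀ i, cl i = σ w ↔ ∃ a, u₂ a = i := fun i =>
      ⟨fun h => ⟨f'.symm ⟨i, h⟩, by simp [u₂, u₀']⟩, by rintro ⟨a, rfl⟩; exact h₂ a⟩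
    have h₁' : ∀ i, cl i = w ↔ ∃ a, u₁ a = i := fun i =>
      ⟨fun h => ⟨f.symm ⟨i, h⟩, by simp [u₁, u₀]⟩, by rintro ⟨a, rfl⟩; exact h₁ a⟩
    let u : Fin p ⊕ Fin p ↪ ι := ⟨Sum.elim u₁ u₂, by
      refine u₁.injective.sumElim u₂.injective fun a b h => hfix ?_
      exact (h₂ b).symm.trans ((congrArg cl h).symm.trans (h₁ a))⟩
    have hu' : ∀ i, o (cl i) = v ↔ ∃ a, u a = i := fun i => by
      rw [horb, h₁', h₂', Sum.exists]
      rfl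
    set M : Matrix (Fin p) (Fin p) F := A.submatrix u₁ u₂ with hM
    have hMM : M * B.submatrix u₂ u₁ = 1 := hAσ.submatrix_mul_submatrix hAB h₁ h₂'
    set M' := B.submatrix u₂ u₁ with hM'
    have hAu : A.submatrix u u = Matrix.fromBlocks 0 M M.transpose 0 := by
      ext a b
      rcases a with a | a <;> rcases b with b | b
      · by_contra h
        have h3 := hAσ _ _ (show A (u₁ a) (u₁ b) ≠ 0 from h)
        rw [h₁, h₁] at h3
        exact hfix h3.symm
      · rfl
      · change A (u₂ a) (u₁ b) = A (u₁ b) (u₂ a)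
        rw [hc (u₂ a) (u₁ b), h₁, hcw, mul_one]
      · by_contra h
        have h3 := hAσ _ _ (show A (u₂ a) (u₂ b) ≠ 0 from h)
        rw [h₂, h₂, hσ] at h3
        exact hfix h3
    have hzero : ∀ (X Y : Matrix (Fin p) (Fin p) F) (a b), cl (u a) ≠ cl (u b) →
        Matrix.fromBlocks X 0 0 Y a b = 0 := by
      intro X Y a b hab
      rcases a with a | a <;> rcases b with b | b
      · exact absurd ((h₁ a).trans (h₁ b).symm) hab
      · rfl
      · rfl
      · exact absurd ((h₂ a).trans (h₂ b).symm) hab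
    have hQQ : (Matrix.fromBlocks 1 0 0 M' : Matrix (Fin p ⊕ Fin p) (Fin p ⊕ Fin p) F) *
        Matrix.fromBlocks 1 0 0 M = 1 := by
      rw [Matrix.fromBlocks_multiply, mul_eq_one_comm.1 hMM]
      simp [Matrix.fromBlocks_one]
    obtain ⟨P, hP, P', hP', hPP', hPA⟩ := exists_orbit_congruence hu' A hQQ (hzero _ _) (hzero _ _)
    refine ⟨P, hP, P', hP', hPP', p, Or.inr (Or.inr ⟨u, ?_, ?_⟩)⟩
    · ext X
      rw [SetLike.mem_coe, mem_orbitAlgebra_iff_corner hu']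
      constructor
      · rintro ⟨N, hN, rfl⟩
        refine ⟨N.toBlocks₁₁, N.toBlocks₂₂, congrArg _ ?_⟩
        conv_lhs => rw [← Matrix.fromBlocks_toBlocks N]
        congr 1
        · ext a b
          refine hN _ _ ?_
          change cl (u₁ a) ≠ cl (u₂ b)
          rw [h₁, h₂]
          exact Ne.symm hfix
        · ext a b
          refine hN _ _ ?_
          change cl (u₂ a) ≠ cl (u₁ b)
          rw [h₁, h₂]
          exact hfix
      · rintro ⟨A₁, A₂, rfl⟩
        exact ⟨_, hzero _ _, rfl⟩
    · rw [hPA, hAu, Matrix.fromBlocks_transpose, Matrix.fromBlocks_multiply,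
        Matrix.fromBlocks_multiply]
      congr 1
      simp only [Matrix.transpose_one, Matrix.transpose_zero, Matrix.mul_zero, Matrix.zero_mul,
        Matrix.one_mul, Matrix.mul_one, add_zero, zero_add, hMM]
      rw [← Matrix.transpose_mul, hMM, Matrix.transpose_one]

end NormalForm

/-! ### Decomposition of `C_e` into orbit algebras -/

section OrbitSum

variable {F : Type*} [Field F] {ι W : Type*} [Fintype ι] {cl : ι → W} {k : ℕ} {o : W → Fin k}
  {σ : W → W}

theorem orbitAlgebra_transpose_mul_mul_eq_zero {A : Matrix ι ι F} (hAσ : ClassShift cl σ A)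
    (hoσ : ∀ w, o (σ w) = o w) {v v' : Fin k} (hv : v ≠ v') {X Y : Matrix ι ι F}
    (hX : X ∈ orbitAlgebra F cl o v) (hY : Y ∈ orbitAlgebra F cl o v') :
    X.transpose * A * Y = 0 := by
  ext i j
  rw [Matrix.mul_apply]
  refine Finset.sum_eq_zero fun b _ => ?_
  rw [Matrix.mul_apply, Finset.sum_mul]
  refine Finset.sum_eq_zero fun a _ => ?_
  by_contra h
  have h1 := hX a i (left_ne_zero_of_mul (left_ne_zero_of_mul h))
  have h2 := hAσ a b (right_ne_zero_of_mul (left_ne_zero_of_mul h))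
  have h3 := hY b j (right_ne_zero_of_mul h)
  exact hv (by rw [← h1.2, ← h3.2, h2, hoσ])

theorem orbitAlgebra_mul_eq_zero {v v' : Fin k} (hv : v ≠ v') {X Y : Matrix ι ι F}
    (hX : X ∈ orbitAlgebra F cl o v) (hY : Y ∈ orbitAlgebra F cl o v') : X * Y = 0 := by
  ext i j
  rw [Matrix.mul_apply]
  refine Finset.sum_eq_zero fun b _ => ?_
  by_contra h
  have h1 := hX i b (left_ne_zero_of_mul h)
  have h2 := hY b j (right_ne_zero_of_mul h)
  exact hv (by rw [← h1.2, ← h2.2, h1.1])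

theorem classShift_of_mem_orbitAlgebra {v : Fin k} {X : Matrix ι ι F}
    (hX : X ∈ orbitAlgebra F cl o v) : ClassShift cl id X :=
  fun i j h => (hX i j h).1.symm

omit [Fintype ι] in
theorem classShift_sum {β : Type*} {s : Finset β} {X : β → Matrix ι ι F}
    (hX : ∀ b, ClassShift cl σ (X b)) : ClassShift cl σ (∑ b ∈ s, X b) := by
  intro i j hij
  rw [Matrix.sum_apply] at hij
  obtain ⟨b, -, hb⟩ := Finset.exists_ne_zero_of_sum_ne_zero hij
  exact hX b i j hb

theorem iSupIndep_orbitAlgebra : iSupIndep fun v => (orbitAlgebra F cl o v).toSubmodule := by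
  intro v
  let K : Submodule F (Matrix ι ι F) :=
    { carrier := {X | ∀ i j, o (cl i) = v → X i j = 0}
      add_mem' := fun {X Y} hX hY i j h => by rw [Matrix.add_apply, hX i j h, hY i j h, add_zero]
      zero_mem' := fun _ _ _ => rfl
      smul_mem' := fun c X hX i j h => by rw [Matrix.smul_apply, hX i j h, smul_zero] }
  have hle : (⨆ v', ⨆ (_ : v' ≠ v), (orbitAlgebra F cl o v').toSubmodule) ≤ K := by
    refine iSup₂_le fun v' hv' X hX i j h => ?_
    by_contra hne
    exact hv' (by rw [← h, (hX i j hne).2])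
  rw [Submodule.disjoint_def]
  intro X hX hX'
  ext i j
  by_contra hne
  exact hne (hle hX' i j (hX i j hne).2)

variable [DecidableEq ι]

omit [Fintype ι] in
theorem sum_orbitIdem : ∑ v, orbitIdem F cl o v = 1 := by
  ext i j
  simp only [Matrix.sum_apply, orbitIdem, Matrix.diagonal_apply, Matrix.one_apply]
  split_ifs with h
  · simp
  · simp

theorem iSup_orbitAlgebra (X : Matrix ι ι F) :
    X ∈ (⨆ v, (orbitAlgebra F cl o v).toSubmodule) ↔ ClassShift cl id X := by
  constructor
  · let K : Submodule F (Matrix ι ι F) :=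
      { carrier := {X | ∀ i j, cl i ≠ cl j → X i j = 0}
        add_mem' := fun {X Y} hX hY i j h => by
          rw [Matrix.add_apply, hX i j h, hY i j h, add_zero]
        zero_mem' := fun _ _ _ => rfl
        smul_mem' := fun c X hX i j h => by rw [Matrix.smul_apply, hX i j h, smul_zero] }
    have hle : (⨆ v, (orbitAlgebra F cl o v).toSubmodule) ≤ K := by
      refine iSup_le fun v X hX i j h => ?_
      by_contra hne
      exact h (hX i j hne).1
    intro hX i j hij
    by_contra hne
    exact hij (hle hX i j fun h => hne h.symm)
  · intro hX
    have h : X = ∑ v, orbitIdem F cl o v * X := by rw [← Finset.sum_mul, sum_orbitIdem, one_mul]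
    rw [h]
    refine sum_mem fun v _ => Submodule.mem_iSup_of_mem v ?_
    intro i j hij
    rw [orbitIdem, Matrix.diagonal_mul] at hij
    refine ⟨(hX i j (right_ne_zero_of_mul hij)).symm, ?_⟩
    by_contra hne
    rw [if_neg hne, zero_mul] at hij
    exact hij rfl

/-- The congruences on the orbits fit together to a congruence that brings the intertwiner to
normal form. -/
theorem exists_normal_form [DecidableEq W] [IsAlgClosed F] (h2 : (2 : F) ≠ 0)
    (hσ : Function.Involutive σ)
    {s : Fin k → W} (hs : ∀ v, o (s v) = v) (ho : ∀ w w', o w = o w' ↔ w' = w ∨ w' = σ w)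
    {A : Matrix ι ι F} (hA : IsUnit A) (hAσ : ClassShift cl σ A) {c : W → F}
    (hc : ∀ i j, A j i = A i j * c (cl j)) (hc1 : ∀ w, c w = 1 ∨ c w = -1)
    (hc2 : ∀ w, σ w ≠ w → c w = 1) :
    ∃ (Q Q' : Matrix ι ι F) (S : Fin k → Matrix ι ι F), ClassShift cl id Q ∧
      ClassShift cl id Q' ∧ Q * Q' = 1 ∧ (∀ v, IsNormalBlock (orbitAlgebra F cl o v) (S v)) ∧
      (∀ v i j, S v i j ≠ 0 → o (cl i) = v) ∧ Q.transpose * A * Q = ∑ v, S v := by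
  choose P hP P' hP' hPP' hnf using
    fun v => exists_orbit_normalBlock h2 hσ hs ho hA hAσ hc hc1 hc2 v
  have hoσ : ∀ w, o (σ w) = o w := fun w => ((ho w _).2 (Or.inr rfl)).symm
  refine ⟨∑ v, P v, ∑ v, P' v, fun v => (P v).transpose * A * P v,
    classShift_sum fun v => classShift_of_mem_orbitAlgebra (hP v),
    classShift_sum fun v => classShift_of_mem_orbitAlgebra (hP' v), ?_, hnf, ?_, ?_⟩
  · rw [Finset.sum_mul, ← sum_orbitIdem (F := F) (cl := cl) (o := o)]
    refine Finset.sum_congr rfl fun v _ => ?_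
    rw [Finset.mul_sum, Finset.sum_eq_single v, hPP']
    · exact fun v' _ hv' => orbitAlgebra_mul_eq_zero hv'.symm (hP v) (hP' v')
    · simp
  · intro v i j hij
    change ((P v).transpose * A * P v) i j ≠ 0 at hij
    rw [Matrix.mul_assoc, Matrix.mul_apply] at hij
    obtain ⟨a, -, ha⟩ := Finset.exists_ne_zero_of_sum_ne_zero hij
    have h := hP v a i (left_ne_zero_of_mul ha)
    rw [← h.1, h.2]
  · rw [Matrix.transpose_sum, Finset.sum_mul, Finset.sum_mul]
    refine Finset.sum_congr rfl fun v _ => ?_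
    rw [Finset.mul_sum, Finset.sum_eq_single v]
    · exact fun v' _ hv' =>
        orbitAlgebra_transpose_mul_mul_eq_zero hAσ hoσ hv'.symm (hP v) (hP v')
    · simp

end OrbitSum

section StarSimple

variable {F : Type*} [Field F] {ι κ W : Type*} [Fintype ι] [DecidableEq ι] [DecidableEq κ]
  {cl : ι → W} {k : ℕ} {o : W → Fin k} {σ : W → W}

omit [Fintype ι] [DecidableEq ι] in
theorem kronecker_one_injective [Nonempty κ] {X Y : Matrix ι ι F}
    (h : X ⊗ₖ (1 : Matrix κ κ F) = Y ⊗ₖ (1 : Matrix κ κ F)) : X = Y := by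
  obtain ⟨x⟩ := ‹Nonempty κ›
  ext i j
  have := congrFun (congrFun h (i, x)) (j, x)
  simpa [Matrix.kroneckerMap_apply] using this

/-- If an involution of the algebra of block diagonal matrices permutes the blocks by `σ`, the
blocks of an orbit of `σ` form a `*`-simple algebra: a nonzero `*`-stable ideal contains the matrix
units of one block, and hence those of its partner. -/
theorem isStarSimple_orbitAlgebra [Nonempty κ] (hcl : Function.Surjective cl)
    (hσ : Function.Involutive σ) {s : Fin k → W} (hs : ∀ v, o (s v) = v)
    (ho : ∀ w w', o w = o w' ↔ w' = w ∨ w' = σ w)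
    {ψ : Matrix (ι × κ) (ι × κ) F → Matrix (ι × κ) (ι × κ) F}
    {star : Matrix ι ι F → Matrix ι ι F}
    (hψ : ∀ X, ClassShift cl id X → ψ (X ⊗ₖ (1 : Matrix κ κ F)) = star X ⊗ₖ (1 : Matrix κ κ F))
    (hent : ∀ X i j, star X i j ≠ 0 → ∃ a b, X b a ≠ 0 ∧ cl a = σ (cl i) ∧ cl j = σ (cl b))
    (hinv : ∀ X, ClassShift cl id X → star (star X) = X) (v : Fin k) :
    IsStarSimple ψ (orbitAlgebra F cl o v) := by
  have hoσ : ∀ w, o (σ w) = o w := fun w => ((ho w _).2 (Or.inr rfl)).symm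
  have hstarmem : ∀ X ∈ orbitAlgebra F cl o v, star X ∈ orbitAlgebra F cl o v := by
    intro X hX i j hij
    obtain ⟨a, b, hab, ha, hb⟩ := hent X i j hij
    obtain ⟨h1, h2⟩ := hX b a hab
    refine ⟨?_, ?_⟩
    · rw [hb, h1, ha, hσ]
    · rw [← hoσ, ← ha, ← h1, h2]
  have hsingle : ∀ i j, cl i = cl j → o (cl i) = v → ∀ c : F,
      Matrix.single i j c ∈ orbitAlgebra F cl o v := by
    intro i j hij hv c a b hab
    rw [Matrix.single_apply] at hab
    split_ifs at hab with h
    · rw [← h.1, ← h.2]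
      exact ⟨hij, hv⟩
    · exact absurd rfl hab
  refine ⟨fun X hX => ⟨star X, hstarmem X hX, hψ X (classShift_of_mem_orbitAlgebra hX)⟩, ?_, ?_⟩
  · obtain ⟨i, hi⟩ := hcl (s v)
    have hiv : o (cl i) = v := by rw [hi, hs]
    refine ⟨_, hsingle i i rfl hiv 1, _, hsingle i i rfl hiv 1, fun h => ?_⟩
    rw [Matrix.single_mul_single_same, mul_one] at h
    have := congrFun (congrFun h i) i
    rw [Matrix.single_apply_same] at this
    exact one_ne_zero this
  · intro J hJ hideal hstable
    by_cases hbot : J = ⊥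
    · exact Or.inl hbot
    refine Or.inr (le_antisymm hJ ?_)
    obtain ⟨X, hX, hX0⟩ := (Submodule.ne_bot_iff J).1 hbot
    obtain ⟨i, j, hij⟩ : ∃ i j, X i j ≠ 0 := by
      by_contra! hcon
      exact hX0 (Matrix.ext hcon)
    obtain ⟨hclij, hiv⟩ := hJ hX i j hij
    have hblock : ∀ a b, cl a = cl i → cl b = cl i → Matrix.single a b (1 : F) ∈ J := by
      intro a b ha hb
      have h1 := (hideal _ (hsingle a i ha (by rw [ha, hiv]) 1) X hX).1
      have h2 := (hideal _ (hsingle j b (by rw [hb, hclij]) (by rw [← hclij, hiv]) 1) _ h1).2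
      have h3 : Matrix.single a i (1 : F) * X * Matrix.single j b 1 =
          X i j • Matrix.single a b (1 : F) := by
        rw [Matrix.single_mul_mul_single, one_mul, mul_one, Matrix.smul_single, smul_eq_mul,
          mul_one]
      rw [h3] at h2
      have h4 := J.smul_mem (X i j)⁻¹ h2
      rwa [smul_smul, inv_mul_cancel₀ hij, one_smul] at h4
    have hsupp : ∀ Z : Matrix ι ι F, (∀ a b, Z a b ≠ 0 → cl a = cl i ∧ cl b = cl i) → Z ∈ J := by
      intro Z hZ
      rw [Matrix.matrix_eq_sum_single Z]
      refine sum_mem fun a _ => sum_mem fun b _ => ?_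
      by_cases h : Z a b = 0
      · rw [h, Matrix.single_zero]
        exact zero_mem _
      · have h1 : Matrix.single a b (Z a b) = Z a b • Matrix.single a b (1 : F) := by
          rw [Matrix.smul_single, smul_eq_mul, mul_one]
        rw [h1]
        exact J.smul_mem _ (hblock a b (hZ a b h).1 (hZ a b h).2)
    have hpartner : ∀ a b, cl a = σ (cl i) → cl b = σ (cl i) → Matrix.single a b (1 : F) ∈ J := by
      intro a b ha hb
      have hshift : ClassShift cl id (Matrix.single a b (1 : F)) :=
        classShift_single (ha.trans hb.symm) 1
      have hmem : star (Matrix.single a b 1) ∈ J := by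
        refine hsupp _ fun x y hxy => ?_
        obtain ⟨a', b', hab', ha', hb'⟩ := hent _ x y hxy
        rw [Matrix.single_apply] at hab'
        split_ifs at hab' with h
        · rw [hb', ← h.1, ha, hσ]
          refine ⟨hσ.injective ?_, rfl⟩
          rw [← ha', ← h.2, hb]
        · exact absurd rfl hab'
      obtain ⟨Y, hY, hψY⟩ := hstable _ hmem
      have h1 : ClassShift cl id (star (Matrix.single a b (1 : F))) :=
        fun x y hxy => (hJ hmem x y hxy).1.symm
      rw [hψ _ h1, hinv _ hshift] at hψY
      rw [kronecker_one_injective hψY]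
      exact hY
    intro Z hZ
    rw [Matrix.matrix_eq_sum_single Z]
    refine sum_mem fun a _ => sum_mem fun b _ => ?_
    by_cases h : Z a b = 0
    · rw [h, Matrix.single_zero]
      exact zero_mem _
    · have h1 : Matrix.single a b (Z a b) = Z a b • Matrix.single a b (1 : F) := by
        rw [Matrix.smul_single, smul_eq_mul, mul_one]
      rw [h1]
      refine J.smul_mem _ ?_
      obtain ⟨hab, hav⟩ := hZ a b h
      rcases (ho (cl i) (cl a)).1 (by rw [hiv, hav]) with h2 | h2
      · exact hblock a b h2 (hab ▸ h2)
      · exact hpartner a b h2 (hab ▸ h2)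

end StarSimple

/-! ### Antiautomorphisms of `C ⊗ D` -/

section Antiautomorphism

variable {F : Type*} [Field F]

/-- By the theorem of Skolem and Noether, every antiautomorphism of a matrix algebra is of the form
`Z ↦ Φ⁻¹ Zᵀ Φ`. -/
theorem exists_transpose_conj {I : Type*} [Fintype I] [DecidableEq I]
    (ψ : Matrix I I F ≃ₐ[F] (Matrix I I F)ᵐᵒᵖ) :
    ∃ Φ : Matrix I I F, IsUnit Φ ∧ ∀ Z, Z.transpose * Φ = Φ * (ψ Z).unop := by
  obtain ⟨T, hT⟩ := AlgEquiv.eq_linearEquivConjAlgEquiv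
    (Matrix.toLinAlgEquiv'.symm.trans ((ψ.trans (Matrix.transposeAlgEquiv I F F).symm).trans
      Matrix.toLinAlgEquiv'))
  set M : Matrix I I F := LinearMap.toMatrixAlgEquiv' (T : (I → F) →ₗ[F] (I → F)) with hM
  have hMT : Matrix.toLinAlgEquiv' M = (T : (I → F) →ₗ[F] (I → F)) := by
    rw [hM, Matrix.toLinAlgEquiv'_toMatrixAlgEquiv']
  refine ⟨M.transpose, ?_, fun Z => ?_⟩
  · rw [Matrix.isUnit_transpose]
    have h : IsUnit (Matrix.toLinAlgEquiv' M) := by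
      rw [hMT]
      exact (LinearMap.GeneralLinearGroup.ofLinearEquiv T).isUnit
    exact (MulEquiv.isUnit_map _).1 h
  · have h := AlgEquiv.congr_fun hT (Matrix.toLinAlgEquiv' Z)
    have h1 : (ψ Z).unop.transpose * M = M * Z := by
      apply Matrix.toLinAlgEquiv'.injective
      rw [map_mul, map_mul, hMT]
      refine LinearMap.ext fun x => ?_
      have h2 := LinearMap.congr_fun h (T x)
      simpa using h2
    have h2 := congrArg Matrix.transpose h1
    rw [Matrix.transpose_mul, Matrix.transpose_mul, Matrix.transpose_transpose] at h2
    exact h2.symm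

end Antiautomorphism

section FineForm

variable {F : Type*} [Field F] {r : ℕ} {N : Fin r → ℕ} {ε : Fin r → F} [∀ l, NeZero (N l)]

theorem fineElement_ne_zero (hε : ∀ l, IsPrimitiveRoot (ε l) (N l))
    (t : ∀ l, ZMod (N l) × ZMod (N l)) : fineElement ε t ≠ 0 := by
  rw [← fineBasis_apply hε]
  exact (fineBasis hε).ne_zero t

/-- If `X ↦ q⁻¹ Xᵀ q` multiplies each basis element of the fine grading by a scalar, it preserves
the commutation relation `X_a X_b = ε X_b X_a` up to inversion of `ε`; hence `ε ^ 2 = 1`. -/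
theorem eq_two_of_transpose_mul (hN : ∀ l, 1 < N l) (hε : ∀ l, IsPrimitiveRoot (ε l) (N l))
    {q : Matrix (∀ l, Fin (N l)) (∀ l, Fin (N l)) F} (hq : IsUnit q)
    (h : ∀ t, ∃ c : F, (fineElement ε t).transpose * q = c • (q * fineElement ε t)) (l : Fin r) :
    N l = 2 := by
  have hne : ∀ t, (fineElement ε t).transpose * q ≠ 0 := by
    intro t h0
    have h1 : (fineElement ε t).transpose = 0 := hq.mul_right_cancel (by rw [h0, zero_mul])
    exact fineElement_ne_zero hε t (Matrix.transpose_eq_zero.1 h1)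
  set u : ∀ l, ZMod (N l) × ZMod (N l) := Pi.single l (1, 0) with hu
  set v : ∀ l, ZMod (N l) × ZMod (N l) := Pi.single l (0, 1) with hv
  have : Fact (1 < N l) := ⟨hN l⟩
  have huv : fineElement ε u * fineElement ε v = fineElement ε (u + v) := by
    rw [fineElement_mul hε, twist, Finset.prod_eq_one, one_smul]
    intro l' _
    have : (u l').2 = 0 := by
      by_cases hl : l' = l
      · subst hl
        simp [hu]
      · simp [hu, Pi.single_eq_of_ne hl]
    rw [this, ZMod.val_zero, zero_mul, pow_zero]
  have hvu : fineElement ε v * fineElement ε u = (ε l)⁻¹ • fineElement ε (u + v) := by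
    rw [fineElement_mul hε, add_comm v u, twist, Finset.prod_eq_single l]
    · simp [hu, hv, ZMod.val_one]
    · intro l' _ hl
      simp [hu, hv, Pi.single_eq_of_ne hl]
    · simp
  obtain ⟨cu, hcu⟩ := h u
  obtain ⟨cv, hcv⟩ := h v
  have h1 : (fineElement ε (u + v)).transpose * q =
      (cu * cv * (ε l)⁻¹) • (q * fineElement ε (u + v)) := by
    rw [← huv, Matrix.transpose_mul, mul_assoc, hcu, mul_smul_comm, ← mul_assoc, hcv,
      smul_mul_assoc, mul_assoc, hvu, mul_smul_comm, smul_smul, smul_smul, huv, mul_assoc]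
  have h2 : (ε l)⁻¹ • (fineElement ε (u + v)).transpose * q =
      (cu * cv) • (q * fineElement ε (u + v)) := by
    rw [← Matrix.transpose_smul, ← hvu, Matrix.transpose_mul, mul_assoc, hcv, mul_smul_comm,
      ← mul_assoc, hcu, smul_mul_assoc, mul_assoc, huv, smul_smul, mul_comm cv]
  have hε0 : ε l ≠ 0 := (hε l).ne_zero (NeZero.ne _)
  have h3 : (ε l ^ 2 - 1) • ((fineElement ε (u + v)).transpose * q) = 0 := by
    have h4 : (ε l)⁻¹ • ((fineElement ε (u + v)).transpose * q) =
        ε l • ((fineElement ε (u + v)).transpose * q) := by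
      rw [← smul_mul_assoc, h2, h1, smul_smul]
      congr 1
      field_simp
    have h5 := congrArg (ε l • ·) h4
    simp only [smul_smul, mul_inv_cancel₀ hε0, one_smul] at h5
    rw [sub_smul, one_smul, sq, ← h5, sub_self]
  have h4 : ε l ^ 2 = 1 := sub_eq_zero.1 ((smul_eq_zero.1 h3).resolve_right (hne _))
  exact le_antisymm (Nat.le_of_dvd two_pos ((hε l).dvd_of_pow_eq_one 2 h4)) (hN l)

/-- If all factors have size two and `X ↦ q⁻¹ Xᵀ q` multiplies each basis element by a scalar, the
scalar is a sign, since the square of a basis element is scalar. Hence the square of this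
antiautomorphism is the identity, and `q` is symmetric or skew-symmetric. -/
theorem transpose_inv_mul_eq_one_or (hN : ∀ l, N l = 2) (hε : ∀ l, IsPrimitiveRoot (ε l) (N l))
    {q : Matrix (∀ l, Fin (N l)) (∀ l, Fin (N l)) F} (hq : IsUnit q)
    (h : ∀ t, ∃ c : F, (fineElement ε t).transpose * q = c • (q * fineElement ε t)) :
    q.transpose⁻¹ * q = 1 ∨ q.transpose⁻¹ * q = -1 := by
  have : Nonempty (∀ l, Fin (N l)) := ⟨fun l => ⟨0, NeZero.pos _⟩⟩
  obtain ⟨q', hqq', hq'q⟩ := isUnit_iff_exists.1 hq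
  have hq0 : q ≠ 0 := hq.ne_zero
  have hcomm : ∀ t, fineElement ε t * (q' * q.transpose) = q' * q.transpose * fineElement ε t := by
    intro t
    obtain ⟨c, hc⟩ := h t
    have htt : t + t = 0 := by
      funext l
      have h2 : ∀ a : ZMod (N l), a + a = 0 := fun a => by
        have : ((2 : ℕ) : ZMod (N l)) = 0 := by
          conv_lhs => rw [← hN l]
          exact ZMod.natCast_self _
        rw [← two_mul, ← Nat.cast_ofNat, this, zero_mul]
      exact Prod.ext (h2 _) (h2 _)
    have hsq : fineElement ε t * fineElement ε t = twist ε t t • 1 := by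
      rw [fineElement_mul hε, htt, fineElement_zero]
    have hτ := twist_ne_zero (fun l => (hε l).ne_zero (NeZero.ne _)) t t
    have hcc : c * c = 1 := by
      have h1 : (fineElement ε t * fineElement ε t).transpose * q =
          (c * c) • (q * (fineElement ε t * fineElement ε t)) := by
        rw [Matrix.transpose_mul, mul_assoc, hc, mul_smul_comm, ← mul_assoc, hc, smul_mul_assoc,
          mul_assoc, smul_smul]
      rw [hsq, Matrix.transpose_smul, Matrix.transpose_one, smul_mul_assoc, one_mul,
        mul_smul_comm, mul_one, smul_smul] at h1
      have h2 : (c * c * twist ε t t - twist ε t t) • q = 0 := by rw [sub_smul, h1, sub_self]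
      have h3 := sub_eq_zero.1 ((smul_eq_zero.1 h2).resolve_right hq0)
      exact mul_right_cancel₀ hτ (by rw [h3, one_mul])
    have h1 := congrArg Matrix.transpose hc
    rw [Matrix.transpose_mul, Matrix.transpose_transpose, Matrix.transpose_smul,
      Matrix.transpose_mul] at h1
    have h2 : fineElement ε t = c • (q' * (fineElement ε t).transpose * q) := by
      rw [mul_assoc, hc, mul_smul_comm, ← mul_assoc, hq'q, one_mul, smul_smul, hcc, one_smul]
    calc fineElement ε t * (q' * q.transpose)
        = c • (q' * (fineElement ε t).transpose * q) * (q' * q.transpose) := by rw [← h2]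
      _ = q' * (c • ((fineElement ε t).transpose * (q * q') * q.transpose)) := by
          rw [smul_mul_assoc, mul_smul_comm]
          simp only [mul_assoc]
      _ = q' * q.transpose * fineElement ε t := by rw [hqq', mul_one, ← h1, mul_assoc]
  have hcomm' : ∀ X, X * (q' * q.transpose) = q' * q.transpose * X := by
    intro X
    have hX : X ∈ Submodule.span F (Set.range (fineElement (N := N) ε)) := by
      rw [span_fineElement hε]
      exact Submodule.mem_top
    induction hX using Submodule.span_induction with
    | mem x hx =>
      obtain ⟨t, rfl⟩ := hx
      exact hcomm t
    | zero => rw [zero_mul, mul_zero]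
    | add x y _ _ hx hy => rw [add_mul, mul_add, hx, hy]
    | smul c x _ hx => rw [smul_mul_assoc, mul_smul_comm, hx]
  obtain ⟨μ, hμ⟩ := eq_diagonal_of_commute_single (cl := fun _ : ∀ l, Fin (N l) => ())
    (Function.surjective_to_subsingleton _) fun i j _ => hcomm' (Matrix.single i j 1)
  have hqt : q.transpose = μ () • q := by
    have h1 : q' * q.transpose = μ () • (1 : Matrix (∀ l, Fin (N l)) (∀ l, Fin (N l)) F) := by
      rw [hμ, Matrix.smul_one_eq_diagonal]
    calc q.transpose = q * (q' * q.transpose) := by rw [← mul_assoc, hqq', one_mul]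
      _ = μ () • q := by rw [h1, mul_smul_comm, mul_one]
  have hμμ : μ () * μ () = 1 := by
    have h1 := congrArg Matrix.transpose hqt
    rw [Matrix.transpose_transpose, Matrix.transpose_smul, hqt, smul_smul] at h1
    have h2 : (μ () * μ () - 1) • q = 0 := by rw [sub_smul, one_smul, ← h1, sub_self]
    exact sub_eq_zero.1 ((smul_eq_zero.1 h2).resolve_right hq0)
  have hdet : IsUnit q.transpose.det := by
    rw [Matrix.det_transpose]
    exact (Matrix.isUnit_iff_isUnit_det q).1 hq
  rcases mul_self_eq_one_iff.1 hμμ with h1 | h1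
  · left
    rw [h1, one_smul] at hqt
    rw [hqt] at hdet ⊢
    exact Matrix.nonsing_inv_mul _ hdet
  · right
    rw [h1, neg_smul, one_smul] at hqt
    calc q.transpose⁻¹ * q = q.transpose⁻¹ * -q.transpose := by rw [hqt, neg_neg]
      _ = -1 := by rw [mul_neg, Matrix.nonsing_inv_mul _ hdet]

end FineForm

section ClassComponents

variable {F : Type*} [Field F] {G : Type*} [AddCommGroup G] {ι W : Type*} {g : ι → G}
  {cl : ι → W} {γ : W → G}

/-- The identity component of an elementary grading consists of the matrices that are block diagonal
for the partition of the indices by their degrees. -/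
theorem mem_elementaryComponent_zero_iff (hγ : Function.Injective γ) (hcl : ∀ i, γ (cl i) = g i)
    {X : Matrix ι ι F} : X ∈ elementaryComponent F g 0 ↔ ClassShift cl id X := by
  have h : ∀ i j, -g i + g j = 0 ↔ cl j = cl i := fun i j => by
    rw [neg_add_eq_zero, ← hcl, ← hcl, hγ.eq_iff]
    exact eq_comm
  constructor
  · intro hX i j hij
    by_contra hne
    exact hij (hX i j fun h' => hne ((h i j).1 h'))
  · intro hX i j hij
    by_contra hne
    exact hij ((h i j).2 (hX i j hne))

variable {r : ℕ} {N : Fin r → ℕ} {ε : Fin r → F} {deg : (∀ l, ZMod (N l) × ZMod (N l)) →+ G}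
  [Fintype ι] [DecidableEq ι]

/-- Since the supports of `C` and `D` meet in the neutral element only, the identity component of
`C ⊗ D` is `C_e ⊗ I`. -/
theorem exists_of_mem_tensorComponent_zero [∀ l, NeZero (N l)] (hdeg : Function.Injective deg)
    (hsupp : ∀ h, elementaryComponent F g h ≠ ⊥ → h ∈ Set.range deg → h = 0)
    {M : Matrix (ι × ∀ l, Fin (N l)) (ι × ∀ l, Fin (N l)) F}
    (hM : M ∈ tensorComponent (elementaryComponent F g) (fineComponent ε deg) 0) :
    ∃ A ∈ elementaryComponent F g 0, M = A ⊗ₖ 1 := by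
  rw [mem_tensorComponent_iff] at hM
  have hzero : ∀ i j, -g i + g j ≠ 0 → blk M i j = 0 := by
    intro i j hij
    refine eq_zero_of_mem_fineComponent (fun hr => ?_) (hM i j)
    have h1 : -g j + g i ∈ Set.range deg := by
      have : -g j + g i = 0 + g i - g j := by abel
      rwa [this]
    have h2 := hsupp _ (fun hbot => ?_) h1
    · rw [neg_add_eq_zero] at h2
      exact hij (by rw [h2, neg_add_cancel])
    · have h3 := single_mem_elementaryComponent (F := F) g j i 1
      rw [hbot, Submodule.mem_bot] at h3
      have h4 := congrFun (congrFun h3 j) i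
      rw [Matrix.single_apply_same] at h4
      exact one_ne_zero h4
  have hscalar : ∀ i j, ∃ c : F, (-g i + g j ≠ 0 → c = 0) ∧ blk M i j = c • 1 := by
    intro i j
    by_cases hij : -g i + g j = 0
    · have h1 := hM i j
      have h2 : 0 + g i - g j = deg 0 := by
        rw [neg_add_eq_zero] at hij
        rw [hij, map_zero, zero_add, sub_self]
      rw [h2] at h1
      obtain ⟨c, hc⟩ := exists_eq_smul_of_mem_fineComponent hdeg h1
      rw [fineElement_zero] at hc
      exact ⟨c, fun h => absurd hij h, hc⟩
    · exact ⟨0, fun _ => rfl, by rw [hzero i j hij, zero_smul]⟩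
  choose A hA hMA using hscalar
  exact ⟨Matrix.of A, hA, ext_blk fun i j => by rw [hMA, blk_kronecker]; rfl⟩

omit [DecidableEq ι] in
theorem blk_kronecker_one_mul {κ : Type*} [Fintype κ] [DecidableEq κ] (A : Matrix ι ι F)
    (M : Matrix (ι × κ) (ι × κ) F) (i j : ι) :
    blk (A ⊗ₖ (1 : Matrix κ κ F) * M) i j = ∑ k, A i k • blk M k j := by
  rw [blk_mul]
  exact Finset.sum_congr rfl fun k _ => by rw [blk_kronecker, smul_mul_assoc, one_mul]

omit [DecidableEq ι] in
theorem blk_mul_kronecker_one {κ : Type*} [Fintype κ] [DecidableEq κ] (A : Matrix ι ι F)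
    (M : Matrix (ι × κ) (ι × κ) F) (i j : ι) :
    blk (M * A ⊗ₖ (1 : Matrix κ κ F)) i j = ∑ k, A k j • blk M i k := by
  rw [blk_mul]
  exact Finset.sum_congr rfl fun k _ => by rw [blk_kronecker, mul_smul_comm, mul_one]

omit [Fintype ι] [DecidableEq ι] in
theorem kronecker_one_mem_tensorComponent_zero [∀ l, NeZero (N l)] {A : Matrix ι ι F}
    (hA : A ∈ elementaryComponent F g 0) :
    A ⊗ₖ 1 ∈ tensorComponent (elementaryComponent F g) (fineComponent ε deg) 0 := by
  refine Submodule.subset_span ⟨0, deg 0, by rw [map_zero, add_zero], A, hA, 1, ?_, rfl⟩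
  rw [← fineElement_zero (ε := ε)]
  exact fineElement_mem 0

theorem kronecker_one_mul_mem_tensorComponent {A : Matrix ι ι F}
    (hA : A ∈ elementaryComponent F g 0) {h : G}
    {M : Matrix (ι × ∀ l, Fin (N l)) (ι × ∀ l, Fin (N l)) F}
    (hM : M ∈ tensorComponent (elementaryComponent F g) (fineComponent ε deg) h) :
    A ⊗ₖ 1 * M ∈ tensorComponent (elementaryComponent F g) (fineComponent ε deg) h := by
  rw [mem_tensorComponent_iff] at hM ⊢
  intro i j
  rw [blk_kronecker_one_mul]
  refine sum_mem fun k _ => ?_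
  by_cases h0 : -g i + g k = 0
  · rw [neg_add_eq_zero.1 h0]
    exact Submodule.smul_mem _ _ (hM k j)
  · rw [hA i k h0, zero_smul]
    exact zero_mem _

theorem mul_kronecker_one_mem_tensorComponent {A : Matrix ι ι F}
    (hA : A ∈ elementaryComponent F g 0) {h : G}
    {M : Matrix (ι × ∀ l, Fin (N l)) (ι × ∀ l, Fin (N l)) F}
    (hM : M ∈ tensorComponent (elementaryComponent F g) (fineComponent ε deg) h) :
    M * A ⊗ₖ 1 ∈ tensorComponent (elementaryComponent F g) (fineComponent ε deg) h := by
  rw [mem_tensorComponent_iff] at hM ⊢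
  intro i j
  rw [blk_mul_kronecker_one]
  refine sum_mem fun k _ => ?_
  by_cases h0 : -g k + g j = 0
  · rw [← neg_add_eq_zero.1 h0]
    exact Submodule.smul_mem _ _ (hM i k)
  · rw [hA k j h0, zero_smul]
    exact zero_mem _

end ClassComponents

section BlockScalars

variable {F : Type*} [Field F] {ι κ W : Type*} [Fintype ι] [DecidableEq ι] [Fintype κ]
  [DecidableEq κ] {cl : ι → W} {σ : W → W} {S : Matrix ι ι F} {Φ : Matrix (ι × κ) (ι × κ) F}

/-- Two antiautomorphisms that agree on `C_e ⊗ I` differ by a conjugation by an element of the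
centralizer of `C_e ⊗ I`. Hence, up to the factor `S ⊗ I`, the matrix `Φ` is block diagonal, and the
blocks depend on the class only. -/
theorem exists_block_scalars [DecidableEq W] (hcl : Function.Surjective cl)
    (hσ : Function.Involutive σ) (hS : IsUnit S) (hSσ : ClassShift cl σ S)
    (hΦ : ∀ X, ClassShift cl id X → (X.transpose ⊗ₖ (1 : Matrix κ κ F)) * Φ =
      Φ * ((S⁻¹ * X.transpose * S) ⊗ₖ (1 : Matrix κ κ F))) :
    ∃ q : W → Matrix κ κ F, ∀ i j, blk Φ i j = S i j • q (cl j) := by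
  have hdet : IsUnit S.det := (Matrix.isUnit_iff_isUnit_det S).1 hS
  have hSS : S * S⁻¹ = 1 := Matrix.mul_nonsing_inv _ hdet
  have hSS' : S⁻¹ * S = 1 := Matrix.nonsing_inv_mul _ hdet
  have hSiσ : ClassShift cl σ S⁻¹ := hSσ.inverse hσ hSS
  have hcomm : ∀ X, ClassShift cl id X →
      X ⊗ₖ (1 : Matrix κ κ F) * (S⁻¹ ⊗ₖ (1 : Matrix κ κ F) * Φ) =
        S⁻¹ ⊗ₖ (1 : Matrix κ κ F) * Φ * X ⊗ₖ (1 : Matrix κ κ F) := by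
    intro X hX
    have h1 : ClassShift cl id (S * X * S⁻¹) := by
      have := (hSσ.mul hX).mul hSiσ
      rwa [Function.id_comp, hσ.comp_self] at this
    have h2 := hΦ _ h1.transpose_id
    rw [Matrix.transpose_transpose] at h2
    have h3 : S⁻¹ * (S * X * S⁻¹) * S = X := by
      rw [mul_assoc S, ← mul_assoc S⁻¹, hSS', one_mul, mul_assoc, hSS', mul_one]
    rw [h3] at h2
    rw [mul_assoc, ← h2, ← mul_assoc, ← mul_assoc, ← Matrix.mul_kronecker_mul,
      ← Matrix.mul_kronecker_mul, mul_one, ← mul_assoc, ← mul_assoc, hSS', one_mul]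
  set Z := S⁻¹ ⊗ₖ (1 : Matrix κ κ F) * Φ with hZ
  obtain ⟨q, hq⟩ := eq_diagonal_of_commute_single (A := Matrix κ κ F)
    (z := Matrix.of fun i j => blk Z i j) hcl fun i j hij => by
      have hs : ∀ a b, Matrix.single i j (1 : Matrix κ κ F) a b =
          blk (Matrix.single i j (1 : F) ⊗ₖ (1 : Matrix κ κ F)) a b := by
        intro a b
        rw [blk_kronecker, Matrix.single_apply, Matrix.single_apply]
        split_ifs
        · rw [one_smul]
        · rw [zero_smul]
      ext1 a b
      simp only [Matrix.mul_apply, hs, Matrix.of_apply]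
      rw [← blk_mul, ← blk_mul, hcomm _ (classShift_single hij 1)]
  refine ⟨q, fun i j => ?_⟩
  have h1 : Φ = S ⊗ₖ (1 : Matrix κ κ F) * Z := by
    rw [hZ, ← mul_assoc, ← Matrix.mul_kronecker_mul, hSS, mul_one, Matrix.one_kronecker_one,
      one_mul]
  have h2 : ∀ k, blk Z k j = if k = j then q (cl k) else 0 := fun k => by
    have := congrFun (congrFun hq k) j
    rwa [Matrix.diagonal_apply] at this
  rw [h1, blk_kronecker_one_mul, Finset.sum_eq_single j]
  · rw [h2, if_pos rfl]
  · intro k _ hk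
    rw [h2, if_neg hk, smul_zero]
  · simp

omit [DecidableEq ι] [DecidableEq κ] in
theorem blk_mul_of_classShift (hSσ : ClassShift cl σ S) {q : W → Matrix κ κ F}
    (hq : ∀ i j, blk Φ i j = S i j • q (cl j)) (M : Matrix (ι × κ) (ι × κ) F) (i j : ι) :
    blk (Φ * M) i j = q (σ (cl i)) * ∑ k, S i k • blk M k j := by
  rw [blk_mul, Finset.mul_sum]
  refine Finset.sum_congr rfl fun k _ => ?_
  rw [hq]
  by_cases h : S i k = 0
  · rw [h, zero_smul, zero_smul, zero_mul, mul_zero]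
  · rw [hSσ i k h, smul_mul_assoc, mul_smul_comm]

theorem isUnit_block_scalar (hcl : Function.Surjective cl) (hσ : Function.Involutive σ)
    (hΦ : IsUnit Φ) (hSσ : ClassShift cl σ S) {q : W → Matrix κ κ F}
    (hq : ∀ i j, blk Φ i j = S i j • q (cl j)) (w : W) : IsUnit (q w) := by
  obtain ⟨Ψ, hΨ, -⟩ := isUnit_iff_exists.1 hΦ
  obtain ⟨i, hi⟩ := hcl (σ w)
  have h := blk_mul_of_classShift hSσ hq Ψ i i
  rw [hΨ, blk_one, if_pos rfl, hi, hσ] at h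
  exact IsUnit.of_mul_eq_one _ h.symm

end BlockScalars

section BlockDegrees

variable {F : Type*} [Field F] {G : Type*} [AddCommGroup G] {ι W : Type*} [Fintype ι]
  [DecidableEq ι] {g : ι → G} {cl : ι → W} {γ : W → G} {σ : W → W} {r : ℕ} {N : Fin r → ℕ}
  {ε : Fin r → F} {deg : (∀ l, ZMod (N l) × ZMod (N l)) →+ G} {S : Matrix ι ι F}
  {Φ : Matrix (ι × ∀ l, Fin (N l)) (ι × ∀ l, Fin (N l)) F}
  {ψ : Matrix (ι × ∀ l, Fin (N l)) (ι × ∀ l, Fin (N l)) F →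
    Matrix (ι × ∀ l, Fin (N l)) (ι × ∀ l, Fin (N l)) F}

/-- Comparison of degrees in `Zᵀ Φ = Φ ψ(Z)` for the homogeneous element `Z = E_ij ⊗ X`, where `X`
is a basis element of `D`. -/
theorem exists_transpose_mul_block_scalar (hcl : ∀ i, γ (cl i) = g i) (hS : IsUnit S)
    (hSσ : ClassShift cl σ S) (hψ : ∀ Z, Z.transpose * Φ = Φ * ψ Z)
    (hgr : ∀ h, ∀ Z ∈ tensorComponent (elementaryComponent F g) (fineComponent ε deg) h,
      ψ Z ∈ tensorComponent (elementaryComponent F g) (fineComponent ε deg) h)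
    {q : W → Matrix (∀ l, Fin (N l)) (∀ l, Fin (N l)) F}
    (hq : ∀ i j, blk Φ i j = S i j • q (cl j)) (i j : ι) (t : ∀ l, ZMod (N l) × ZMod (N l)) :
    ∃ y ∈ fineComponent ε deg (-g i + g j + deg t + γ (σ (cl j)) - γ (σ (cl i))),
      (fineElement ε t).transpose * q (σ (cl i)) = q (σ (cl j)) * y := by
  obtain ⟨l, hl⟩ : ∃ l, S i l ≠ 0 := by
    by_contra! hcon
    exact ((Matrix.isUnit_iff_isUnit_det S).1 hS).ne_zero (Matrix.det_eq_zero_of_row_eq_zero i hcon)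
  set Z := Matrix.single i j (1 : F) ⊗ₖ fineElement ε t with hZ
  have hZmem : Z ∈ tensorComponent (elementaryComponent F g) (fineComponent ε deg)
      (-g i + g j + deg t) :=
    Submodule.subset_span ⟨_, _, rfl, _, single_mem_elementaryComponent g i j 1, _,
      fineElement_mem t, rfl⟩
  have hψZ := mem_tensorComponent_iff.1 (hgr _ _ hZmem)
  have h1 : blk (Z.transpose * Φ) j l = S i l • ((fineElement ε t).transpose * q (σ (cl i))) := by
    rw [hZ, ← Matrix.kroneckerMap_transpose, blk_mul, Finset.sum_eq_single i]
    · rw [blk_kronecker, Matrix.transpose_apply, Matrix.single_apply_same, one_smul, hq,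
        hSσ i l hl, mul_smul_comm]
    · intro k _ hk
      rw [blk_kronecker, Matrix.transpose_apply, Matrix.single_apply_of_row_ne hk.symm, zero_smul,
        zero_mul]
    · simp
  rw [hψ, blk_mul_of_classShift hSσ hq] at h1
  refine ⟨(S i l)⁻¹ • ∑ k, S j k • blk (ψ Z) k l, ?_, ?_⟩
  · refine Submodule.smul_mem _ _ (sum_mem fun k _ => ?_)
    by_cases hk : S j k = 0
    · rw [hk, zero_smul]
      exact zero_mem _
    · rw [← hSσ j k hk, ← hSσ i l hl, hcl, hcl]
      exact Submodule.smul_mem _ _ (hψZ k l)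
  · rw [mul_smul_comm, h1, smul_smul, inv_mul_cancel₀ hl, one_smul]

end BlockDegrees

/-! ### Normal form of a graded antiautomorphism -/

section NormalForm

variable {F : Type*} [Field F] [IsAlgClosed F] {ι κ W : Type*} [Fintype ι] [DecidableEq ι]
  [Fintype κ] [DecidableEq κ] [Nonempty κ] [Finite W] [DecidableEq W] {cl : ι → W}

/-- The normal form of the restriction of the antiautomorphism `ψ` to `C_e ⊗ I`, after a conjugation
by the matrix `Q'`, whose inverse is `Q`. -/
theorem exists_normal_form_of_involution (h2 : (2 : F) ≠ 0) (hcl : Function.Surjective cl)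
    {Φ : Matrix (ι × κ) (ι × κ) F} (hΦ : IsUnit Φ)
    {star : Matrix ι ι F → Matrix ι ι F}
    (hint : ∀ X, ClassShift cl id X → (X.transpose ⊗ₖ (1 : Matrix κ κ F)) * Φ =
      Φ * (star X ⊗ₖ (1 : Matrix κ κ F)))
    (hstar : ∀ X, ClassShift cl id X → ClassShift cl id (star X))
    (hinv : ∀ X, ClassShift cl id X → star (star X) = X) :
    ∃ (σ : W → W) (k : ℕ) (o : W → Fin k) (s : Fin k → W) (Q Q' : Matrix ι ι F)
      (S : Fin k → Matrix ι ι F), Function.Involutive σ ∧ (∀ v, o (s v) = v) ∧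
      (∀ w w', o w = o w' ↔ w' = w ∨ w' = σ w) ∧ ClassShift cl id Q ∧ ClassShift cl id Q' ∧
      Q * Q' = 1 ∧ (∀ v, IsNormalBlock (orbitAlgebra F cl o v) (S v)) ∧
      (∀ v i j, S v i j ≠ 0 → o (cl i) = v) ∧ IsUnit (∑ v, S v) ∧ ClassShift cl σ (∑ v, S v) ∧
      ∀ X, ClassShift cl id X →
        Q' * star (Q * X * Q') * Q = (∑ v, S v)⁻¹ * X.transpose * ∑ v, S v := by
  obtain ⟨A₀, hA₀, hint₀⟩ := exists_intertwiner hcl hΦ hint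
  obtain ⟨σ, hσ, hA₀σ⟩ := exists_class_involution hcl hA₀ hint₀ hstar hinv
  obtain ⟨c₀, hc₀⟩ := exists_symmetry_scalars hcl hA₀ hint₀ hstar hinv
  obtain ⟨k, o, s, hs, ho⟩ := exists_orbit_representatives hσ
  obtain ⟨A, c, hA, hintA, hAσ, hc, hc1, hc2⟩ :=
    exists_normalized_intertwiner hcl hA₀ hint₀ hσ hA₀σ hc₀ hs ho hstar
  obtain ⟨Q, Q', S, hQ, hQ', hQQ', hnf, hSo, hsum⟩ :=
    exists_normal_form h2 hσ hs ho hA hAσ hc hc1 hc2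
  have hQ'Q : Q' * Q = 1 := mul_eq_one_comm.1 hQQ'
  have hQu : IsUnit Q := IsUnit.of_mul_eq_one _ hQQ'
  have hSu : IsUnit (∑ v, S v) := by
    rw [← hsum]
    exact (((Matrix.isUnit_transpose Q).2 hQu).mul hA).mul hQu
  refine ⟨σ, k, o, s, Q, Q', S, hσ, hs, ho, hQ, hQ', hQQ', hnf, hSo, hSu, ?_, fun X hX => ?_⟩
  · rw [← hsum]
    exact (hQ.transpose_id.mul hAσ).mul hQ
  · have h1 : ClassShift cl id (Q * X * Q') := (hQ.mul hX).mul hQ'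
    have h2 : (∑ v, S v) * (Q' * star (Q * X * Q') * Q) = X.transpose * ∑ v, S v := by
      calc (∑ v, S v) * (Q' * star (Q * X * Q') * Q)
          = Q.transpose * A * (Q * Q') * star (Q * X * Q') * Q := by
            rw [← hsum]
            simp only [mul_assoc]
        _ = Q.transpose * ((Q * X * Q').transpose * A) * Q := by
            rw [hQQ', mul_one, hintA _ h1]
            simp only [mul_assoc]
        _ = (Q' * Q).transpose * X.transpose * (Q.transpose * A * Q) := by
            simp only [Matrix.transpose_mul, mul_assoc]
        _ = X.transpose * ∑ v, S v := by rw [hQ'Q, Matrix.transpose_one, one_mul, hsum]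
    rw [mul_assoc (∑ v, S v)⁻¹, ← h2, ← mul_assoc (∑ v, S v)⁻¹, Matrix.nonsing_inv_mul _
      ((Matrix.isUnit_iff_isUnit_det _).1 hSu), one_mul]

end NormalForm

section GradedForm

variable {F : Type*} [Field F] {G : Type*} [AddCommGroup G] {ι W : Type*} [Fintype ι]
  [DecidableEq ι] [DecidableEq W] {g : ι → G} {cl : ι → W} {γ : W → G} {σ : W → W} {r : ℕ}
  {N : Fin r → ℕ} {ε : Fin r → F} {deg : (∀ l, ZMod (N l) × ZMod (N l)) →+ G}
  {Φ : Matrix (ι × ∀ l, Fin (N l)) (ι × ∀ l, Fin (N l)) F}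
  {ψ : Matrix (ι × ∀ l, Fin (N l)) (ι × ∀ l, Fin (N l)) F →
    Matrix (ι × ∀ l, Fin (N l)) (ι × ∀ l, Fin (N l)) F}
  {k : ℕ} {o : W → Fin k} {s : Fin k → W} {S : Fin k → Matrix ι ι F}

/-- If the restriction of a graded antiautomorphism `Z ↦ Φ⁻¹ Zᵀ Φ` to `C_e ⊗ I` is in normal form,
then `Φ` is a sum of tensor products, one for each orbit of `σ` on the classes. -/
theorem exists_sum_kronecker [∀ l, NeZero (N l)] (hclγ : ∀ i, γ (cl i) = g i)
    (hcl : Function.Surjective cl) (hW : Nonempty W) (hN : ∀ l, 1 < N l)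
    (hε : ∀ l, IsPrimitiveRoot (ε l) (N l)) (hdeg : Function.Injective deg)
    (hσ : Function.Involutive σ) (hs : ∀ v, o (s v) = v)
    (ho : ∀ w w', o w = o w' ↔ w' = w ∨ w' = σ w)
    (hSo : ∀ v i j, S v i j ≠ 0 → o (cl i) = v) (hS : IsUnit (∑ v, S v))
    (hSσ : ClassShift cl σ (∑ v, S v)) (hΦ : IsUnit Φ) (hψ : ∀ Z, Z.transpose * Φ = Φ * ψ Z)
    (hψS : ∀ X, ClassShift cl id X →
      ψ (X ⊗ₖ 1) = ((∑ v, S v)⁻¹ * X.transpose * ∑ v, S v) ⊗ₖ 1)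
    (hgr : ∀ h, ∀ Z ∈ tensorComponent (elementaryComponent F g) (fineComponent ε deg) h,
      ψ Z ∈ tensorComponent (elementaryComponent F g) (fineComponent ε deg) h) :
    (∀ l, N l = 2) ∧
    ∃ (Y : Fin k → Matrix ι ι F) (Q : Fin k → Matrix (∀ l, Fin (N l)) (∀ l, Fin (N l)) F),
      (∀ v, Y v ∈ orbitAlgebra F cl o v ∧ ∀ b ∈ orbitAlgebra F cl o v, Y v * b = b * Y v) ∧
      (∀ v, IsUnit (Q v) ∧
        ((Q v).transpose⁻¹ * Q v = 1 ∨ (Q v).transpose⁻¹ * Q v = -1)) ∧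
      Φ = ∑ v, (S v * Y v) ⊗ₖ Q v := by
  obtain ⟨q, hq⟩ := exists_block_scalars (Φ := Φ) hcl hσ hS hSσ fun X hX => by
    rw [← hψS X hX, ← hψ, ← Matrix.kroneckerMap_transpose, Matrix.transpose_one]
  have hqu := isUnit_block_scalar hcl hσ hΦ hSσ hq
  have hqt : ∀ w t, ∃ c : F, (fineElement ε t).transpose * q w = c • (q w * fineElement ε t) := by
    intro w t
    obtain ⟨i, hi⟩ := hcl (σ w)
    obtain ⟨y, hy, h⟩ := exists_transpose_mul_block_scalar hclγ hS hSσ hψ hgr hq i i t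
    rw [neg_add_cancel, zero_add, add_sub_cancel_right] at hy
    obtain ⟨c, rfl⟩ := exists_eq_smul_of_mem_fineComponent hdeg hy
    rw [hi, hσ, mul_smul_comm] at h
    exact ⟨c, h⟩
  have hqσ : ∀ w, ∃ c : F, q (σ w) = c • q w := by
    intro w
    obtain ⟨i, hi⟩ := hcl w
    obtain ⟨j, hj⟩ := hcl (σ w)
    obtain ⟨y, hy, h⟩ := exists_transpose_mul_block_scalar hclγ hS hSσ hψ hgr hq i j 0
    rw [← hclγ, ← hclγ, hi, hj, hσ, map_zero, add_zero, neg_add_eq_sub, sub_add_cancel, sub_self,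
      ← map_zero deg] at hy
    obtain ⟨c, rfl⟩ := exists_eq_smul_of_mem_fineComponent hdeg hy
    rw [fineElement_zero, Matrix.transpose_one, one_mul, hi, hj, hσ, mul_smul_comm, mul_one] at h
    exact ⟨c, h⟩
  have hN2 : ∀ l, N l = 2 := by
    obtain ⟨w⟩ := hW
    exact eq_two_of_transpose_mul hN hε (hqu w) (hqt w)
  have hμ : ∀ w, ∃ c : F, q w = c • q (s (o w)) := by
    intro w
    rcases (ho w _).1 (hs (o w)).symm with h | h
    · exact ⟨1, by rw [h, one_smul]⟩
    · obtain ⟨c, hc⟩ := hqσ (σ w)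
      exact ⟨c, by rw [h, ← hc, hσ]⟩
  choose μ hμ using hμ
  have hoσ : ∀ w, o (σ w) = o w := fun w => ((ho w _).2 (Or.inr rfl)).symm
  refine ⟨hN2, fun v => Matrix.diagonal fun i => if o (cl i) = v then μ (cl i) else 0,
    fun v => q (s v), fun v => ⟨?_, fun b hb => ?_⟩,
    fun v => ⟨hqu _, transpose_inv_mul_eq_one_or hN2 hε (hqu _) (hqt _)⟩, ?_⟩
  · intro i j hij
    by_cases h : i = j
    · subst h
      beta_reduce at hij
      rw [Matrix.diagonal_apply_eq] at hij
      refine ⟨rfl, ?_⟩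
      by_contra hne
      exact hij (if_neg hne)
    · exact absurd (Matrix.diagonal_apply_ne _ h) hij
  · ext i j
    beta_reduce
    rw [Matrix.diagonal_mul, Matrix.mul_diagonal]
    by_cases h : b i j = 0
    · rw [h, mul_zero, zero_mul]
    · rw [(hb i j h).1, mul_comm]
  · refine ext_blk fun i j => ?_
    have hsum : ∀ v, v ≠ o (cl i) → S v i j = 0 := fun v hv => by
      by_contra hne
      exact hv (hSo v i j hne).symm
    have hSij : (∑ v, S v) i j = S (o (cl i)) i j := by
      rw [Matrix.sum_apply, Finset.sum_eq_single _ (fun v _ hv => hsum v hv) (by simp)]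
    rw [hq, blk_sum, hSij, Finset.sum_eq_single (o (cl i))]
    · rw [blk_kronecker, Matrix.mul_diagonal]
      by_cases h : S (o (cl i)) i j = 0
      · rw [h, zero_smul, zero_mul, zero_smul]
      · have h1 : o (cl j) = o (cl i) := by
          rw [hSσ i j (by rwa [hSij]), hoσ]
        rw [if_pos h1, ← smul_smul, ← h1, ← hμ]
    · intro v _ hv
      rw [blk_kronecker, Matrix.mul_diagonal, hsum v hv, zero_mul, zero_smul]
    · simp

end GradedForm

section Conjugation

variable {F : Type*} [Field F] {ι κ W : Type*} [Fintype ι] [DecidableEq ι] [Fintype κ]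
  [DecidableEq κ]

/-- A conjugation by `Q' ⊗ I`, where `Q' = Q⁻¹`, replaces the matrix `Φ` of the antiautomorphism `ψ`
by a congruent one. -/
theorem transpose_mul_conj {Φ : Matrix (ι × κ) (ι × κ) F}
    {ψ : Matrix (ι × κ) (ι × κ) F → Matrix (ι × κ) (ι × κ) F}
    (hψ : ∀ Z, Z.transpose * Φ = Φ * ψ Z) {Q Q' : Matrix ι ι F} (hQ : Q * Q' = 1)
    (Z : Matrix (ι × κ) (ι × κ) F) :
    Z.transpose * (Q.transpose ⊗ₖ 1 * Φ * Q ⊗ₖ 1) = Q.transpose ⊗ₖ 1 * Φ * Q ⊗ₖ 1 *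
      (Q' ⊗ₖ 1 * ψ (Q ⊗ₖ 1 * Z * Q' ⊗ₖ 1) * Q ⊗ₖ (1 : Matrix κ κ F)) := by
  have h1 : Q ⊗ₖ (1 : Matrix κ κ F) * Q' ⊗ₖ 1 = 1 := by
    rw [← Matrix.mul_kronecker_mul, hQ, mul_one, Matrix.one_kronecker_one]
  have h2 : Q.transpose ⊗ₖ (1 : Matrix κ κ F) * Q'.transpose ⊗ₖ 1 = 1 := by
    rw [← Matrix.mul_kronecker_mul, ← Matrix.transpose_mul, mul_eq_one_comm.1 hQ, mul_one,
      Matrix.transpose_one, Matrix.one_kronecker_one]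
  have ht : ∀ A : Matrix ι ι F, (A ⊗ₖ (1 : Matrix κ κ F)).transpose = A.transpose ⊗ₖ 1 :=
    fun A => by rw [← Matrix.kroneckerMap_transpose, Matrix.transpose_one]
  calc Z.transpose * (Q.transpose ⊗ₖ 1 * Φ * Q ⊗ₖ 1)
      = Q.transpose ⊗ₖ (1 : Matrix κ κ F) * Q'.transpose ⊗ₖ 1 * Z.transpose *
          Q.transpose ⊗ₖ 1 * Φ * Q ⊗ₖ 1 := by rw [h2, one_mul]; simp only [mul_assoc]
    _ = Q.transpose ⊗ₖ 1 * ((Q ⊗ₖ 1 * Z * Q' ⊗ₖ 1).transpose * Φ) *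
          Q ⊗ₖ (1 : Matrix κ κ F) := by
        rw [Matrix.transpose_mul, Matrix.transpose_mul, ht, ht]
        simp only [mul_assoc]
    _ = Q.transpose ⊗ₖ 1 * Φ * (Q ⊗ₖ 1 * Q' ⊗ₖ 1) * ψ (Q ⊗ₖ 1 * Z * Q' ⊗ₖ 1) *
          Q ⊗ₖ (1 : Matrix κ κ F) := by
        rw [hψ, h1, mul_one]
        simp only [mul_assoc]
    _ = _ := by simp only [mul_assoc]

end Conjugation

/-! ### Transport to `C ⊗ D` -/

section Conclusion

variable {F : Type*} [Field F] {G : Type*} [AddCommGroup G] {n : ℕ}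
  {𝒜 : G → Submodule F (Matrix (Fin n) (Fin n) F)}

namespace TensorDecomposition

theorem mem_tensorComponent_iff_symm_mem (𝒟 : TensorDecomposition 𝒜) {h : G} {Z : 𝒟.CD} :
    Z ∈ tensorComponent (elementaryComponent F 𝒟.tuple) (fineComponent 𝒟.ε 𝒟.deg) h ↔
      𝒟.equiv.symm Z ∈ 𝒜 h := by
  rw [← 𝒟.map_component]
  constructor
  · rintro ⟨X, hX, rfl⟩
    simpa using hX
  · intro hZ
    exact ⟨_, hZ, by simp⟩

theorem pos (𝒟 : TensorDecomposition 𝒜) (hn : 0 < n) : 0 < 𝒟.m := by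
  have : NeZero n := ⟨hn.ne'⟩
  by_contra h
  have : IsEmpty (Fin 𝒟.m) := by
    rw [Nat.eq_zero_of_not_pos h]
    infer_instance
  exact zero_ne_one (𝒟.equiv.injective (Subsingleton.elim (𝒟.equiv 0) (𝒟.equiv 1)))

end TensorDecomposition

end Conclusion

end GradedMatrix

theorem proposition1 {F : Type*} [Field F] [IsAlgClosed F] (hchar : ringChar F ≠ 2)
    {G : Type*} [AddCommGroup G] [Finite G] [DecidableEq G] {n : ℕ} (hn : 0 < n)
    (𝒜 : G → Submodule F (Matrix (Fin n) (Fin n) F)) [GradedAlgebra 𝒜]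
    (φ : Matrix (Fin n) (Fin n) F ≃ₐ[F] (Matrix (Fin n) (Fin n) F)ᵐᵒᵖ)
    (hgraded : ∀ g, ∀ X ∈ 𝒜 g, (φ X).unop ∈ 𝒜 g)
    (horder : ∀ X ∈ 𝒜 0, (φ (φ X).unop).unop = X) :
    -- `R` is isomorphic, as a graded algebra, to a tensor product `C ⊗ D`
    Nonempty (GradedMatrix.TensorDecomposition 𝒜) ∧
    -- and for each such isomorphism
    ∀ 𝒟 : GradedMatrix.TensorDecomposition 𝒜,
      -- `D` is a tensor product of `2 × 2` matrix algebras with `(-1)`-gradings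
      (∀ l, 𝒟.N l = 2) ∧
      -- and after a change of basis by an invertible element of `C_e`
      ∃ P : 𝒟.Cˣ, (P : 𝒟.C) ∈ 𝒟.Ce ∧
      ∃ (k : ℕ) (B : Fin k → NonUnitalSubalgebra F 𝒟.C)
        (S Y : Fin k → 𝒟.C) (Q : Fin k → 𝒟.D),
        -- `C_e` is the direct sum of the `*`-simple algebras `B i`
        (iSupIndep fun i => (B i).toSubmodule) ∧
        (⨆ i, (B i).toSubmodule) = 𝒟.Ce ∧
        (∀ i j, i ≠ j → ∀ x ∈ B i, ∀ y ∈ B j, x * y = 0) ∧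
        (∀ i, GradedMatrix.IsStarSimple (𝒟.transport P φ) (B i)) ∧
        -- `S i` is the normal form of the involution on `B i`
        (∀ i, GradedMatrix.IsNormalBlock (B i) (S i)) ∧
        IsUnit (∑ i, S i) ∧
        (∀ X ∈ 𝒟.Ce, 𝒟.transport P φ (Matrix.kronecker X (1 : 𝒟.D)) =
          Matrix.kronecker ((∑ i, S i)⁻¹ * X.transpose * ∑ i, S i) (1 : 𝒟.D)) ∧
        -- `Y i` lies in the center of `B i`
        (∀ i, Y i ∈ B i ∧ ∀ b ∈ B i, Y i * b = b * Y i) ∧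
        (∀ i, IsUnit (Q i) ∧
          ((Q i).transpose⁻¹ * Q i = 1 ∨ (Q i).transpose⁻¹ * Q i = -1)) ∧
        -- `Φ = S_1 Y_1 ⊗ Q_1 + ⋯ + S_k Y_k ⊗ Q_k` defines `φ`
        IsUnit (∑ i, Matrix.kronecker (S i * Y i) (Q i)) ∧
        ∀ X : 𝒟.CD, 𝒟.transport P φ X =
          (∑ i, Matrix.kronecker (S i * Y i) (Q i))⁻¹ * X.transpose *
            ∑ i, Matrix.kronecker (S i * Y i) (Q i) := by
  refine ⟨GradedMatrix.nonempty_tensorDecomposition hn 𝒜, fun 𝒟 => ?_⟩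
  have hNZ : ∀ l, NeZero (𝒟.N l) := fun l => ⟨(zero_lt_one.trans (𝒟.one_lt_N l)).ne'⟩
  have hκ : Nonempty (∀ l, Fin (𝒟.N l)) := ⟨fun l => ⟨0, NeZero.pos _⟩⟩
  -- the classes of indices are indexed by the elements of the tuple
  set cl : Fin 𝒟.m → Set.range 𝒟.tuple := Set.rangeFactorization 𝒟.tuple with hcl_def
  have hcl : Function.Surjective cl := Set.rangeFactorization_surjective
  have hγ : Function.Injective (Subtype.val : Set.range 𝒟.tuple → G) := Subtype.val_injective
  have hclγ : ∀ i, (cl i : G) = 𝒟.tuple i := fun _ => rfl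
  have hW : Nonempty (Set.range 𝒟.tuple) := ⟨cl ⟨0, 𝒟.pos hn⟩⟩
  have hCe : ∀ X : 𝒟.C, X ∈ 𝒟.Ce ↔ GradedMatrix.ClassShift cl id X := fun X =>
    GradedMatrix.mem_elementaryComponent_zero_iff hγ hclγ
  set ψ : 𝒟.CD → 𝒟.CD := fun Z => 𝒟.equiv (φ (𝒟.equiv.symm Z)).unop with hψ_def
  obtain ⟨Φ, hΦ, hψ⟩ := GradedMatrix.exists_transpose_conj
    ((𝒟.equiv.symm.trans φ).trans (AlgEquiv.op 𝒟.equiv))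
  replace hψ : ∀ Z : 𝒟.CD, Z.transpose * Φ = Φ * ψ Z := hψ
  have hψgr : ∀ h, ∀ Z ∈ GradedMatrix.tensorComponent
      (GradedMatrix.elementaryComponent F 𝒟.tuple) (GradedMatrix.fineComponent 𝒟.ε 𝒟.deg) h,
      ψ Z ∈ GradedMatrix.tensorComponent (GradedMatrix.elementaryComponent F 𝒟.tuple)
        (GradedMatrix.fineComponent 𝒟.ε 𝒟.deg) h := by
    intro h Z hZ
    rw [𝒟.mem_tensorComponent_iff_symm_mem] at hZ ⊢
    rw [hψ_def]
    simpa using hgraded h _ hZ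
  -- `φ` induces an involution `star` of `C_e`, since `C_e ⊗ I` is the identity component
  have hstar : ∀ X : 𝒟.C, ∃ X' : 𝒟.C, GradedMatrix.ClassShift cl id X →
      GradedMatrix.ClassShift cl id X' ∧ ψ (X ⊗ₖ 1) = X' ⊗ₖ 1 := by
    intro X
    by_cases hX : GradedMatrix.ClassShift cl id X
    · obtain ⟨X', hX', h⟩ := GradedMatrix.exists_of_mem_tensorComponent_zero 𝒟.deg_injective
        𝒟.support_inter (hψgr 0 _ (GradedMatrix.kronecker_one_mem_tensorComponent_zero
          ((hCe X).2 hX)))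
      exact ⟨X', fun _ => ⟨(hCe X').1 hX', h⟩⟩
    · exact ⟨0, fun h => absurd h hX⟩
  choose star hstar using hstar
  have hstar2 : ∀ X, GradedMatrix.ClassShift cl id X → star (star X) = X := by
    intro X hX
    apply GradedMatrix.kronecker_one_injective (κ := ∀ l, Fin (𝒟.N l))
    rw [← (hstar _ (hstar X hX).1).2, ← (hstar X hX).2, hψ_def]
    have h := 𝒟.mem_tensorComponent_iff_symm_mem.1
      (GradedMatrix.kronecker_one_mem_tensorComponent_zero ((hCe X).2 hX))
    simp [horder _ h]
  obtain ⟨σ, k, o, s, Q, Q', S, hσ, hs, ho, hQ, hQ', hQQ', hnf, hSo, hS, hSσ, hstarS⟩ :=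
    GradedMatrix.exists_normal_form_of_involution (Ring.two_ne_zero hchar) hcl hΦ
      (star := star) (fun X hX => by
        rw [← (hstar X hX).2, ← hψ, ← Matrix.kroneckerMap_transpose, Matrix.transpose_one])
      (fun X hX => (hstar X hX).1) hstar2
  have hQ'Q : Q' * Q = 1 := mul_eq_one_comm.1 hQQ'
  let P : 𝒟.Cˣ := ⟨Q', Q, hQ'Q, hQQ'⟩
  have htr : ∀ Z, 𝒟.transport P φ Z =
      Q' ⊗ₖ 1 * ψ (Q ⊗ₖ 1 * Z * Q' ⊗ₖ 1) * Q ⊗ₖ (1 : 𝒟.D) := fun _ => rfl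
  have hkron : ∀ A : 𝒟.C, IsUnit A → IsUnit (A ⊗ₖ (1 : 𝒟.D)) := by
    rintro A ⟨⟨A, A', h1, -⟩, rfl⟩
    refine IsUnit.of_mul_eq_one (A' ⊗ₖ 1) ?_
    rw [← Matrix.mul_kronecker_mul, h1, mul_one, Matrix.one_kronecker_one]
  have hQu : IsUnit Q := IsUnit.of_mul_eq_one _ hQQ'
  -- after the conjugation by `P ⊗ I`, the antiautomorphism is given by a matrix congruent to `Φ`
  have hΦ' : IsUnit (Q.transpose ⊗ₖ (1 : 𝒟.D) * Φ * Q ⊗ₖ (1 : 𝒟.D)) :=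
    ((hkron _ ((Matrix.isUnit_transpose Q).2 hQu)).mul hΦ).mul (hkron _ hQu)
  have hψ' : ∀ Z, Z.transpose * (Q.transpose ⊗ₖ (1 : 𝒟.D) * Φ * Q ⊗ₖ (1 : 𝒟.D)) =
      Q.transpose ⊗ₖ (1 : 𝒟.D) * Φ * Q ⊗ₖ (1 : 𝒟.D) * 𝒟.transport P φ Z :=
    GradedMatrix.transpose_mul_conj hψ hQQ'
  have htrS : ∀ X, GradedMatrix.ClassShift cl id X → 𝒟.transport P φ (X ⊗ₖ (1 : 𝒟.D)) =
      ((∑ v, S v)⁻¹ * X.transpose * ∑ v, S v) ⊗ₖ (1 : 𝒟.D) := by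
    intro X hX
    rw [← hstarS X hX, htr, ← Matrix.mul_kronecker_mul, ← Matrix.mul_kronecker_mul, mul_one,
      mul_one, (hstar _ ((hQ.mul hX).mul hQ')).2, ← Matrix.mul_kronecker_mul,
      ← Matrix.mul_kronecker_mul, mul_one, mul_one]
  have htrgr : ∀ h, ∀ Z ∈ GradedMatrix.tensorComponent
      (GradedMatrix.elementaryComponent F 𝒟.tuple) (GradedMatrix.fineComponent 𝒟.ε 𝒟.deg) h,
      𝒟.transport P φ Z ∈ GradedMatrix.tensorComponent
        (GradedMatrix.elementaryComponent F 𝒟.tuple)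
        (GradedMatrix.fineComponent 𝒟.ε 𝒟.deg) h := by
    intro h Z hZ
    rw [htr]
    refine GradedMatrix.mul_kronecker_one_mem_tensorComponent ((hCe _).2 hQ)
      (GradedMatrix.kronecker_one_mul_mem_tensorComponent ((hCe _).2 hQ') (hψgr h _ ?_))
    exact GradedMatrix.mul_kronecker_one_mem_tensorComponent ((hCe _).2 hQ')
      (GradedMatrix.kronecker_one_mul_mem_tensorComponent ((hCe _).2 hQ) hZ)
  obtain ⟨hN2, Y, D, hY, hD, hsum⟩ := GradedMatrix.exists_sum_kronecker hclγ hcl hW 𝒟.one_lt_N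
    𝒟.isPrimitiveRoot 𝒟.deg_injective hσ hs ho hSo hS hSσ hΦ' hψ' htrS htrgr
  have hSdet := (Matrix.isUnit_iff_isUnit_det _).1 hS
  have hSi : GradedMatrix.ClassShift cl σ (∑ v, S v)⁻¹ :=
    hSσ.inverse hσ (Matrix.mul_nonsing_inv _ hSdet)
  refine ⟨hN2, P, (hCe _).2 hQ', k, fun v => GradedMatrix.orbitAlgebra F cl o v, S, Y, D,
    GradedMatrix.iSupIndep_orbitAlgebra, ?_,
    fun v v' hv x hx y hy => GradedMatrix.orbitAlgebra_mul_eq_zero hv hx hy, fun v => ?_, hnf, hS,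
    fun X hX => htrS X ((hCe X).1 hX), hY, hD, ?_, fun Z => ?_⟩
  · ext X
    rw [hCe]
    exact GradedMatrix.iSup_orbitAlgebra X
  · refine GradedMatrix.isStarSimple_orbitAlgebra hcl hσ hs ho htrS (fun X i j hij => ?_)
      (fun X hX => ?_) v
    · rw [Matrix.mul_apply] at hij
      obtain ⟨b, -, hb⟩ := Finset.exists_ne_zero_of_sum_ne_zero hij
      have hb1 := left_ne_zero_of_mul hb
      rw [Matrix.mul_apply] at hb1
      obtain ⟨a, -, ha⟩ := Finset.exists_ne_zero_of_sum_ne_zero hb1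
      exact ⟨a, b, right_ne_zero_of_mul ha, hSi i a (left_ne_zero_of_mul ha),
        hSσ b j (right_ne_zero_of_mul hb)⟩
    · have hX1 := (hQ.mul hX).mul hQ'
      have hX2 : GradedMatrix.ClassShift cl id (Q' * star (Q * X * Q') * Q) :=
        (hQ'.mul (hstar _ hX1).1).mul hQ
      rw [← hstarS X hX, ← hstarS _ hX2]
      have h1 : Q * (Q' * star (Q * X * Q') * Q) * Q' = star (Q * X * Q') := by
        rw [mul_assoc, mul_assoc _ Q, hQQ', mul_one, ← mul_assoc, hQQ', one_mul]
      rw [h1, hstar2 _ hX1, mul_assoc, mul_assoc _ Q', hQ'Q, mul_one, ← mul_assoc, hQ'Q, one_mul]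
  · exact hsum ▸ hΦ'
  · have h1 := hψ' Z
    rw [hsum] at h1 hΦ'
    calc 𝒟.transport P φ Z = (∑ v, (S v * Y v) ⊗ₖ D v)⁻¹ *
          ((∑ v, (S v * Y v) ⊗ₖ D v) * 𝒟.transport P φ Z) := by
          rw [← mul_assoc, Matrix.nonsing_inv_mul _ ((Matrix.isUnit_iff_isUnit_det _).1 hΦ'),
            one_mul]
      _ = _ := by
          rw [← h1, ← mul_assoc]
          rfl
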